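/- Let $n\ge 0$. A linear XEB scheme $(S,\mu,\phi,M,\rho_0)$ on $n$ qubits consists of a set $S\subseteq SU(2^n)$, a probability distribution $\mu$ on $S$, a (measurable) implementation map $\phi$ assigning to each $g\in S$ a quantum channel (completely positive trace-preserving map) $\phi(g)$ on $n$ qubits, a POVM $M=\{M_x\}_{x\in\{0,1\}^n}$ and a state $\rho_0$. For $m\ge 0$ put $$q_R(m)=-1+2^n\,\mathbb{E}_{g_1,\dots,g_m\sim\mu}\Big[\sum_{x\in\{0,1\}^n}|\langle x|g_m\cdots g_1|0^n\rangle|^2\ \mathrm{tr}\big[M_x\,(\phi(g_m)\circ\cdots\circ\phi(g_1))(\rho_0)\big]\Big],$$ where $g_1,\dots,g_m$ are i.i.d. Write $\omega(g):\rho\mapsto g\rho g^\dagger$, let $\|\cdot\|_\diamond$ be the diamond norm, and for a linear map $\Lambda$ on the real space of linear operators $\mathcal C$ on Hermitian $2^n\times 2^n$ matrices let $|||\Lambda|||_\diamond=\max_{\mathcal C\neq 0}\|\Lambda(\mathcal C)\|_\diamond/\|\mathcal C\|_\diamond$. Let $\Lambda(\mu):\mathcal C\mapsto\int \omega(g^\dagger)\circ\mathcal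 C\circ\omega(g)\,d\mu(g)$ be the twirling map of $\mu$, and let $\mu_H$ be the Haar probability measure on $SU(2^n)$. **Theorem.** Let $(S,\mu,\phi,M,\rho_0)$ be a linear XEB scheme on $n$ qubits and let $\gamma,\delta\in\mathbb{R}$. Suppose that $\mu$ gives a $\gamma$-approximate twirl, i.e. $|||\Lambda(\mu)-\Lambda(\mu_H)|||_\diamond\le\gamma$, that $\mathbb{E}_{g\sim\mu}\|\phi(g)-\omega(g)\|_\diamond\le\delta$, and that $\delta\le\frac{1-\gamma}{11}$. Then there exist $A,B\in\mathbb{R}$ and $p\in[1-2\delta,1]$ such that $$|q_R(m)-(A+Bp^m)|\le 16\cdot 2^n(\gamma+6\delta)^m\qquad\text{for all integers } m\ge 0,$$ and, if $p<1$, then moreover $A=0$ and $|B|\le 128$. -/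

import Mathlib

open MeasureTheory
open scoped Matrix ComplexOrder

noncomputable section

namespace XEB

/-! ### Operators and superoperators on `n` qubits -/

/-- Bit strings `{0,1}^n`, the labels of the computational basis of `n` qubits. -/
abbrev Bits (n : ℕ) : Type := Fin n → Fin 2

/-- Linear operators on `(ℂ²)^{⊗ n}`, as matrices in the computational basis. -/
abbrev Op (n : ℕ) : Type := Matrix (Bits n) (Bits n) ℂ

/-- Complex-linear maps on operators. -/
abbrev Superop (n : ℕ) : Type := Op n →ₗ[ℂ] Op n

/-- The special unitary group `SU(2^n)`. -/
abbrev SU (n : ℕ) : Type := ↥(Matrix.specialUnitaryGroup (Bits n) ℂ)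

/-- `C` maps Hermitian operators to Hermitian operators. By complexification, these superoperators
are exactly the real-linear operators on the space of Hermitian matrices. -/
def IsHermitianPreserving {n : ℕ} (C : Superop n) : Prop :=
  ∀ X : Op n, X.IsHermitian → (C X).IsHermitian

/-- The map `ρ ↦ U ρ U†`. -/
def conjMap {n : ℕ} (U : Op n) : Superop n where
  toFun ρ := U * ρ * Uᴴ
  map_add' ρ σ := by rw [Matrix.mul_add, Matrix.add_mul]
  map_smul' c ρ := by simp

/-- The unitary channel `ω(g) : ρ ↦ g ρ g†`. -/
def omega {n : ℕ} (g : SU n) : Superop n := conjMap (g : Op n)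

/-- The action `id ⊗ C` of `C` on operators of a `k`-dimensional ancilla together with
the `n` qubits. -/
def ampliate {n : ℕ} (k : ℕ) (C : Superop n) (X : Matrix (Fin k × Bits n) (Fin k × Bits n) ℂ) :
    Matrix (Fin k × Bits n) (Fin k × Bits n) ℂ :=
  Matrix.of fun a b => C (Matrix.of fun i j => X (a.1, i) (b.1, j)) a.2 b.2

/-- Quantum channels: completely positive trace-preserving maps. -/
structure IsChannel {n : ℕ} (C : Superop n) : Prop where
  completelyPositive : ∀ (k : ℕ) (X : Matrix (Fin k × Bits n) (Fin k × Bits n) ℂ),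
    X.PosSemidef → (ampliate k C X).PosSemidef
  tracePreserving : ∀ X : Op n, (C X).trace = X.trace

/-! ### Norms -/

/-- The trace norm: the sum of the singular values, that is, of the square roots of
the eigenvalues of `X† X`. -/
def traceNorm {ι : Type*} [Fintype ι] [DecidableEq ι] (X : Matrix ι ι ℂ) : ℝ :=
  ∑ i, Real.sqrt ((Matrix.isHermitian_conjTranspose_mul_self X).eigenvalues i)

/-- The diamond norm: the supremum of `‖(id_k ⊗ C)(X)‖₁` over all ancilla dimensions `k`
and all `X` with `‖X‖₁ ≤ 1`. -/
def diamondNorm {n : ℕ} (C : Superop n) : ℝ :=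
  sSup {r : ℝ | ∃ (k : ℕ) (X : Matrix (Fin k × Bits n) (Fin k × Bits n) ℂ),
    traceNorm X ≤ 1 ∧ r = traceNorm (ampliate k C X)}

/-- The induced diamond norm of a map on Hermitian-preserving superoperators: the supremum of
`‖L(C)‖_⋄ / ‖C‖_⋄`. -/
def inducedDiamondNorm {n : ℕ} (L : Superop n → Superop n) : ℝ :=
  sSup {r : ℝ | ∃ C : Superop n, IsHermitianPreserving C ∧
    r = diamondNorm (L C) / diamondNorm C}

/-! ### Haar measure on `SU(2^n)` and twirling maps -/

/-- The Borel sigma-algebra on `SU(2^n)`. -/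
instance instMeasurableSpaceSU (n : ℕ) : MeasurableSpace (SU n) := borel (SU n)

instance instBorelSpaceSU (n : ℕ) : BorelSpace (SU n) := ⟨rfl⟩

instance instIsTopologicalGroupSU (n : ℕ) : IsTopologicalGroup (SU n) where
  continuous_mul := by
    refine Continuous.subtype_mk ?_ _
    exact (continuous_subtype_val.comp continuous_fst).mul
      (continuous_subtype_val.comp continuous_snd)
  continuous_inv := by
    refine Continuous.subtype_mk ?_ _
    exact Continuous.matrix_conjTranspose continuous_subtype_val

instance instCompactSpaceSU (n : ℕ) : CompactSpace (SU n) := by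
  refine isCompact_iff_compactSpace.mp ?_
  have hK : IsCompact
      (Set.pi Set.univ fun _ : Bits n =>
        (Set.pi Set.univ fun _ : Bits n => Metric.closedBall (0 : ℂ) 1)) :=
    isCompact_univ_pi fun _ => isCompact_univ_pi fun _ => isCompact_closedBall 0 1
  refine IsCompact.of_isClosed_subset (s := (Set.pi Set.univ fun _ : Bits n =>
        (Set.pi Set.univ fun _ : Bits n => Metric.closedBall (0 : ℂ) 1))) hK ?_ ?_
  · have h : (Matrix.specialUnitaryGroup (Bits n) ℂ : Set (Op n))
        = {A : Op n | A * Aᴴ = 1} ∩ {A : Op n | A.det = 1} := by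
      ext A
      simp only [SetLike.mem_coe, Matrix.mem_specialUnitaryGroup_iff,
        Matrix.mem_unitaryGroup_iff, Set.mem_inter_iff, Set.mem_ofPred_eq]
      rfl
    change IsClosed (Matrix.specialUnitaryGroup (Bits n) ℂ : Set (Op n))
    rw [h]
    refine IsClosed.inter (isClosed_eq ?_ continuous_const) (isClosed_eq ?_ continuous_const)
    · exact continuous_id.mul (Continuous.matrix_conjTranspose continuous_id)
    · exact Continuous.matrix_det continuous_id
  · intro A hA i _ j _
    rw [mem_closedBall_zero_iff]
    exact entry_norm_bound_of_unitary (Matrix.specialUnitaryGroup_le_unitaryGroup hA) i j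

/-- The Haar probability measure on `SU(2^n)`. -/
def haarSU (n : ℕ) : Measure (SU n) := Measure.haarMeasure ⊤

instance instIsProbabilityMeasureHaarSU (n : ℕ) : IsProbabilityMeasure (haarSU n) :=
  ⟨Measure.haarMeasure_self⟩

theorem continuous_twirl_entry {n : ℕ} (C : Superop n) (ρ : Op n) (i j : Bits n) :
    Continuous fun g : SU n => (omega g⁻¹ ∘ₗ C ∘ₗ omega g) ρ i j := by
  have hg : Continuous fun g : SU n => (g : Op n) := continuous_subtype_val
  have hginv : Continuous fun g : SU n => ((g⁻¹ : SU n) : Op n) := hg.comp continuous_inv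
  have hC : Continuous fun X : Op n => C X := C.continuous_of_finiteDimensional
  have hin : Continuous fun g : SU n => C ((g : Op n) * ρ * (g : Op n)ᴴ) :=
    hC.comp ((hg.matrix_mul continuous_const).matrix_mul hg.matrix_conjTranspose)
  exact ((hginv.matrix_mul hin).matrix_mul hginv.matrix_conjTranspose).matrix_elem i j

theorem integrable_twirl_entry {n : ℕ} (μ : Measure (SU n)) [IsProbabilityMeasure μ]
    (C : Superop n) (ρ : Op n) (i j : Bits n) :
    Integrable (fun g : SU n => (omega g⁻¹ ∘ₗ C ∘ₗ omega g) ρ i j) μ :=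
  (continuous_twirl_entry C ρ i j).integrable_of_hasCompactSupport
    (HasCompactSupport.of_compactSpace _)

/-- The twirling map `Λ(μ) : C ↦ ∫ ω(g†) ∘ C ∘ ω(g) dμ(g)`; the integral is taken entrywise. -/
def twirl {n : ℕ} (μ : Measure (SU n)) [IsProbabilityMeasure μ] (C : Superop n) : Superop n where
  toFun ρ := Matrix.of fun i j => ∫ g, (omega g⁻¹ ∘ₗ C ∘ₗ omega g) ρ i j ∂μ
  map_add' ρ σ := by
    ext i j
    simp only [Matrix.of_apply, Matrix.add_apply, map_add]
    exact integral_add (integrable_twirl_entry μ C ρ i j) (integrable_twirl_entry μ C σ i j)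
  map_smul' c ρ := by
    ext i j
    simp only [Matrix.of_apply, Matrix.smul_apply, map_smul, RingHom.id_apply, smul_eq_mul]
    exact integral_const_mul c _

/-- `Λ(μ)` is a `γ`-approximate twirl (in induced diamond norm). -/
def IsApproxTwirl {n : ℕ} (μ : Measure (SU n)) [IsProbabilityMeasure μ] (γ : ℝ) : Prop :=
  inducedDiamondNorm (fun C => twirl μ C - twirl (haarSU n) C) ≤ γ

/-! ### Linear XEB schemes -/

/-- A linear XEB scheme `(S, μ, φ, M, ρ₀)` on `n` qubits. -/
structure LinearXEB (n : ℕ) where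
  /-- the gate set `S ⊆ SU(2^n)` -/
  S : Set (SU n)
  /-- the distribution of the gates -/
  μ : Measure S
  isProbabilityMeasure_μ : IsProbabilityMeasure μ
  /-- the noisy implementation of the gates -/
  φ : S → Superop n
  isChannel_φ : ∀ g, IsChannel (φ g)
  measurable_φ : ∀ (ρ : Op n) (i j : Bits n), Measurable fun g => φ g ρ i j
  /-- the noisy measurement -/
  M : Bits n → Op n
  posSemidef_M : ∀ x, (M x).PosSemidef
  sum_M : ∑ x, M x = 1
  /-- the noisy initial state -/
  ρ₀ : Op n
  posSemidef_ρ₀ : ρ₀.PosSemidef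
  trace_ρ₀ : ρ₀.trace = 1

attribute [instance] LinearXEB.isProbabilityMeasure_μ

namespace LinearXEB

variable {n : ℕ} (X : LinearXEB n)

/-- The gate distribution as a measure on `SU(2^n)`. -/
def gateLaw : Measure (SU n) := X.μ.map Subtype.val

instance instIsProbabilityMeasureGateLaw : IsProbabilityMeasure X.gateLaw :=
  Measure.isProbabilityMeasure_map measurable_subtype_coe.aemeasurable

/-- The average implementation error `E_{g ∼ μ} ‖φ(g) - ω(g)‖_⋄`. -/
def avgError : ℝ := ∫ g, diamondNorm (X.φ g - omega (g : SU n)) ∂X.μ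

/-- The ideal circuit `g_m ⋯ g_2 g_1`. -/
def idealCircuit {m : ℕ} (g : Fin m → X.S) : SU n :=
  ((List.ofFn fun i => (g i : SU n)).reverse).prod

/-- The noisy circuit `φ(g_m) ∘ ⋯ ∘ φ(g_2) ∘ φ(g_1)` (multiplication of endomorphisms is
composition). -/
def noisyCircuit {m : ℕ} (g : Fin m → X.S) : Superop n :=
  ((List.ofFn fun i => (X.φ (g i) : Module.End ℂ (Op n))).reverse).prod

/-- `|⟨x| g_m ⋯ g_1 |0^n⟩|²`, the probability of `x` in the ideal circuit. -/
def idealProb {m : ℕ} (g : Fin m → X.S) (x : Bits n) : ℝ :=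
  ‖(X.idealCircuit g : Op n) x 0‖ ^ 2

/-- `tr[M_x (φ(g_m) ∘ ⋯ ∘ φ(g_1))(ρ₀)]`, the probability of `x` in the noisy circuit. -/
def noisyProb {m : ℕ} (g : Fin m → X.S) (x : Bits n) : ℝ :=
  (X.M x * X.noisyCircuit g X.ρ₀).trace.re

/-- The linear XEB quantity after `m` cycles,
`q_R(m) = -1 + 2^n E_{g_1, …, g_m ∼ μ} [∑_x |⟨x| g_m ⋯ g_1 |0^n⟩|² p̃(x)]`. -/
def qR (m : ℕ) : ℝ :=
  -1 + 2 ^ n * ∫ g : Fin m → X.S, (∑ x, X.idealProb g x * X.noisyProb g x)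
    ∂(Measure.pi fun _ => X.μ)

end LinearXEB

end XEB

end

noncomputable section

namespace XEB

/-! ### The trace norm -/

section TraceNorm

open scoped Matrix.Norms.L2Operator

set_option linter.unusedSectionVars false

variable {ι κ : Type*} [Fintype ι] [DecidableEq ι] [Fintype κ] [DecidableEq κ]

/-! Write `T C = E[ω(g†) ∘ C ∘ φ(g)]` (`transfer`). Peeling off one gate at a time and using
independence, the average in `q_R(m)` is a matrix entry of `(T^m C)(ρ₀)`, where `C` is the
measure-and-prepare map of the POVM. Subtracting the completely depolarizing channel, which `T`
fixes, absorbs the `-1` (`qR_eq_signal`). What remains, the signal, lies in the real space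
`errorSpace` of Hermitian-preserving maps with traceless range, normed by the diamond norm.

On that space `T` is within `δ` of the twirl `Λ(μ)`, hence within `γ + δ` of the Haar twirl. By a
Schur-type argument the Haar twirl is there a rank-one projection onto the line of `E₀ = id -
depolarizing` (`twirl_haarSU_eq`). Since `δ` is small against `1 - γ`, perturbation theory gives `T`
one isolated eigenvalue `p ∈ [1 - 2δ, 1]` with right eigenvector `E` and left eigenfunctional `L`,
and `T^m v = p^m L(v) E` up to an error `O((γ + 3δ)^m)` (`exists_eigenvalue_of_perturbation`). This
is the decay, with `A = 0` and `B = 2^n L(signal) Re⟨0|E(ρ₀)|0⟩`.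

To bound `B` independently of `n` one needs `L(signal) = O(2^{-n})`, which the diamond norm does not
yield. A second norm does: the diamond norm of the reshuffled map, where reshuffling sends `X ↦
tr(bX) a` to `X ↦ a X b`. In it the unperturbed functional, the superoperator trace over `4^n - 1`,
has size `2^n / (4^n - 1)` (`norm_superTrace_le`), while the signal has size `O(1)`
(`reshuffleNorm_signal_le`). `L` inherits the bound (`abs_eigenfunctional_le`) because the
hypotheses survive the change of norm: reshuffling commutes with twirling, and `T - Λ(μ)` is still
of order `δ`.

The last point is `diamondNorm_reshuffle_comp_le`: precomposition with a Hermitian-preserving `Ψ`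
costs at most `‖Ψ‖_⋄` after reshuffling. It combines a row-column estimate
(`norm_sum_trace_mul_amp_le`) with a signed Kraus decomposition of `Ψ` of total weight arbitrarily
close to `‖Ψ‖_⋄` (`exists_signed_kraus`), obtained from a Hahn–Banach duality for Choi matrices. -/

theorem norm_mulVec_apply_le (A : Matrix κ ι ℂ) (v : ι → ℂ) (i : κ) :
    ‖(A *ᵥ v) i‖ ≤ ‖A‖ * √(∑ j, ‖v j‖ ^ 2) := by
  have h := Matrix.l2_opNorm_mulVec A (WithLp.toLp 2 v)
  rw [EuclideanSpace.norm_eq (WithLp.toLp 2 v)] at h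
  refine le_trans ?_ h
  exact PiLp.norm_apply_le (p := 2) (WithLp.toLp 2 (A *ᵥ v)) i

theorem norm_entry_le_opNorm (A : Matrix κ ι ℂ) (i : κ) (j : ι) : ‖A i j‖ ≤ ‖A‖ := by
  have h := norm_mulVec_apply_le A (Pi.single j 1) i
  have h2 : ∑ k, ‖(Pi.single j (1 : ℂ) : ι → ℂ) k‖ ^ 2 = 1 := by
    rw [Finset.sum_eq_single j] <;> simp +contextual
  simpa [h2] using h

theorem opNorm_unitary_le_one {U : Matrix ι ι ℂ} (hU : U ∈ Matrix.unitaryGroup ι ℂ) : ‖U‖ ≤ 1 := by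
  have h : ‖Uᴴ * U‖ = ‖U‖ * ‖U‖ := Matrix.l2_opNorm_conjTranspose_mul_self U
  have h1 : Uᴴ * U = 1 := Matrix.mem_unitaryGroup_iff'.mp hU
  rcases isEmpty_or_nonempty ι with hι | hι
  · have : U = 0 := by ext i; exact isEmptyElim i
    simp [this]
  · rw [h1, CStarRing.norm_one] at h
    nlinarith [norm_nonneg U]

theorem opNorm_one_le : ‖(1 : Matrix ι ι ℂ)‖ ≤ 1 :=
  opNorm_unitary_le_one (Matrix.unitaryGroup ι ℂ).one_mem

theorem opNorm_le_one_of_mul_conjTranspose_eq {Y : Matrix ι κ ℂ} (s : ι → ℂ)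
    {U : Matrix ι ι ℂ} (hU : U ∈ Matrix.unitaryGroup ι ℂ)
    (hs : ∀ i, ‖s i‖ ≤ 1) (h : Y * Yᴴ = U * Matrix.diagonal s * Uᴴ) : ‖Y‖ ≤ 1 := by
  have h1 : ‖Yᴴᴴ * Yᴴ‖ = ‖Yᴴ‖ * ‖Yᴴ‖ := Matrix.l2_opNorm_conjTranspose_mul_self Yᴴ
  rw [Matrix.conjTranspose_conjTranspose, Matrix.l2_opNorm_conjTranspose, h] at h1
  have h2 : ‖U * Matrix.diagonal s * Uᴴ‖ ≤ 1 := by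
    have hd : ‖(Matrix.diagonal s : Matrix ι ι ℂ)‖ ≤ 1 := by
      rw [Matrix.l2_opNorm_diagonal]
      exact (pi_norm_le_iff_of_nonneg zero_le_one).2 hs
    have hu := opNorm_unitary_le_one hU
    have hu' : ‖Uᴴ‖ ≤ 1 := by rwa [Matrix.l2_opNorm_conjTranspose]
    calc ‖U * Matrix.diagonal s * Uᴴ‖ ≤ ‖U * Matrix.diagonal s‖ * ‖Uᴴ‖ := Matrix.l2_opNorm_mul _ _
      _ ≤ (‖U‖ * ‖(Matrix.diagonal s : Matrix ι ι ℂ)‖) * ‖Uᴴ‖ := by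
          gcongr; exact Matrix.l2_opNorm_mul _ _
      _ ≤ (1 * 1) * 1 := by gcongr
      _ = 1 := by norm_num
  nlinarith [norm_nonneg Y]

theorem _root_.Matrix.IsHermitian.eq_unitary_mul_diagonal {H : Matrix ι ι ℂ} (hH : H.IsHermitian) :
    H = (hH.eigenvectorUnitary : Matrix ι ι ℂ)
      * Matrix.diagonal (fun i => (hH.eigenvalues i : ℂ))
      * (hH.eigenvectorUnitary : Matrix ι ι ℂ)ᴴ := by
  conv_lhs => rw [hH.spectral_theorem]
  rfl

theorem conjTranspose_eigenvectorUnitary_mul {H : Matrix ι ι ℂ} (hH : H.IsHermitian) :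
    (hH.eigenvectorUnitary : Matrix ι ι ℂ)ᴴ * (hH.eigenvectorUnitary : Matrix ι ι ℂ) = 1 :=
  Matrix.mem_unitaryGroup_iff'.mp hH.eigenvectorUnitary.2

theorem eigenvectorUnitary_mul_conjTranspose {H : Matrix ι ι ℂ} (hH : H.IsHermitian) :
    (hH.eigenvectorUnitary : Matrix ι ι ℂ) * (hH.eigenvectorUnitary : Matrix ι ι ℂ)ᴴ = 1 :=
  Matrix.mem_unitaryGroup_iff.mp hH.eigenvectorUnitary.2

theorem conjTranspose_mul_mul_eq_diagonal {H : Matrix ι ι ℂ} (hH : H.IsHermitian) :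
    (hH.eigenvectorUnitary : Matrix ι ι ℂ)ᴴ * H * (hH.eigenvectorUnitary : Matrix ι ι ℂ)
      = Matrix.diagonal (fun i => (hH.eigenvalues i : ℂ)) := by
  have h := hH.eq_unitary_mul_diagonal
  have h1 := conjTranspose_eigenvectorUnitary_mul hH
  set U := (hH.eigenvectorUnitary : Matrix ι ι ℂ)
  calc Uᴴ * H * U = (Uᴴ * U) * Matrix.diagonal (fun i => (hH.eigenvalues i : ℂ)) * (Uᴴ * U) := by
        conv_lhs => rw [h]
        simp only [Matrix.mul_assoc]
    _ = _ := by rw [h1, Matrix.one_mul, Matrix.mul_one]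

/-- In an eigenbasis of `X†X` the columns of `XU` have length `√λ_i`, so the `i`-th diagonal term of
`(U†Y)(XU)` is at most `‖Y‖ √λ_i`. -/
theorem norm_trace_mul_le (Y X : Matrix ι ι ℂ) : ‖(Y * X).trace‖ ≤ ‖Y‖ * traceNorm X := by
  have hH := Matrix.isHermitian_conjTranspose_mul_self X
  have hd := conjTranspose_mul_mul_eq_diagonal hH
  have hu := eigenvectorUnitary_mul_conjTranspose hH
  have hn : ‖(hH.eigenvectorUnitary : Matrix ι ι ℂ)ᴴ‖ ≤ 1 := by
    rw [Matrix.l2_opNorm_conjTranspose]; exact opNorm_unitary_le_one hH.eigenvectorUnitary.2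
  have htn : traceNorm X = ∑ i, √(hH.eigenvalues i) := rfl
  set U := (hH.eigenvectorUnitary : Matrix ι ι ℂ)
  have h1 : (Y * X).trace = ((Uᴴ * Y) * (X * U)).trace := by
    rw [Matrix.trace_mul_comm (Uᴴ * Y), ← Matrix.mul_assoc, Matrix.mul_assoc X, hu, Matrix.mul_one,
      Matrix.trace_mul_comm]
  have hcol : ∀ i, ∑ j, ‖(X * U) j i‖ ^ 2 = hH.eigenvalues i := by
    intro i
    have h2 : ((X * U)ᴴ * (X * U)) i i = (hH.eigenvalues i : ℂ) := by
      rw [Matrix.conjTranspose_mul, Matrix.mul_assoc, ← Matrix.mul_assoc Xᴴ, ← Matrix.mul_assoc, hd,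
        Matrix.diagonal_apply_eq]
    rw [Matrix.mul_apply] at h2
    have h3 : (((∑ j, ‖(X * U) j i‖ ^ 2 : ℝ)) : ℂ) = (hH.eigenvalues i : ℂ) := by
      rw [← h2]
      push_cast
      refine Finset.sum_congr rfl fun j _ => ?_
      rw [Matrix.conjTranspose_apply, Complex.star_def, ← Complex.normSq_eq_conj_mul_self,
        Complex.normSq_eq_norm_sq]
      push_cast; rfl
    exact_mod_cast h3
  rw [h1, htn, Finset.mul_sum, Matrix.trace]
  refine (norm_sum_le _ _).trans (Finset.sum_le_sum fun i _ => ?_)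
  have h4 := norm_mulVec_apply_le (Uᴴ * Y) (fun j => (X * U) j i) i
  rw [hcol i] at h4
  refine h4.trans ?_
  gcongr
  calc ‖Uᴴ * Y‖ ≤ ‖Uᴴ‖ * ‖Y‖ := Matrix.l2_opNorm_mul _ _
    _ ≤ 1 * ‖Y‖ := by gcongr
    _ = ‖Y‖ := one_mul _

/-- The witness is the adjoint of the polar part of `X`, that is `(X†X)^{-1/2} X†`. With
`norm_trace_mul_le` this makes the trace norm dual to the operator norm, so trace norms can be
bounded by testing against contractions. -/
theorem exists_trace_mul_eq_traceNorm (X : Matrix ι ι ℂ) :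
    ∃ Y : Matrix ι ι ℂ, ‖Y‖ ≤ 1 ∧ (Y * X).trace = traceNorm X := by
  have hH := Matrix.isHermitian_conjTranspose_mul_self X
  have hpos := Matrix.eigenvalues_conjTranspose_mul_self_nonneg X
  have hU := hH.eigenvectorUnitary.2
  have hd := conjTranspose_mul_mul_eq_diagonal hH
  have hu := conjTranspose_eigenvectorUnitary_mul hH
  have htn : traceNorm X = ∑ i, √(hH.eigenvalues i) := rfl
  set U := (hH.eigenvectorUnitary : Matrix ι ι ℂ)
  -- The convention `0⁻¹ = 0` makes `diag(s)` a pseudo-inverse, so the kernel of `X` needs no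
  -- separate treatment.
  set s : ι → ℂ := fun i => ((√(hH.eigenvalues i))⁻¹ : ℝ)
  have hsH : (Matrix.diagonal s)ᴴ = Matrix.diagonal s := by
    rw [Matrix.diagonal_conjTranspose]
    congr 1
    ext i
    simp [s]
  refine ⟨U * Matrix.diagonal s * Uᴴ * Xᴴ, ?_, ?_⟩
  · refine opNorm_le_one_of_mul_conjTranspose_eq
      (fun i => s i * (hH.eigenvalues i : ℂ) * s i) hU (fun i => ?_) ?_
    · rw [← Complex.ofReal_mul, ← Complex.ofReal_mul, Complex.norm_real]
      by_cases h0 : hH.eigenvalues i = 0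
      · simp [h0]
      · have hp : 0 < hH.eigenvalues i := lt_of_le_of_ne (hpos i) (Ne.symm h0)
        have h1 : √(hH.eigenvalues i) * √(hH.eigenvalues i) = hH.eigenvalues i :=
          Real.mul_self_sqrt hp.le
        have h2 : √(hH.eigenvalues i) ≠ 0 := (Real.sqrt_pos.2 hp).ne'
        have : (√(hH.eigenvalues i))⁻¹ * hH.eigenvalues i * (√(hH.eigenvalues i))⁻¹ = 1 := by
          field_simp
          nlinarith
        rw [this]; simp
    · calc U * Matrix.diagonal s * Uᴴ * Xᴴ * (U * Matrix.diagonal s * Uᴴ * Xᴴ)ᴴ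
          = U * Matrix.diagonal s * (Uᴴ * (Xᴴ * X) * U) * Matrix.diagonal s * Uᴴ := by
            simp only [Matrix.conjTranspose_mul, Matrix.conjTranspose_conjTranspose, hsH,
              Matrix.mul_assoc]
        _ = _ := by
            rw [hd]
            simp only [Matrix.mul_assoc, Matrix.diagonal_mul_diagonal]
  · calc (U * Matrix.diagonal s * Uᴴ * Xᴴ * X).trace
        = (Matrix.diagonal s * (Uᴴ * (Xᴴ * X) * U)).trace := by
          rw [Matrix.mul_assoc, Matrix.mul_assoc, Matrix.mul_assoc, Matrix.trace_mul_comm]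
          simp only [Matrix.mul_assoc]
      _ = ((∑ i, √(hH.eigenvalues i) : ℝ) : ℂ) := by
          rw [hd, Matrix.diagonal_mul_diagonal, Matrix.trace_diagonal, Complex.ofReal_sum]
          refine Finset.sum_congr rfl fun i _ => ?_
          rw [← Complex.ofReal_mul]
          congr 1
          rw [inv_mul_eq_div, Real.div_sqrt]

theorem traceNorm_nonneg (X : Matrix ι ι ℂ) : 0 ≤ traceNorm X :=
  Finset.sum_nonneg fun _ _ => Real.sqrt_nonneg _

theorem traceNorm_le {X : Matrix ι ι ℂ} {c : ℝ}
    (h : ∀ Y : Matrix ι ι ℂ, ‖Y‖ ≤ 1 → ‖(Y * X).trace‖ ≤ c) : traceNorm X ≤ c := by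
  obtain ⟨Y, hY, hX⟩ := exists_trace_mul_eq_traceNorm X
  have := h Y hY
  rwa [hX, Complex.norm_real, Real.norm_of_nonneg (traceNorm_nonneg X)] at this

theorem norm_trace_mul_le_of_le {X Y : Matrix ι ι ℂ} (hY : ‖Y‖ ≤ 1) :
    ‖(Y * X).trace‖ ≤ traceNorm X := by
  refine (norm_trace_mul_le Y X).trans ?_
  simpa using mul_le_mul_of_nonneg_right hY (traceNorm_nonneg X)

theorem traceNorm_smul_le (c : ℂ) (X : Matrix ι ι ℂ) : traceNorm (c • X) ≤ ‖c‖ * traceNorm X :=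
  traceNorm_le fun Y hY => by
    rw [Matrix.mul_smul, Matrix.trace_smul, norm_smul]
    exact mul_le_mul_of_nonneg_left (norm_trace_mul_le_of_le hY) (norm_nonneg _)

@[simp] theorem traceNorm_zero : traceNorm (0 : Matrix ι ι ℂ) = 0 :=
  le_antisymm (traceNorm_le fun Y _ => by simp) (traceNorm_nonneg _)

theorem traceNorm_smul (c : ℂ) (X : Matrix ι ι ℂ) : traceNorm (c • X) = ‖c‖ * traceNorm X := by
  refine le_antisymm (traceNorm_smul_le c X) ?_
  by_cases hc : c = 0
  · simp [hc]
  · have h := traceNorm_smul_le c⁻¹ (c • X)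
    rw [smul_smul, inv_mul_cancel₀ hc, one_smul, norm_inv] at h
    rwa [← le_inv_mul_iff₀ (norm_pos_iff.2 hc)]

theorem traceNorm_conjTranspose_le (X : Matrix ι ι ℂ) : traceNorm Xᴴ ≤ traceNorm X :=
  traceNorm_le fun Y hY => by
    have h : (Y * Xᴴ).trace = star (Yᴴ * X).trace := by
      rw [← Matrix.trace_conjTranspose, Matrix.conjTranspose_mul, Matrix.conjTranspose_conjTranspose,
        Matrix.trace_mul_comm]
    rw [h, norm_star]
    exact norm_trace_mul_le_of_le (by rwa [Matrix.l2_opNorm_conjTranspose])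

theorem traceNorm_conjTranspose (X : Matrix ι ι ℂ) : traceNorm Xᴴ = traceNorm X :=
  le_antisymm (traceNorm_conjTranspose_le X) (by
    simpa using traceNorm_conjTranspose_le Xᴴ)

theorem norm_entry_le_traceNorm (X : Matrix ι ι ℂ) (i j : ι) : ‖X i j‖ ≤ traceNorm X := by
  have hn : ‖(Matrix.single j i (1 : ℂ) : Matrix ι ι ℂ)‖ ≤ 1 := by
    refine opNorm_le_one_of_mul_conjTranspose_eq (Pi.single j 1)
      (Matrix.unitaryGroup ι ℂ).one_mem (fun k => ?_) ?_
    · by_cases h : k = j <;> simp [h]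
    · rw [Matrix.conjTranspose_single, Matrix.single_mul_single_same, Matrix.one_mul,
        Matrix.conjTranspose_one, Matrix.mul_one, Matrix.diagonal_single]
      simp
  have h := norm_trace_mul_le_of_le (X := X) hn
  rwa [Matrix.trace_single_mul, one_smul] at h

theorem traceNorm_le_trace {X : Matrix ι ι ℂ} (hX : X.PosSemidef) : traceNorm X ≤ X.trace.re := by
  have hH := hX.1
  have hu := opNorm_unitary_le_one hH.eigenvectorUnitary.2
  have hd := hH.eq_unitary_mul_diagonal
  have h1 := conjTranspose_eigenvectorUnitary_mul hH
  set U := (hH.eigenvectorUnitary : Matrix ι ι ℂ)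
  have htr : X.trace.re = ∑ i, hH.eigenvalues i := by
    rw [hH.trace_eq_sum_eigenvalues]; simp
  refine traceNorm_le fun Y hY => ?_
  have h2 : (Y * X).trace = ((Uᴴ * Y * U) * Matrix.diagonal (fun i => (hH.eigenvalues i : ℂ))).trace := by
    conv_lhs => rw [hd]
    rw [← Matrix.mul_assoc, Matrix.trace_mul_comm]
    simp only [Matrix.mul_assoc]
  have h3 : ‖Uᴴ * Y * U‖ ≤ 1 := by
    calc ‖Uᴴ * Y * U‖ ≤ ‖Uᴴ * Y‖ * ‖U‖ := Matrix.l2_opNorm_mul _ _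
      _ ≤ (‖Uᴴ‖ * ‖Y‖) * ‖U‖ := by gcongr; exact Matrix.l2_opNorm_mul _ _
      _ ≤ (1 * 1) * 1 := by rw [Matrix.l2_opNorm_conjTranspose]; gcongr
      _ = 1 := by norm_num
  rw [h2, htr, Matrix.trace]
  refine (norm_sum_le _ _).trans (Finset.sum_le_sum fun i _ => ?_)
  rw [Matrix.diag_apply, Matrix.mul_diagonal, norm_mul, Complex.norm_real,
    Real.norm_of_nonneg (hX.eigenvalues_nonneg i)]
  exact mul_le_of_le_one_left (hX.eigenvalues_nonneg i) ((norm_entry_le_opNorm _ i i).trans h3)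

theorem traceNorm_one_le : traceNorm (1 : Matrix ι ι ℂ) ≤ Fintype.card ι := by
  simpa using traceNorm_le_trace (Matrix.PosSemidef.one (n := ι) (R := ℂ))

/-- The isometry `ℂ^κ → ℂ^ι` of an injection, as a matrix. -/
def injMatrix (f : κ → ι) : Matrix ι κ ℂ := Matrix.of fun i k => if i = f k then 1 else 0

theorem injMatrix_conjTranspose_mul {f : κ → ι} (hf : Function.Injective f) :
    (injMatrix f)ᴴ * injMatrix f = 1 := by
  ext a b
  simp [injMatrix, Matrix.mul_apply, Matrix.one_apply, hf.eq_iff, eq_comm]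

theorem opNorm_injMatrix_le {f : κ → ι} (hf : Function.Injective f) : ‖injMatrix f‖ ≤ 1 := by
  have h := Matrix.l2_opNorm_conjTranspose_mul_self (injMatrix f)
  rw [injMatrix_conjTranspose_mul hf] at h
  have := opNorm_one_le (ι := κ)
  nlinarith [norm_nonneg (injMatrix f)]

theorem mul_injMatrix {τ : Type*} (A : Matrix τ ι ℂ) (f : κ → ι) :
    A * injMatrix f = A.submatrix id f := by
  ext a b
  simp [injMatrix, Matrix.mul_apply]

theorem conjTranspose_injMatrix_mul {τ : Type*} (A : Matrix ι τ ℂ) (f : κ → ι) :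
    (injMatrix f)ᴴ * A = A.submatrix f id := by
  ext a b
  simp [injMatrix, Matrix.mul_apply]

theorem opNorm_submatrix_right_le {τ : Type*} [Fintype τ] (A : Matrix τ ι ℂ) {f : κ → ι}
    (hf : Function.Injective f) : ‖A.submatrix id f‖ ≤ ‖A‖ := by
  rw [← mul_injMatrix]
  exact (Matrix.l2_opNorm_mul _ _).trans
    (mul_le_of_le_one_right (norm_nonneg _) (opNorm_injMatrix_le hf))

theorem opNorm_submatrix_left_le {τ : Type*} [Fintype τ] [DecidableEq τ] (A : Matrix ι τ ℂ)
    {f : κ → ι} (hf : Function.Injective f) : ‖A.submatrix f id‖ ≤ ‖A‖ := by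
  rw [← conjTranspose_injMatrix_mul]
  refine (Matrix.l2_opNorm_mul _ _).trans (mul_le_of_le_one_left (norm_nonneg _) ?_)
  rw [Matrix.l2_opNorm_conjTranspose]
  exact opNorm_injMatrix_le hf

theorem opNorm_submatrix_le (A : Matrix ι ι ℂ) {f : κ → ι}
    (hf : Function.Injective f) : ‖A.submatrix f f‖ ≤ ‖A‖ :=
  (opNorm_submatrix_left_le (A.submatrix id f) hf).trans (opNorm_submatrix_right_le A hf)

theorem traceNorm_submatrix_equiv_le (e : κ ≃ ι) (X : Matrix ι ι ℂ) :
    traceNorm (X.submatrix e e) ≤ traceNorm X :=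
  traceNorm_le fun Y hY => by
    have h : (Y * X.submatrix e e).trace = (Y.submatrix e.symm e.symm * X).trace := by
      simp only [Matrix.trace, Matrix.diag_apply, Matrix.mul_apply, Matrix.submatrix_apply]
      rw [← e.symm.sum_comp]
      refine Finset.sum_congr rfl fun i _ => ?_
      rw [← e.symm.sum_comp]
      simp
    rw [h]
    exact norm_trace_mul_le_of_le ((opNorm_submatrix_le Y e.symm.injective).trans hY)

theorem traceNorm_submatrix_equiv (e : κ ≃ ι) (X : Matrix ι ι ℂ) :
    traceNorm (X.submatrix e e) = traceNorm X :=
  le_antisymm (traceNorm_submatrix_equiv_le e X) (by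
    simpa using traceNorm_submatrix_equiv_le e.symm (X.submatrix e e))

end TraceNorm

end XEB
end

noncomputable section

namespace XEB

/-! ### The diamond norm -/

section DiamondNorm

open scoped Matrix.Norms.L2Operator Kronecker

set_option linter.unusedSectionVars false

variable {n : ℕ} {ι κ : Type*} [Fintype ι] [DecidableEq ι] [Fintype κ] [DecidableEq κ]

/-! ### Operator-norm bounds as matrix inequalities, and ancilla blocks. -/

theorem opNorm_le_sqrt_of_posSemidef {M : Matrix ι κ ℂ} {c : ℝ}
    (h : ((c : ℂ) • (1 : Matrix κ κ ℂ) - Mᴴ * M).PosSemidef) : ‖M‖ ≤ √c := by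
  rw [Matrix.l2_opNorm_def]
  refine ContinuousLinearMap.opNorm_le_bound _ (Real.sqrt_nonneg _) fun x => ?_
  have h1 := h.re_dotProduct_nonneg x.ofLp
  have hx : ‖x‖ ^ 2 = RCLike.re (star x.ofLp ⬝ᵥ x.ofLp) := by
    rw [EuclideanSpace.norm_sq_eq, dotProduct, map_sum]
    refine Finset.sum_congr rfl fun i _ => ?_
    simp [← Complex.normSq_eq_conj_mul_self, ← Complex.normSq_eq_norm_sq, Complex.normSq_apply]
  have hMx : ‖(WithLp.toLp 2 (M *ᵥ x.ofLp) : EuclideanSpace ℂ ι)‖ ^ 2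
      = RCLike.re (star x.ofLp ⬝ᵥ ((Mᴴ * M) *ᵥ x.ofLp)) := by
    rw [EuclideanSpace.norm_sq_eq, ← Matrix.mulVec_mulVec, Matrix.dotProduct_mulVec,
      ← Matrix.star_mulVec, dotProduct, map_sum]
    refine Finset.sum_congr rfl fun i _ => ?_
    simp [← Complex.normSq_eq_conj_mul_self, ← Complex.normSq_eq_norm_sq, Complex.normSq_apply]
  have h2 : ‖(WithLp.toLp 2 (M *ᵥ x.ofLp) : EuclideanSpace ℂ ι)‖ ^ 2 ≤ c * ‖x‖ ^ 2 := by
    rw [hMx, hx]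
    rw [Matrix.sub_mulVec, dotProduct_sub, map_sub, Matrix.smul_mulVec, Matrix.one_mulVec,
      dotProduct_smul, smul_eq_mul] at h1
    have h3 : RCLike.re ((c : ℂ) * (star x.ofLp ⬝ᵥ x.ofLp)) = c * RCLike.re (star x.ofLp ⬝ᵥ x.ofLp) := by
      simp
    linarith
  have h4 : ‖(WithLp.toLp 2 (M *ᵥ x.ofLp) : EuclideanSpace ℂ ι)‖ ≤ √c * ‖x‖ := by
    refine ((le_abs_self _).trans (Real.abs_le_sqrt h2)).trans ?_
    by_cases hc : 0 ≤ c
    · rw [Real.sqrt_mul hc, Real.sqrt_sq (norm_nonneg _)]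
    · rw [Real.sqrt_eq_zero_of_nonpos (by nlinarith [sq_nonneg ‖x‖])]
      positivity
  exact h4

theorem posSemidef_one_sub_of_opNorm_le {Y : Matrix κ κ ℂ} (hY : ‖Y‖ ≤ 1) :
    ((1 : Matrix κ κ ℂ) - Yᴴ * Y).PosSemidef := by
  refine Matrix.PosSemidef.of_dotProduct_mulVec_nonneg
    (Matrix.isHermitian_one.sub (Matrix.isHermitian_conjTranspose_mul_self Y)) fun x => ?_
  have h := Matrix.l2_opNorm_mulVec Y (WithLp.toLp 2 x)
  have hx : ((‖(WithLp.toLp 2 x : EuclideanSpace ℂ κ)‖ ^ 2 : ℝ) : ℂ) = star x ⬝ᵥ x := by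
    rw [EuclideanSpace.norm_sq_eq, dotProduct]
    push_cast
    refine Finset.sum_congr rfl fun i _ => ?_
    simp [← Complex.normSq_eq_conj_mul_self, ← Complex.normSq_eq_norm_sq, ← Complex.ofReal_pow]
  have hYx : ((‖(WithLp.toLp 2 (Y *ᵥ x) : EuclideanSpace ℂ κ)‖ ^ 2 : ℝ) : ℂ)
      = star x ⬝ᵥ ((Yᴴ * Y) *ᵥ x) := by
    rw [EuclideanSpace.norm_sq_eq, ← Matrix.mulVec_mulVec, Matrix.dotProduct_mulVec,
      ← Matrix.star_mulVec, dotProduct]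
    push_cast
    refine Finset.sum_congr rfl fun i _ => ?_
    simp [← Complex.normSq_eq_conj_mul_self, ← Complex.normSq_eq_norm_sq, ← Complex.ofReal_pow]
  rw [Matrix.sub_mulVec, dotProduct_sub, Matrix.one_mulVec, ← hx, ← hYx, ← Complex.ofReal_sub]
  rw [Complex.zero_le_real, sub_nonneg]
  refine pow_le_pow_left₀ (norm_nonneg _) (h.trans ?_) 2
  exact mul_le_of_le_one_left (norm_nonneg _) hY

theorem traceNorm_submatrix_le (X : Matrix ι ι ℂ) {f g : κ → ι} (hf : Function.Injective f)
    (hg : Function.Injective g) : traceNorm (X.submatrix f g) ≤ traceNorm X :=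
  traceNorm_le fun Y hY => by
    have h : X.submatrix f g = (injMatrix f)ᴴ * (X * injMatrix g) := by
      rw [mul_injMatrix, conjTranspose_injMatrix_mul]; rfl
    rw [h, ← Matrix.mul_assoc, ← Matrix.mul_assoc, Matrix.trace_mul_comm, ← Matrix.mul_assoc]
    refine norm_trace_mul_le_of_le ?_
    calc ‖injMatrix g * (Y * (injMatrix f)ᴴ)‖ ≤ ‖injMatrix g‖ * ‖Y * (injMatrix f)ᴴ‖ :=
          Matrix.l2_opNorm_mul _ _
      _ ≤ ‖injMatrix g‖ * (‖Y‖ * ‖(injMatrix f)ᴴ‖) := by gcongr; exact Matrix.l2_opNorm_mul _ _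
      _ ≤ 1 * (1 * 1) := by
          rw [Matrix.l2_opNorm_conjTranspose]
          gcongr
          exacts [opNorm_injMatrix_le hg, opNorm_injMatrix_le hf]
      _ = 1 := by norm_num

/-- The block of an operator on `κ` together with `n` qubits. -/
def block (X : Matrix (κ × Bits n) (κ × Bits n) ℂ) (a b : κ) : Op n :=
  Matrix.of fun i j => X (a, i) (b, j)

/-- The action `id ⊗ C` on operators of an ancilla with an arbitrary index type. -/
def amp (C : Superop n) (X : Matrix (κ × Bits n) (κ × Bits n) ℂ) :
    Matrix (κ × Bits n) (κ × Bits n) ℂ :=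
  Matrix.of fun a b => C (block X a.1 b.1) a.2 b.2

theorem ampliate_eq_amp (k : ℕ) (C : Superop n) (X : Matrix (Fin k × Bits n) (Fin k × Bits n) ℂ) :
    ampliate k C X = amp C X := rfl

theorem ext_block {X Y : Matrix (κ × Bits n) (κ × Bits n) ℂ}
    (h : ∀ a b, block X a b = block Y a b) : X = Y := by
  ext ⟨a, i⟩ ⟨b, j⟩
  exact congrFun (congrFun (h a b) i) j

theorem block_amp (C : Superop n) (X : Matrix (κ × Bits n) (κ × Bits n) ℂ) (a b : κ) :
    block (amp C X) a b = C (block X a b) := rfl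

theorem block_smul (c : ℂ) (X : Matrix (κ × Bits n) (κ × Bits n) ℂ) (a b : κ) :
    block (c • X) a b = c • block X a b := rfl

theorem block_sum {J : Type*} (s : Finset J) (X : J → Matrix (κ × Bits n) (κ × Bits n) ℂ) (a b : κ) :
    block (∑ j ∈ s, X j) a b = ∑ j ∈ s, block (X j) a b := by
  ext i j
  simp [block, Matrix.sum_apply]

theorem block_mul_kronecker (X : Matrix (κ × Bits n) (κ × Bits n) ℂ) (A : Op n) (a b : κ) :
    block (X * ((1 : Matrix κ κ ℂ) ⊗ₖ A)) a b = block X a b * A := by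
  ext i j
  simp [block, Matrix.mul_apply, Fintype.sum_prod_type, Matrix.one_apply]

theorem block_kronecker_mul (X : Matrix (κ × Bits n) (κ × Bits n) ℂ) (A : Op n) (a b : κ) :
    block (((1 : Matrix κ κ ℂ) ⊗ₖ A) * X) a b = A * block X a b := by
  ext i j
  simp [block, Matrix.mul_apply, Fintype.sum_prod_type, Matrix.one_apply]

theorem block_conjTranspose (X : Matrix (κ × Bits n) (κ × Bits n) ℂ) (a b : κ) :
    block Xᴴ a b = (block X b a)ᴴ := rfl

theorem amp_add_left (C C' : Superop n) (X : Matrix (κ × Bits n) (κ × Bits n) ℂ) :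
    amp (C + C') X = amp C X + amp C' X := rfl

theorem amp_smul_left (c : ℂ) (C : Superop n) (X : Matrix (κ × Bits n) (κ × Bits n) ℂ) :
    amp (c • C) X = c • amp C X := rfl

theorem amp_smul_right (c : ℂ) (C : Superop n) (X : Matrix (κ × Bits n) (κ × Bits n) ℂ) :
    amp C (c • X) = c • amp C X :=
  ext_block fun a b => by simp only [block_amp, block_smul, map_smul]

theorem amp_comp (C C' : Superop n) (X : Matrix (κ × Bits n) (κ × Bits n) ℂ) :
    amp (C ∘ₗ C') X = amp C (amp C' X) := rfl

theorem amp_zero_right (C : Superop n) : amp C (0 : Matrix (κ × Bits n) (κ × Bits n) ℂ) = 0 := by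
  simpa using amp_smul_right 0 C (0 : Matrix (κ × Bits n) (κ × Bits n) ℂ)

theorem superop_apply_eq_sum (C : Superop n) (X : Op n) (i j : Bits n) :
    C X i j = ∑ k, ∑ l, X k l * C (Matrix.single k l 1) i j := by
  conv_lhs => rw [Matrix.matrix_eq_sum_single X]
  simp only [map_sum, Matrix.sum_apply]
  refine Finset.sum_congr rfl fun k _ => Finset.sum_congr rfl fun l _ => ?_
  have : Matrix.single k l (X k l) = X k l • Matrix.single k l (1 : ℂ) := by simp
  rw [this, map_smul, Matrix.smul_apply, smul_eq_mul]

theorem trace_mul_amp (C : Superop n) (X Y : Matrix (κ × Bits n) (κ × Bits n) ℂ) :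
    (Y * amp C X).trace = ∑ i, ∑ j, ∑ k, ∑ l, C (Matrix.single k l 1) i j *
      (Y.submatrix (fun b => (b, j)) (fun a => (a, i)) *
        X.submatrix (fun a => (a, k)) (fun b => (b, l))).trace := by
  have h : (Y * amp C X).trace = ∑ j, ∑ b, ∑ i, ∑ a, ∑ k, ∑ l,
      C (Matrix.single k l 1) i j * (Y (b, j) (a, i) * X (a, k) (b, l)) := by
    simp only [Matrix.trace, Matrix.diag_apply, Matrix.mul_apply, amp, Matrix.of_apply,
      Fintype.sum_prod_type_right]
    refine Finset.sum_congr rfl fun j _ => Finset.sum_congr rfl fun b _ =>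
      Finset.sum_congr rfl fun i _ => Finset.sum_congr rfl fun a _ => ?_
    rw [superop_apply_eq_sum, Finset.mul_sum]
    refine Finset.sum_congr rfl fun k _ => ?_
    rw [Finset.mul_sum]
    refine Finset.sum_congr rfl fun l _ => ?_
    simp only [block, Matrix.of_apply]
    ring
  rw [h]
  simp only [Matrix.trace, Matrix.diag_apply, Matrix.mul_apply, Matrix.submatrix_apply,
    Finset.mul_sum]
  conv_rhs => rw [Finset.sum_comm]
  refine Finset.sum_congr rfl fun j _ => ?_
  conv_lhs => rw [Finset.sum_comm]
  refine Finset.sum_congr rfl fun i _ => ?_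
  conv_rhs => rw [Finset.sum_congr rfl fun k _ => Finset.sum_comm, Finset.sum_comm]
  refine Finset.sum_congr rfl fun b _ => ?_
  conv_rhs => rw [Finset.sum_congr rfl fun k _ => Finset.sum_comm, Finset.sum_comm]

theorem traceNorm_amp_le_sum (C : Superop n) (X : Matrix (κ × Bits n) (κ × Bits n) ℂ) :
    traceNorm (amp C X) ≤
      (∑ i, ∑ j, ∑ k, ∑ l, ‖C (Matrix.single k l 1) i j‖) * traceNorm X := by
  refine traceNorm_le fun Y hY => ?_
  rw [trace_mul_amp]
  simp only [Finset.sum_mul]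
  refine norm_sum_le_of_le _ fun i _ => norm_sum_le_of_le _ fun j _ => norm_sum_le_of_le _ fun k _ =>
    norm_sum_le_of_le _ fun l _ => ?_
  rw [norm_mul]
  refine mul_le_mul_of_nonneg_left ?_ (norm_nonneg _)
  have hinj : ∀ i : Bits n, Function.Injective (fun a : κ => (a, i)) :=
    fun i a b h => (Prod.ext_iff.1 h).1
  refine (norm_trace_mul_le_of_le ?_).trans (traceNorm_submatrix_le X (hinj k) (hinj l))
  exact (opNorm_submatrix_left_le (Y.submatrix id fun a => (a, i)) (hinj j)).trans
    ((opNorm_submatrix_right_le Y (hinj i)).trans hY)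

/-- Unboundedness would give the supremum its default value `0`. The entries of `C` provide a crude
bound that is uniform in the ancilla dimension. -/
theorem bddAbove_diamondNorm (C : Superop n) :
    BddAbove {r : ℝ | ∃ (k : ℕ) (X : Matrix (Fin k × Bits n) (Fin k × Bits n) ℂ),
      traceNorm X ≤ 1 ∧ r = traceNorm (ampliate k C X)} := by
  refine ⟨∑ i, ∑ j, ∑ k, ∑ l, ‖C (Matrix.single k l 1) i j‖, ?_⟩
  rintro r ⟨k, X, hX, rfl⟩
  exact (traceNorm_amp_le_sum C X).trans (mul_le_of_le_one_right (by positivity) hX)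

theorem diamondNorm_nonneg (C : Superop n) : 0 ≤ diamondNorm C :=
  Real.sSup_nonneg (by rintro r ⟨k, X, -, rfl⟩; exact traceNorm_nonneg _)

theorem eq_zero_of_traceNorm_eq_zero {X : Matrix ι ι ℂ} (h : traceNorm X = 0) : X = 0 := by
  ext i j
  exact norm_le_zero_iff.1 ((norm_entry_le_traceNorm X i j).trans h.le)

theorem traceNorm_ampliate_le (k : ℕ) (C : Superop n)
    (X : Matrix (Fin k × Bits n) (Fin k × Bits n) ℂ) :
    traceNorm (ampliate k C X) ≤ diamondNorm C * traceNorm X := by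
  rcases (traceNorm_nonneg X).eq_or_lt with h | h
  · rw [eq_zero_of_traceNorm_eq_zero h.symm, ampliate_eq_amp, amp_zero_right]
    simp
  · have hn : ‖((traceNorm X)⁻¹ : ℂ)‖ = (traceNorm X)⁻¹ := by
      rw [norm_inv, Complex.norm_real, Real.norm_of_nonneg h.le]
    have h1 : traceNorm (ampliate k C (((traceNorm X)⁻¹ : ℂ) • X)) ≤ diamondNorm C := by
      refine le_csSup (bddAbove_diamondNorm C) ⟨k, _, ?_, rfl⟩
      rw [traceNorm_smul, hn, inv_mul_cancel₀ h.ne']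
    rw [ampliate_eq_amp, amp_smul_right, traceNorm_smul, hn, inv_mul_le_iff₀ h] at h1
    rw [ampliate_eq_amp]
    linarith

theorem traceNorm_amp_le (C : Superop n) (X : Matrix (κ × Bits n) (κ × Bits n) ℂ) :
    traceNorm (amp C X) ≤ diamondNorm C * traceNorm X := by
  have e := Fintype.equivFin κ
  have h := traceNorm_ampliate_le _ C
    (X.submatrix (e.symm.prodCongr (Equiv.refl (Bits n))) (e.symm.prodCongr (Equiv.refl (Bits n))))
  rw [traceNorm_submatrix_equiv] at h
  rwa [← traceNorm_submatrix_equiv (e.symm.prodCongr (Equiv.refl (Bits n))) (amp C X)]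

/-! ### Dual test for the diamond norm and its norm properties. -/

theorem diamondNorm_le {C : Superop n} {r : ℝ} (hr : 0 ≤ r)
    (h : ∀ (k : ℕ) (X Y : Matrix (Fin k × Bits n) (Fin k × Bits n) ℂ), ‖Y‖ ≤ 1 →
      ‖(Y * amp C X).trace‖ ≤ r * traceNorm X) : diamondNorm C ≤ r := by
  refine Real.sSup_le ?_ hr
  rintro s ⟨k, X, hX, rfl⟩
  exact (traceNorm_le fun Y hY => h k X Y hY).trans (mul_le_of_le_one_right hr hX)

theorem norm_trace_mul_amp_le (C : Superop n) (X : Matrix (κ × Bits n) (κ × Bits n) ℂ)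
    {Y : Matrix (κ × Bits n) (κ × Bits n) ℂ} (hY : ‖Y‖ ≤ 1) :
    ‖(Y * amp C X).trace‖ ≤ diamondNorm C * traceNorm X :=
  (norm_trace_mul_le_of_le hY).trans (traceNorm_amp_le C X)

theorem traceNorm_apply_le (C : Superop n) (X : Op n) :
    traceNorm (C X) ≤ diamondNorm C * traceNorm X := by
  have h := traceNorm_amp_le C (X.submatrix (Equiv.punitProd.{0, 0} (Bits n)) (Equiv.punitProd.{0, 0} (Bits n)))
  rw [traceNorm_submatrix_equiv] at h
  rwa [← traceNorm_submatrix_equiv (Equiv.punitProd.{0, 0} (Bits n)) (C X)]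

theorem diamondNorm_add_le (C C' : Superop n) :
    diamondNorm (C + C') ≤ diamondNorm C + diamondNorm C' :=
  diamondNorm_le (add_nonneg (diamondNorm_nonneg _) (diamondNorm_nonneg _)) fun k X Y hY => by
    rw [amp_add_left, Matrix.mul_add, Matrix.trace_add, add_mul]
    exact (norm_add_le _ _).trans
      (add_le_add (norm_trace_mul_amp_le C X hY) (norm_trace_mul_amp_le C' X hY))

@[simp] theorem diamondNorm_zero : diamondNorm (0 : Superop n) = 0 := by
  refine le_antisymm (diamondNorm_le le_rfl fun k X Y _ => ?_) (diamondNorm_nonneg _)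
  have : amp (0 : Superop n) X = 0 := rfl
  simp [this]

theorem diamondNorm_smul_le (c : ℂ) (C : Superop n) :
    diamondNorm (c • C) ≤ ‖c‖ * diamondNorm C :=
  diamondNorm_le (mul_nonneg (norm_nonneg _) (diamondNorm_nonneg _)) fun k X Y hY => by
    rw [amp_smul_left, Matrix.mul_smul, Matrix.trace_smul, norm_smul, mul_assoc]
    exact mul_le_mul_of_nonneg_left (norm_trace_mul_amp_le C X hY) (norm_nonneg _)

theorem diamondNorm_smul (c : ℂ) (C : Superop n) : diamondNorm (c • C) = ‖c‖ * diamondNorm C := by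
  refine le_antisymm (diamondNorm_smul_le c C) ?_
  by_cases hc : c = 0
  · simp [hc]
  · have h := diamondNorm_smul_le c⁻¹ (c • C)
    rw [smul_smul, inv_mul_cancel₀ hc, one_smul, norm_inv] at h
    rwa [← le_inv_mul_iff₀ (norm_pos_iff.2 hc)]

theorem diamondNorm_neg (C : Superop n) : diamondNorm (-C) = diamondNorm C := by
  rw [← neg_one_smul ℂ C, diamondNorm_smul]; simp

theorem diamondNorm_sub_le (C C' : Superop n) :
    diamondNorm (C - C') ≤ diamondNorm C + diamondNorm C' := by
  rw [sub_eq_add_neg, ← diamondNorm_neg C']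
  exact diamondNorm_add_le _ _

theorem diamondNorm_comp_le (C C' : Superop n) :
    diamondNorm (C ∘ₗ C') ≤ diamondNorm C * diamondNorm C' :=
  diamondNorm_le (mul_nonneg (diamondNorm_nonneg _) (diamondNorm_nonneg _)) fun k X Y hY => by
    rw [amp_comp, mul_assoc]
    exact (norm_trace_mul_amp_le C _ hY).trans
      (mul_le_mul_of_nonneg_left (traceNorm_amp_le C' X) (diamondNorm_nonneg _))

theorem diamondNorm_id_le : diamondNorm (LinearMap.id : Superop n) ≤ 1 :=
  diamondNorm_le zero_le_one fun k X Y hY => by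
    rw [one_mul]; exact norm_trace_mul_le_of_le hY

theorem traceNorm_single_le (k l : ι) : traceNorm (Matrix.single k l (1 : ℂ)) ≤ 1 :=
  traceNorm_le fun Y hY => by
    simpa [Matrix.trace_mul_single] using (norm_entry_le_opNorm Y l k).trans hY

theorem norm_superop_single_le (C : Superop n) (i j k l : Bits n) :
    ‖C (Matrix.single k l 1) i j‖ ≤ diamondNorm C :=
  (norm_entry_le_traceNorm _ i j).trans ((traceNorm_apply_le C _).trans
    (mul_le_of_le_one_right (diamondNorm_nonneg _) (traceNorm_single_le k l)))

theorem diamondNorm_le_sum (C : Superop n) :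
    diamondNorm C ≤ ∑ i, ∑ j, ∑ k, ∑ l, ‖C (Matrix.single k l 1) i j‖ := by
  refine Real.sSup_le ?_ (by positivity)
  rintro r ⟨k, X, hX, rfl⟩
  exact (traceNorm_amp_le_sum C X).trans (mul_le_of_le_one_right (by positivity) hX)

theorem superop_ext_single {C C' : Superop n}
    (h : ∀ i j k l, C (Matrix.single k l 1) i j = C' (Matrix.single k l 1) i j) : C = C' := by
  ext X i j
  rw [superop_apply_eq_sum, superop_apply_eq_sum C']
  simp only [h]

theorem eq_zero_of_diamondNorm_eq_zero {C : Superop n} (h : diamondNorm C = 0) : C = 0 :=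
  superop_ext_single fun i j k l => norm_le_zero_iff.1 ((norm_superop_single_le C i j k l).trans h.le)

/-- The superoperator `X ↦ (C X†)†`. -/
def superConj (C : Superop n) : Superop n where
  toFun X := (C Xᴴ)ᴴ
  map_add' X Y := by simp
  map_smul' c X := by simp

theorem diamondNorm_superConj_le (C : Superop n) : diamondNorm (superConj C) ≤ diamondNorm C :=
  diamondNorm_le (diamondNorm_nonneg _) fun k X Y hY => by
    have h : amp (superConj C) X = (amp C Xᴴ)ᴴ := ext_block fun a b => by
      rw [block_amp, block_conjTranspose, block_amp, block_conjTranspose]; rfl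
    refine (norm_trace_mul_le_of_le hY).trans ?_
    rw [h, traceNorm_conjTranspose, ← traceNorm_conjTranspose X]
    exact traceNorm_amp_le C _

/-- The Haagerup-type estimate that absorbs a row and a column into the ancilla. -/
theorem norm_sum_trace_mul_amp_le {J : Type*} [Fintype J] [DecidableEq J] (C : Superop n)
    (X : Matrix (κ × Bits n) (κ × Bits n) ℂ) (B Y : J → Matrix (κ × Bits n) (κ × Bits n) ℂ)
    {b y : ℝ}
    (hB : ((b : ℂ) • (1 : Matrix (κ × Bits n) (κ × Bits n) ℂ) - ∑ j, B j * (B j)ᴴ).PosSemidef)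
    (hY : ((y : ℂ) • (1 : Matrix (κ × Bits n) (κ × Bits n) ℂ) - ∑ j, (Y j)ᴴ * Y j).PosSemidef) :
    ‖∑ j, (Y j * amp C (X * B j)).trace‖ ≤ diamondNorm C * √b * √y * traceNorm X := by
  rcases isEmpty_or_nonempty J with hJ | ⟨⟨j₀⟩⟩
  · simp only [Finset.univ_eq_empty, Finset.sum_empty, norm_zero]
    have := diamondNorm_nonneg C
    have := traceNorm_nonneg X
    positivity
  -- The index `j` joins the ancilla: the `B j` become one block row `R`, the `Y j` one block column
  -- `K`, whose norms are controlled by `∑ B B†` and `∑ Y† Y`. As `amp` takes square matrices, the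
  -- rectangular `X R` is placed in block row `j₀` and zeros elsewhere.
  let f : κ × Bits n → (J × κ) × Bits n := fun x => ((j₀, x.1), x.2)
  have hf : Function.Injective f := by
    rintro ⟨a, i⟩ ⟨b, j⟩ h
    simp only [f, Prod.mk.injEq, true_and] at h
    simpa using h
  let R : Matrix (κ × Bits n) ((J × κ) × Bits n) ℂ := Matrix.of fun x z => B z.1.1 x (z.1.2, z.2)
  let K : Matrix ((J × κ) × Bits n) (κ × Bits n) ℂ := Matrix.of fun z x => Y z.1.1 (z.1.2, z.2) x
  have hR : R * Rᴴ = ∑ j, B j * (B j)ᴴ := by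
    ext x x'
    simp [R, Matrix.mul_apply, Matrix.sum_apply, Fintype.sum_prod_type]
  have hK : Kᴴ * K = ∑ j, (Y j)ᴴ * Y j := by
    ext x x'
    simp [K, Matrix.mul_apply, Matrix.sum_apply, Fintype.sum_prod_type]
  have hRn : ‖R‖ ≤ √b := by
    rw [← Matrix.l2_opNorm_conjTranspose]
    refine opNorm_le_sqrt_of_posSemidef ?_
    rwa [Matrix.conjTranspose_conjTranspose, hR]
  have hKn : ‖K‖ ≤ √y := opNorm_le_sqrt_of_posSemidef (by rwa [hK])
  have hX' : traceNorm (injMatrix f * (X * R)) ≤ √b * traceNorm X := by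
    refine traceNorm_le fun W hW => ?_
    rw [← Matrix.mul_assoc, ← Matrix.mul_assoc, Matrix.trace_mul_comm, ← Matrix.mul_assoc]
    refine (norm_trace_mul_le _ _).trans (mul_le_mul_of_nonneg_right ?_ (traceNorm_nonneg X))
    calc ‖R * (W * injMatrix f)‖ ≤ ‖R‖ * (‖W‖ * ‖injMatrix f‖) :=
          (Matrix.l2_opNorm_mul _ _).trans (by gcongr; exact Matrix.l2_opNorm_mul _ _)
      _ ≤ √b * (1 * 1) := by gcongr; exact opNorm_injMatrix_le hf
      _ = √b := by ring
  have hblock : ∀ (j : J) (a b : κ), block (injMatrix f * (X * R)) (j₀, a) (j, b)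
      = block (X * B j) a b := by
    intro j a b
    ext i i'
    simp [block, injMatrix, Matrix.mul_apply, f, R, Fintype.sum_prod_type, ite_and]
  have htr : (∑ j, (Y j * amp C (X * B j)).trace)
      = (K * (injMatrix f)ᴴ * amp C (injMatrix f * (X * R))).trace := by
    rw [Matrix.mul_assoc, conjTranspose_injMatrix_mul]
    simp only [Matrix.trace, Matrix.diag_apply, Matrix.mul_apply (M := K), Fintype.sum_prod_type]
    refine Finset.sum_congr rfl fun j _ => Finset.sum_congr rfl fun a _ =>
      Finset.sum_congr rfl fun i _ => ?_
    simp only [Matrix.mul_apply (M := Y j), Fintype.sum_prod_type]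
    refine Finset.sum_congr rfl fun b _ => Finset.sum_congr rfl fun i' _ => ?_
    simp only [Matrix.submatrix_apply, id, f, amp, Matrix.of_apply, hblock, K]
  rw [htr]
  refine (norm_trace_mul_le _ _).trans ?_
  have h1 : ‖K * (injMatrix f)ᴴ‖ ≤ √y := by
    refine (Matrix.l2_opNorm_mul _ _).trans ?_
    rw [Matrix.l2_opNorm_conjTranspose]
    calc ‖K‖ * ‖injMatrix f‖ ≤ √y * 1 := by gcongr; exact opNorm_injMatrix_le hf
      _ = √y := mul_one _
  calc ‖K * (injMatrix f)ᴴ‖ * traceNorm (amp C (injMatrix f * (X * R)))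
      ≤ √y * (diamondNorm C * (√b * traceNorm X)) := by
        gcongr
        · exact traceNorm_nonneg _
        · exact (traceNorm_amp_le _ _).trans (mul_le_mul_of_nonneg_left hX' (diamondNorm_nonneg _))
    _ = _ := by ring

theorem posSemidef_smul_one_sub_sum_kronecker {J : Type*} [Fintype J] {A B : J → Op n} {c : ℝ}
    (h : ((c : ℂ) • (1 : Op n) - ∑ j, A j * B j).PosSemidef) :
    ((c : ℂ) • (1 : Matrix (κ × Bits n) (κ × Bits n) ℂ)
      - ∑ j, ((1 : Matrix κ κ ℂ) ⊗ₖ A j) * ((1 : Matrix κ κ ℂ) ⊗ₖ B j)).PosSemidef := by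
  have h1 := (Matrix.PosSemidef.one (n := κ) (R := ℂ)).kronecker h
  have h2 : ((c : ℂ) • (1 : Matrix (κ × Bits n) (κ × Bits n) ℂ)
      - ∑ j, ((1 : Matrix κ κ ℂ) ⊗ₖ A j) * ((1 : Matrix κ κ ℂ) ⊗ₖ B j))
      = (1 : Matrix κ κ ℂ) ⊗ₖ ((c : ℂ) • (1 : Op n) - ∑ j, A j * B j) := by
    ext ⟨a, i⟩ ⟨b, j⟩
    simp only [← Matrix.mul_kronecker_mul, Matrix.mul_one, Matrix.sub_apply, Matrix.smul_apply,
      Matrix.sum_apply, Matrix.kronecker_apply, Matrix.one_apply, Prod.mk.injEq, smul_eq_mul]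
    by_cases hab : a = b <;> simp [hab]
  rw [h2]
  exact h1

/-- The row-column estimate with `C = id`: `A j` goes to the test operator and `B j` stays with `X`.
For `B = A†` it says that a channel has norm at most one. -/
theorem diamondNorm_sum_mul_mul_le {J : Type*} [Fintype J] [DecidableEq J] {C : Superop n}
    {A B : J → Op n} (hC : ∀ X, C X = ∑ j, A j * X * B j) {a b : ℝ}
    (hA : ((a : ℂ) • (1 : Op n) - ∑ j, (A j)ᴴ * A j).PosSemidef)
    (hB : ((b : ℂ) • (1 : Op n) - ∑ j, B j * (B j)ᴴ).PosSemidef) :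
    diamondNorm C ≤ √a * √b :=
  diamondNorm_le (by positivity) fun k X Y hY => by
    have hamp : amp C X = ∑ j, ((1 : Matrix (Fin k) (Fin k) ℂ) ⊗ₖ A j) *
        amp LinearMap.id (X * ((1 : Matrix (Fin k) (Fin k) ℂ) ⊗ₖ B j)) := ext_block fun c d => by
      rw [block_sum, block_amp, hC]
      refine Finset.sum_congr rfl fun j _ => ?_
      rw [block_kronecker_mul, block_amp, block_mul_kronecker, LinearMap.id_apply, Matrix.mul_assoc]
    rw [hamp, Matrix.mul_sum, Matrix.trace_sum]
    simp only [← Matrix.mul_assoc Y]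
    refine (norm_sum_trace_mul_amp_le LinearMap.id X _ _ (b := b) (y := a) ?_ ?_).trans ?_
    · have := posSemidef_smul_one_sub_sum_kronecker (κ := Fin k) hB
      simpa [Matrix.conjTranspose_kronecker] using this
    · have h1 := posSemidef_smul_one_sub_sum_kronecker (κ := Fin k) hA
      have h2 := Matrix.posSemidef_sum Finset.univ fun j (_ : j ∈ Finset.univ) =>
        (posSemidef_one_sub_of_opNorm_le hY).conjTranspose_mul_mul_same
          ((1 : Matrix (Fin k) (Fin k) ℂ) ⊗ₖ A j)
      convert h1.add h2 using 1
      simp only [Matrix.mul_sub, Matrix.sub_mul, Finset.sum_sub_distrib, Matrix.mul_one,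
        Matrix.conjTranspose_mul, Matrix.conjTranspose_kronecker, Matrix.conjTranspose_one,
        Matrix.mul_assoc]
      abel
    · have := traceNorm_nonneg X
      calc _ ≤ 1 * √b * √a * traceNorm X := by gcongr; exact diamondNorm_id_le
        _ = _ := by ring

/-- By cyclicity of the trace, `D j` moves to the left of the test operator, and the row-column
estimate applies with `Y j = D j * Y`. Reshuffled compositions have exactly this shape. -/
theorem diamondNorm_sum_apply_mul_mul_le {J : Type*} [Fintype J] [DecidableEq J] {C F : Superop n}
    {B D : J → Op n} (hF : ∀ X, F X = ∑ j, C (X * B j) * D j) {b d : ℝ}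
    (hB : ((b : ℂ) • (1 : Op n) - ∑ j, B j * (B j)ᴴ).PosSemidef)
    (hD : ((d : ℂ) • (1 : Op n) - ∑ j, (D j)ᴴ * D j).PosSemidef) (hd : 0 ≤ d) :
    diamondNorm F ≤ diamondNorm C * √b * √d := by
  have hC0 := diamondNorm_nonneg C
  refine diamondNorm_le (by positivity) fun k X Y hY => ?_
  have hamp : amp F X = ∑ j, amp C (X * ((1 : Matrix (Fin k) (Fin k) ℂ) ⊗ₖ B j)) *
      ((1 : Matrix (Fin k) (Fin k) ℂ) ⊗ₖ D j) := ext_block fun c e => by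
    rw [block_sum, block_amp, hF]
    refine Finset.sum_congr rfl fun j _ => ?_
    rw [block_mul_kronecker, block_amp, block_mul_kronecker]
  have htr : (Y * amp F X).trace = ∑ j, ((((1 : Matrix (Fin k) (Fin k) ℂ) ⊗ₖ D j) * Y) *
      amp C (X * ((1 : Matrix (Fin k) (Fin k) ℂ) ⊗ₖ B j))).trace := by
    rw [hamp, Matrix.mul_sum, Matrix.trace_sum]
    refine Finset.sum_congr rfl fun j _ => ?_
    rw [← Matrix.mul_assoc, Matrix.trace_mul_comm, ← Matrix.mul_assoc]
  rw [htr]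
  refine norm_sum_trace_mul_amp_le C X _ _ (b := b) (y := d) ?_ ?_
  · have := posSemidef_smul_one_sub_sum_kronecker (κ := Fin k) hB
    simpa [Matrix.conjTranspose_kronecker] using this
  · have h1 := (posSemidef_smul_one_sub_sum_kronecker (κ := Fin k) hD).conjTranspose_mul_mul_same Y
    have h2 := (posSemidef_one_sub_of_opNorm_le hY).smul (α := ℂ) (a := (d : ℂ)) (by simpa using hd)
    convert h1.add h2 using 1
    simp only [Matrix.mul_sub, Matrix.sub_mul, Matrix.mul_one, Matrix.mul_sum, Matrix.sum_mul,
        Matrix.conjTranspose_mul, Matrix.conjTranspose_kronecker, Matrix.conjTranspose_one,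
        Matrix.mul_assoc, Matrix.mul_smul, Matrix.smul_mul, smul_sub]
    abel

end DiamondNorm

end XEB
end

noncomputable section

namespace XEB

/-! ### Kraus decompositions -/

section Kraus

open scoped Matrix.Norms.L2Operator Kronecker

set_option linter.unusedSectionVars false

variable {n : ℕ} {ι : Type*} [Fintype ι] [DecidableEq ι]

/-- The unnormalized maximally entangled state. -/
def maxEntangled (n : ℕ) : Matrix (Bits n × Bits n) (Bits n × Bits n) ℂ :=
  Matrix.vecMulVec (fun x => if x.1 = x.2 then 1 else 0) (star fun x => if x.1 = x.2 then 1 else 0)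

theorem block_maxEntangled (a b : Bits n) :
    block (maxEntangled n) a b = Matrix.single a b 1 := by
  ext i j
  simp only [block, maxEntangled, Matrix.vecMulVec_apply, Matrix.single_apply, Matrix.of_apply,
    Pi.star_apply]
  by_cases h1 : a = i <;> by_cases h2 : b = j <;> simp [h1, h2]

theorem posSemidef_maxEntangled : (maxEntangled n).PosSemidef :=
  Matrix.posSemidef_vecMulVec_self_star _

/-- The Choi matrix of a superoperator. -/
def choi (C : Superop n) : Matrix (Bits n × Bits n) (Bits n × Bits n) ℂ := amp C (maxEntangled n)

theorem choi_apply (C : Superop n) (a b i j : Bits n) :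
    choi C (a, i) (b, j) = C (Matrix.single a b 1) i j := by
  rw [← block_maxEntangled]; rfl

/-- The partial trace over the second factor. -/
def partialTrace : Matrix (Bits n × Bits n) (Bits n × Bits n) ℂ →ₗ[ℂ] Op n where
  toFun W := Matrix.of fun a b => ∑ i, W (a, i) (b, i)
  map_add' W W' := by ext; simp [Finset.sum_add_distrib]
  map_smul' c W := by ext; simp [Finset.mul_sum]

theorem trace_mul_partialTrace (A : Op n) (W : Matrix (Bits n × Bits n) (Bits n × Bits n) ℂ) :
    (A * partialTrace W).trace = ((A ⊗ₖ (1 : Op n)) * W).trace := by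
  simp only [partialTrace, LinearMap.coe_mk, AddHom.coe_mk, Matrix.trace, Matrix.diag_apply,
    Matrix.mul_apply, Matrix.of_apply, Fintype.sum_prod_type, Matrix.kronecker_apply,
    Matrix.one_apply, Finset.mul_sum, mul_ite, mul_one, mul_zero, ite_mul, zero_mul]
  refine Finset.sum_congr rfl fun a _ => ?_
  rw [Finset.sum_comm]
  simp

theorem posSemidef_partialTrace {W : Matrix (Bits n × Bits n) (Bits n × Bits n) ℂ}
    (hW : W.PosSemidef) : (partialTrace W).PosSemidef := by
  have h : partialTrace W = ∑ i, W.submatrix (fun a => (a, i)) (fun a => (a, i)) := by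
    ext a b
    simp [partialTrace, Matrix.sum_apply]
  rw [h]
  exact Matrix.posSemidef_sum _ fun i _ => hW.submatrix _

theorem exists_conjTranspose_mul_self_eq {W : Matrix ι ι ℂ} (hW : W.PosSemidef) :
    ∃ G : Matrix ι ι ℂ, W = Gᴴ * G := by
  have hH := hW.1
  set U := (hH.eigenvectorUnitary : Matrix ι ι ℂ) with hU
  refine ⟨Matrix.diagonal (fun i => ((√(hH.eigenvalues i) : ℝ) : ℂ)) * Uᴴ, ?_⟩
  conv_lhs => rw [hH.eq_unitary_mul_diagonal]
  have h : (Matrix.diagonal (fun i => ((√(hH.eigenvalues i) : ℝ) : ℂ)))ᴴ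
      = Matrix.diagonal (fun i => ((√(hH.eigenvalues i) : ℝ) : ℂ)) := by
    rw [Matrix.diagonal_conjTranspose]; congr 1; ext i; simp
  rw [Matrix.conjTranspose_mul, Matrix.conjTranspose_conjTranspose, h, ← hU, Matrix.mul_assoc,
    Matrix.mul_assoc, ← Matrix.mul_assoc (Matrix.diagonal _) (Matrix.diagonal _),
    Matrix.diagonal_mul_diagonal]
  congr 4
  ext i
  rw [← Complex.ofReal_mul, Real.mul_self_sqrt (hW.eigenvalues_nonneg i)]

/-- Factor `W = G†G`; each row of `G`, conjugated and read as a matrix, is a Kraus operator. -/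
theorem exists_kraus {W : Matrix (Bits n × Bits n) (Bits n × Bits n) ℂ} (hW : W.PosSemidef) :
    ∃ K : Bits n × Bits n → Op n,
      (∀ (X : Op n) (i j : Bits n),
        (∑ p, K p * X * (K p)ᴴ) i j = ∑ a, ∑ b, X a b * W (a, i) (b, j)) ∧
      ∑ p, (K p)ᴴ * K p = (partialTrace W)ᵀ := by
  obtain ⟨G, rfl⟩ := exists_conjTranspose_mul_self_eq hW
  refine ⟨fun p => Matrix.of fun i a => star (G p (a, i)), fun X i j => ?_, ?_⟩
  · simp only [Matrix.sum_apply, Matrix.mul_apply, Matrix.of_apply, Matrix.conjTranspose_apply,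
      star_star, Finset.sum_mul, Finset.mul_sum]
    conv_lhs => rw [Finset.sum_comm, Finset.sum_congr rfl fun b _ => Finset.sum_comm,
      Finset.sum_comm]
    refine Finset.sum_congr rfl fun a _ => Finset.sum_congr rfl fun b _ =>
      Finset.sum_congr rfl fun p _ => ?_
    ring
  · ext a b
    simp only [Matrix.sum_apply, Matrix.mul_apply, Matrix.of_apply, Matrix.conjTranspose_apply,
      star_star, Matrix.transpose_apply, partialTrace, LinearMap.coe_mk, AddHom.coe_mk]
    rw [Finset.sum_comm]
    exact Finset.sum_congr rfl fun i _ => Finset.sum_congr rfl fun p _ => mul_comm _ _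

theorem posSemidef_choi {C : Superop n} (hC : IsChannel C) : (choi C).PosSemidef := by
  let e := Fintype.equivFin (Bits n)
  have h := hC.completelyPositive _
    ((maxEntangled n).submatrix (e.symm.prodCongr (Equiv.refl (Bits n)))
      (e.symm.prodCongr (Equiv.refl (Bits n)))) (posSemidef_maxEntangled.submatrix _)
  have h2 := h.submatrix (e.prodCongr (Equiv.refl (Bits n)))
  convert h2 using 1
  ext ⟨a, i⟩ ⟨b, j⟩
  rw [choi_apply, ← block_maxEntangled]
  simp [ampliate, block]

theorem IsChannel.exists_kraus {C : Superop n} (hC : IsChannel C) :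
    ∃ K : Bits n × Bits n → Op n, (∀ X, C X = ∑ p, K p * X * (K p)ᴴ) ∧ ∑ p, (K p)ᴴ * K p = 1 := by
  obtain ⟨K, h1, h2⟩ := XEB.exists_kraus (posSemidef_choi hC)
  refine ⟨K, fun X => ?_, ?_⟩
  · ext i j
    rw [h1, superop_apply_eq_sum]
    simp only [choi_apply]
  · rw [h2]
    ext a b
    have h3 : partialTrace (choi C) b a = (C (Matrix.single b a 1)).trace := by
      simp only [partialTrace, LinearMap.coe_mk, AddHom.coe_mk, Matrix.of_apply, choi_apply]
      rfl
    rw [Matrix.transpose_apply, h3, hC.tracePreserving, Matrix.one_apply]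
    by_cases h : a = b
    · subst h; simp
    · rw [Matrix.trace_single_eq_of_ne _ _ _ (Ne.symm h), if_neg h]

theorem diamondNorm_le_one_of_kraus {J : Type*} [Fintype J] [DecidableEq J] {C : Superop n}
    {K : J → Op n} (hC : ∀ X, C X = ∑ p, K p * X * (K p)ᴴ) (hK : ∑ p, (K p)ᴴ * K p = 1) :
    diamondNorm C ≤ 1 := by
  have h := diamondNorm_sum_mul_mul_le (a := 1) (b := 1) hC (by simp [hK, Matrix.PosSemidef.zero])
    (by simp [hK, Matrix.PosSemidef.zero])
  simpa using h

theorem IsChannel.diamondNorm_le_one {C : Superop n} (hC : IsChannel C) : diamondNorm C ≤ 1 := by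
  obtain ⟨K, h1, h2⟩ := hC.exists_kraus
  exact diamondNorm_le_one_of_kraus h1 h2

theorem IsChannel.isHermitianPreserving {C : Superop n} (hC : IsChannel C) :
    IsHermitianPreserving C := by
  obtain ⟨K, h1, -⟩ := hC.exists_kraus
  intro X hX
  rw [h1]
  unfold Matrix.IsHermitian
  rw [Matrix.conjTranspose_sum]
  refine Finset.sum_congr rfl fun p _ => ?_
  rw [Matrix.conjTranspose_mul, Matrix.conjTranspose_mul, Matrix.conjTranspose_conjTranspose, hX,
    Matrix.mul_assoc]

theorem IsHermitianPreserving.map_conjTranspose {C : Superop n} (hC : IsHermitianPreserving C)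
    (X : Op n) : C Xᴴ = (C X)ᴴ := by
  have h1 : (X + Xᴴ).IsHermitian := by
    unfold Matrix.IsHermitian
    rw [Matrix.conjTranspose_add, Matrix.conjTranspose_conjTranspose, add_comm]
  have h2 : (Complex.I • (X - Xᴴ)).IsHermitian := by
    unfold Matrix.IsHermitian
    rw [Matrix.conjTranspose_smul, Matrix.conjTranspose_sub, Matrix.conjTranspose_conjTranspose,
      Complex.star_def, Complex.conj_I, neg_smul, ← smul_neg, neg_sub]
  have e1 := hC _ h1
  have e2 := hC _ h2
  unfold Matrix.IsHermitian at e1 e2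
  rw [map_add, Matrix.conjTranspose_add] at e1
  rw [map_smul, map_sub, Matrix.conjTranspose_smul, Matrix.conjTranspose_sub, Complex.star_def,
    Complex.conj_I, neg_smul, ← smul_neg, neg_sub] at e2
  have e3 : (C Xᴴ)ᴴ - (C X)ᴴ = C X - C Xᴴ := smul_right_injective _ Complex.I_ne_zero e2
  have e4 : (2 : ℂ) • (C X)ᴴ = (2 : ℂ) • C Xᴴ := by
    rw [two_smul, two_smul]
    calc (C X)ᴴ + (C X)ᴴ = ((C X)ᴴ + (C Xᴴ)ᴴ) - ((C Xᴴ)ᴴ - (C X)ᴴ) := by abel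
      _ = C Xᴴ + C Xᴴ := by rw [e1, e3]; abel
  exact (smul_right_injective _ (two_ne_zero' ℂ) e4).symm

theorem isHermitianPreserving_of_map_conjTranspose {C : Superop n}
    (h : ∀ X, C Xᴴ = (C X)ᴴ) : IsHermitianPreserving C := fun X hX => by
  unfold Matrix.IsHermitian
  rw [← h, hX]

theorem isHermitian_choi {C : Superop n} (hC : IsHermitianPreserving C) : (choi C).IsHermitian := by
  ext ⟨a, i⟩ ⟨b, j⟩
  rw [Matrix.conjTranspose_apply, choi_apply, choi_apply, ← Matrix.conjTranspose_apply,
    ← hC.map_conjTranspose, Matrix.conjTranspose_single, star_one]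

/-! ### Splitting a Hermitian-preserving map into completely positive parts. -/

theorem exists_posSemidef_add_sub {Y : Matrix ι ι ℂ} (hY : Y.IsHermitian) :
    ∃ A : Matrix ι ι ℂ, (A + Y).PosSemidef ∧ (A - Y).PosSemidef ∧ A.trace.re ≤ traceNorm Y := by
  have hd := hY.eq_unitary_mul_diagonal
  have hu := conjTranspose_eigenvectorUnitary_mul hY
  have hu' := eigenvectorUnitary_mul_conjTranspose hY
  have hmem := hY.eigenvectorUnitary.2
  set U := (hY.eigenvectorUnitary : Matrix ι ι ℂ)
  set l := hY.eigenvalues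
  have hpos : ∀ f : ι → ℝ, (∀ i, 0 ≤ f i) →
      (U * Matrix.diagonal (fun i => (f i : ℂ)) * Uᴴ).PosSemidef := fun f hf =>
    (Matrix.PosSemidef.diagonal (d := fun i => (f i : ℂ)) fun i => by
      simpa using hf i).mul_mul_conjTranspose_same U
  have hadd : ∀ f g : ι → ℝ, U * Matrix.diagonal (fun i => ((f i + g i : ℝ) : ℂ)) * Uᴴ
      = U * Matrix.diagonal (fun i => (f i : ℂ)) * Uᴴ
        + U * Matrix.diagonal (fun i => (g i : ℂ)) * Uᴴ := fun f g => by
    rw [← Matrix.add_mul, ← Matrix.mul_add, Matrix.diagonal_add]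
    simp
  refine ⟨U * Matrix.diagonal (fun i => ((|l i| : ℝ) : ℂ)) * Uᴴ, ?_, ?_, ?_⟩
  · have h := hpos (fun i => |l i| + l i) fun i => by linarith [neg_abs_le (l i)]
    rwa [hadd, ← hd] at h
  · have h := hpos (fun i => |l i| + -l i) fun i => by linarith [le_abs_self (l i)]
    rw [hadd] at h
    have h2 : U * Matrix.diagonal (fun i => ((-l i : ℝ) : ℂ)) * Uᴴ = -Y := by
      rw [hd, ← Matrix.neg_mul, ← Matrix.mul_neg, Matrix.diagonal_neg]
      simp
    rwa [h2, ← sub_eq_add_neg] at h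
  -- The test operator is `sign Y = U diag(sign l) U†`, a contraction with `tr(sign(Y) Y) = tr |Y|`.
  · have hV : ‖U * Matrix.diagonal (fun i => ((SignType.sign (l i) : ℝ) : ℂ))‖ ≤ 1 := by
      have h1 : ‖(Matrix.diagonal (fun i => ((SignType.sign (l i) : ℝ) : ℂ)) : Matrix ι ι ℂ)‖ ≤ 1 := by
        rw [Matrix.l2_opNorm_diagonal]
        refine (pi_norm_le_iff_of_nonneg zero_le_one).2 fun i => ?_
        rcases lt_trichotomy (l i) 0 with h | h | h <;> simp [h]
      calc _ ≤ ‖U‖ * _ := Matrix.l2_opNorm_mul _ _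
        _ ≤ 1 * 1 := by gcongr; exact opNorm_unitary_le_one hmem
        _ = 1 := one_mul 1
    have hV' : ‖U * Matrix.diagonal (fun i => ((SignType.sign (l i) : ℝ) : ℂ)) * Uᴴ‖ ≤ 1 := by
      calc _ ≤ ‖U * Matrix.diagonal (fun i => ((SignType.sign (l i) : ℝ) : ℂ))‖ * ‖Uᴴ‖ :=
            Matrix.l2_opNorm_mul _ _
        _ ≤ 1 * 1 := by
            rw [Matrix.l2_opNorm_conjTranspose]; gcongr; exact opNorm_unitary_le_one hmem
        _ = 1 := one_mul 1
    have h := norm_trace_mul_le_of_le (X := Y) hV'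
    refine le_trans ?_ ((Complex.re_le_norm _).trans h)
    refine le_of_eq ?_
    congr 2
    conv_rhs => rw [hd]
    have h3 : ∀ S L : Matrix ι ι ℂ, (U * S * Uᴴ) * (U * L * Uᴴ) = U * (S * ((Uᴴ * U) * L)) * Uᴴ :=
      fun S L => by simp only [Matrix.mul_assoc]
    rw [h3, hu, Matrix.one_mul, Matrix.diagonal_mul_diagonal]
    congr 4
    ext i
    rw [← Complex.ofReal_mul, sign_mul_self]

theorem posSemidef_smul_one_sub {V : Matrix ι ι ℂ} (hV : V.IsHermitian) {c : ℝ} (hc : 0 < c)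
    (h : ‖V‖ ≤ c) : ((c : ℂ) • (1 : Matrix ι ι ℂ) - V).PosSemidef := by
  have hn : ‖((c : ℂ)⁻¹) • V‖ ≤ 1 := by
    rw [norm_smul, norm_inv, Complex.norm_real, Real.norm_of_nonneg hc.le, inv_mul_le_iff₀ hc]
    linarith
  -- With `W = V / c`, positivity comes from `2(1 - W) = (1 - W²) + (1 - W)²`.
  have h1 := posSemidef_one_sub_of_opNorm_le hn
  have h2 := Matrix.posSemidef_conjTranspose_mul_self ((1 : Matrix ι ι ℂ) - ((c : ℂ)⁻¹) • V)
  have h3 := (h1.add h2).smul (a := ((c / 2 : ℝ) : ℂ)) (by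
    rw [Complex.zero_le_real]; positivity)
  have hc' : (c : ℂ) ≠ 0 := by exact_mod_cast hc.ne'
  convert h3 using 1
  simp only [Matrix.conjTranspose_smul, Matrix.conjTranspose_sub, Matrix.conjTranspose_one,
    Matrix.mul_sub, Matrix.sub_mul, Matrix.one_mul, Matrix.mul_one, star_inv₀, Complex.star_def,
    Complex.conj_ofReal, show Vᴴ = V from hV]
  rw [show (1 : Matrix ι ι ℂ) - ((c : ℂ)⁻¹ • V) * ((c : ℂ)⁻¹ • V)
      + (1 - (c : ℂ)⁻¹ • V - ((c : ℂ)⁻¹ • V - ((c : ℂ)⁻¹ • V) * ((c : ℂ)⁻¹ • V)))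
      = (2 : ℂ) • ((1 : Matrix ι ι ℂ) - (c : ℂ)⁻¹ • V) by rw [two_smul]; abel, smul_smul, smul_sub,
    smul_smul]
  congr 2
  · push_cast; field_simp
  · push_cast
    rw [show (c : ℂ) / 2 * 2 * (c : ℂ)⁻¹ = 1 by field_simp, one_smul]

theorem block_kronecker_one_mul (X : Matrix (Bits n × Bits n) (Bits n × Bits n) ℂ) (B : Op n)
    (a b : Bits n) :
    block ((B ⊗ₖ (1 : Op n)) * X) a b = ∑ c, B a c • block X c b := by
  ext i j
  simp [block, Matrix.mul_apply, Fintype.sum_prod_type, Matrix.one_apply, Matrix.sum_apply]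

theorem block_mul_kronecker_one (X : Matrix (Bits n × Bits n) (Bits n × Bits n) ℂ) (B : Op n)
    (a b : Bits n) :
    block (X * (B ⊗ₖ (1 : Op n))) a b = ∑ c, B c b • block X a c := by
  ext i j
  simp [block, Matrix.mul_apply, Fintype.sum_prod_type, Matrix.one_apply, Matrix.sum_apply,
    mul_comm]

theorem amp_kronecker_one_mul_mul (C : Superop n)
    (X : Matrix (Bits n × Bits n) (Bits n × Bits n) ℂ) (B B' : Op n) :
    amp C ((B ⊗ₖ (1 : Op n)) * X * (B' ⊗ₖ (1 : Op n)))
      = (B ⊗ₖ (1 : Op n)) * amp C X * (B' ⊗ₖ (1 : Op n)) :=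
  ext_block fun a b => by
    simp only [block_amp, block_mul_kronecker_one, block_kronecker_one_mul, map_sum, map_smul]

theorem partialTrace_maxEntangled : partialTrace (maxEntangled n) = 1 := by
  ext a b
  have h : ∀ i, maxEntangled n (a, i) (b, i) = Matrix.single a b 1 i i := fun i => by
    rw [← block_maxEntangled]; rfl
  simp only [partialTrace, LinearMap.coe_mk, AddHom.coe_mk, Matrix.of_apply, h]
  change (Matrix.single a b (1 : ℂ)).trace = _
  rw [Matrix.one_apply]
  by_cases h : a = b
  · subst h; simp
  · rw [Matrix.trace_single_eq_of_ne _ _ _ h, if_neg h]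

theorem traceNorm_kronecker_mul_choi_mul_le (C : Superop n) (B : Op n) :
    traceNorm ((B ⊗ₖ (1 : Op n)) * choi C * (Bᴴ ⊗ₖ (1 : Op n)))
      ≤ diamondNorm C * (Bᴴ * B).trace.re := by
  rw [choi, ← amp_kronecker_one_mul_mul]
  refine (traceNorm_amp_le _ _).trans (mul_le_mul_of_nonneg_left ?_ (diamondNorm_nonneg C))
  have h := (posSemidef_maxEntangled (n := n)).mul_mul_conjTranspose_same (B ⊗ₖ (1 : Op n))
  rw [Matrix.conjTranspose_kronecker, Matrix.conjTranspose_one] at h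
  refine (traceNorm_le_trace h).trans (le_of_eq ?_)
  rw [Matrix.trace_mul_comm, ← Matrix.mul_assoc, ← Matrix.mul_kronecker_mul, Matrix.mul_one,
    ← trace_mul_partialTrace, partialTrace_maxEntangled, Matrix.mul_one]

/-- Take the absolute value of the Choi matrix twisted by `B ⊗ 1`, then untwist. The twisted matrix
is `id ⊗ C` applied to a positive operator of trace `tr(B†B)`, which gives the bound. The weight
`B†B` is fixed before `Z` is found; `exists_choi_le` exchanges the two. -/
theorem exists_posSemidef_add_sub_choi {C : Superop n} (hC : IsHermitianPreserving C) (B : Op n)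
    (hB : IsUnit B.det) :
    ∃ Z : Matrix (Bits n × Bits n) (Bits n × Bits n) ℂ, (Z + choi C).PosSemidef ∧
      (Z - choi C).PosSemidef ∧
      ((Bᴴ * B) * partialTrace Z).trace.re ≤ diamondNorm C * (Bᴴ * B).trace.re := by
  have hH : ((B ⊗ₖ (1 : Op n)) * choi C * (Bᴴ ⊗ₖ (1 : Op n))).IsHermitian := by
    have := Matrix.isHermitian_mul_mul_conjTranspose (B ⊗ₖ (1 : Op n)) (isHermitian_choi hC)
    rwa [Matrix.conjTranspose_kronecker, Matrix.conjTranspose_one] at this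
  obtain ⟨A, h1, h2, h3⟩ := exists_posSemidef_add_sub hH
  have hinv : (B⁻¹ ⊗ₖ (1 : Op n)) * (B ⊗ₖ (1 : Op n)) = 1 := by
    rw [← Matrix.mul_kronecker_mul, Matrix.nonsing_inv_mul _ hB, Matrix.mul_one,
      Matrix.one_kronecker_one]
  have hinv2 : (B ⊗ₖ (1 : Op n)) * (B⁻¹ ⊗ₖ (1 : Op n)) = 1 := by
    rw [← Matrix.mul_kronecker_mul, Matrix.mul_nonsing_inv _ hB, Matrix.mul_one,
      Matrix.one_kronecker_one]
  have hBH : (Bᴴ ⊗ₖ (1 : Op n)) = (B ⊗ₖ (1 : Op n))ᴴ := by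
    rw [Matrix.conjTranspose_kronecker, Matrix.conjTranspose_one]
  rw [hBH] at h1 h2 h3
  set P := B ⊗ₖ (1 : Op n)
  set N := B⁻¹ ⊗ₖ (1 : Op n)
  have hPN : Pᴴ * Nᴴ = 1 := by rw [← Matrix.conjTranspose_mul, hinv, Matrix.conjTranspose_one]
  have hJ : N * (P * choi C * Pᴴ) * Nᴴ = choi C := by
    calc _ = (N * P) * choi C * (Pᴴ * Nᴴ) := by simp only [Matrix.mul_assoc]
      _ = _ := by rw [hinv, hPN, Matrix.one_mul, Matrix.mul_one]
  refine ⟨N * A * Nᴴ, ?_, ?_, ?_⟩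
  · have := h1.mul_mul_conjTranspose_same N
    rwa [Matrix.mul_add, Matrix.add_mul, hJ] at this
  · have := h2.mul_mul_conjTranspose_same N
    rwa [Matrix.mul_sub, Matrix.sub_mul, hJ] at this
  · have h4 : ((Bᴴ * B) * partialTrace (N * A * Nᴴ)).trace = A.trace := by
      rw [trace_mul_partialTrace, show (Bᴴ * B) ⊗ₖ (1 : Op n) = Pᴴ * P by
        rw [← hBH, ← Matrix.mul_kronecker_mul, Matrix.mul_one], Matrix.mul_assoc,
        Matrix.trace_mul_comm]
      congr 1
      have hNP : Nᴴ * Pᴴ = 1 := by rw [← Matrix.conjTranspose_mul, hinv2, Matrix.conjTranspose_one]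
      calc P * (N * A * Nᴴ) * Pᴴ = (P * N) * A * (Nᴴ * Pᴴ) := by simp only [Matrix.mul_assoc]
        _ = A := by rw [hinv2, hNP, Matrix.one_mul, Matrix.mul_one]
    rw [h4]
    refine h3.trans ?_
    rw [← hBH]
    exact traceNorm_kronecker_mul_choi_mul_le C B

theorem exists_eq_trace_mul (f : Op n →ₗ[ℂ] ℂ) : ∃ F : Op n, ∀ W, f W = (F * W).trace := by
  refine ⟨Matrix.of fun j i => f (Matrix.single i j 1), fun W => ?_⟩
  conv_lhs => rw [Matrix.matrix_eq_sum_single W]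
  simp only [map_sum, Matrix.trace, Matrix.diag_apply, Matrix.mul_apply, Matrix.of_apply]
  rw [Finset.sum_comm]
  refine Finset.sum_congr rfl fun j _ => Finset.sum_congr rfl fun i _ => ?_
  have : Matrix.single i j (W i j) = W i j • Matrix.single i j (1 : ℂ) := by simp
  rw [this, map_smul, smul_eq_mul, mul_comm]

/-- A minimax argument. The attainable partial traces form a convex set; if none were at most `ε`,
Hahn–Banach would separate this set from the `ε`-ball by a functional `f = tr(F ·)`. The Hermitian
part of `F` then serves as a weight `B†B` in `exists_posSemidef_add_sub_choi`, and `‖C‖_⋄ < ε` gives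
a contradiction. -/
theorem exists_choi_le {C : Superop n} (hC : IsHermitianPreserving C) {ε : ℝ}
    (hε : diamondNorm C < ε) :
    ∃ Z : Matrix (Bits n × Bits n) (Bits n × Bits n) ℂ, (Z + choi C).PosSemidef ∧
      (Z - choi C).PosSemidef ∧ ((ε : ℂ) • (1 : Op n) - partialTrace Z).PosSemidef := by
  by_contra hno
  have hD := diamondNorm_nonneg C
  have hε0 : 0 < ε := hD.trans_lt hε
  let T : Set (Op n) := {W | ∃ Z, (Z + choi C).PosSemidef ∧ (Z - choi C).PosSemidef ∧
    W = partialTrace Z}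
  have hposZ : ∀ Z, (Z + choi C).PosSemidef → (Z - choi C).PosSemidef → Z.PosSemidef := by
    intro Z h1 h2
    have h3 := (h1.add h2).smul (a := ((1 / 2 : ℝ) : ℂ)) (by rw [Complex.zero_le_real]; norm_num)
    convert h3 using 1
    rw [add_add_sub_cancel, ← two_smul ℂ Z, smul_smul]
    norm_num
  have hdisj : Disjoint (Metric.ball (0 : Op n) ε) T := by
    rw [Set.disjoint_left]
    rintro W hW ⟨Z, h1, h2, rfl⟩
    refine hno ⟨Z, h1, h2, posSemidef_smul_one_sub
      (posSemidef_partialTrace (hposZ Z h1 h2)).1 hε0 ?_⟩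
    rw [mem_ball_zero_iff] at hW
    exact hW.le
  have hconv : Convex ℝ T := by
    rintro _ ⟨Z, h1, h2, rfl⟩ _ ⟨Z', h1', h2', rfl⟩ s t hs ht hst
    refine ⟨(s : ℂ) • Z + (t : ℂ) • Z', ?_, ?_, ?_⟩
    · have := (h1.smul (a := (s : ℂ)) (by simpa using hs)).add
        (h1'.smul (a := (t : ℂ)) (by simpa using ht))
      convert this using 1
      have e : choi C = (s : ℂ) • choi C + (t : ℂ) • choi C := by
        rw [← add_smul, ← Complex.ofReal_add, hst, Complex.ofReal_one, one_smul]
      conv_lhs => rw [e]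
      rw [smul_add, smul_add]; abel
    · have := (h2.smul (a := (s : ℂ)) (by simpa using hs)).add
        (h2'.smul (a := (t : ℂ)) (by simpa using ht))
      convert this using 1
      have e : choi C = (s : ℂ) • choi C + (t : ℂ) • choi C := by
        rw [← add_smul, ← Complex.ofReal_add, hst, Complex.ofReal_one, one_smul]
      conv_lhs => rw [e]
      rw [smul_sub, smul_sub]; abel
    · rw [map_add, map_smul, map_smul]
      rfl
  obtain ⟨f, u, hf1, hf2⟩ := RCLike.geometric_hahn_banach_open (𝕜 := ℂ)
    (convex_ball (0 : Op n) ε) Metric.isOpen_ball hconv hdisj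
  obtain ⟨F, hF⟩ := exists_eq_trace_mul (n := n) f.toLinearMap
  have hF' : ∀ W, f W = (F * W).trace := hF
  have hu : 0 < u := by simpa using hf1 0 (Metric.mem_ball_self hε0)
  obtain ⟨Z₀, hZ₀, hZ₀', -⟩ := exists_posSemidef_add_sub_choi hC 1 (by simp)
  -- Admissible `Z` may be enlarged by `t (S ⊗ 1)`; if `Re f S` were negative, large `t` would push
  -- `Re f` below the positive separating level `u`.
  have hfpos : ∀ S : Op n, S.PosSemidef → 0 ≤ (f S).re := by
    intro S hS
    by_contra hneg
    push Not at hneg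
    have hSk : (S ⊗ₖ (1 : Op n)).PosSemidef := hS.kronecker Matrix.PosSemidef.one
    have hpt : partialTrace (S ⊗ₖ (1 : Op n)) = (Fintype.card (Bits n) : ℂ) • S := by
      ext a b
      simp [partialTrace]
    have hd : 0 < (Fintype.card (Bits n) : ℝ) := by exact_mod_cast Fintype.card_pos
    have key : ∀ t : ℝ, 0 ≤ t → u ≤ (f (partialTrace Z₀)).re
        + t * ((Fintype.card (Bits n) : ℝ) * (f S).re) := by
      intro t ht
      have hts := hSk.smul (a := (t : ℂ)) (by simpa using ht)
      have := hf2 (partialTrace (Z₀ + (t : ℂ) • (S ⊗ₖ (1 : Op n)))) ⟨_, by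
        rw [add_right_comm]; exact hZ₀.add hts, by
        rw [add_sub_right_comm]; exact hZ₀'.add hts, rfl⟩
      rw [map_add, map_smul, hpt, map_add, map_smul, map_smul] at this
      simp only [smul_eq_mul, map_add, RCLike.re_to_complex, Complex.re_ofReal_mul] at this
      rwa [← Complex.ofReal_natCast, Complex.re_ofReal_mul] at this
    have h1 := key (|(f (partialTrace Z₀)).re| / ((Fintype.card (Bits n) : ℝ) * -(f S).re)) (by
      have : 0 < -(f S).re := by linarith
      positivity)
    have h2 : |(f (partialTrace Z₀)).re| / ((Fintype.card (Bits n) : ℝ) * -(f S).re)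
        * ((Fintype.card (Bits n) : ℝ) * (f S).re) = -|(f (partialTrace Z₀)).re| := by
      have := hneg.ne
      field_simp
    rw [h2] at h1
    linarith [le_abs_self (f (partialTrace Z₀)).re]
  have hHpos : (F + Fᴴ).PosSemidef := by
    refine Matrix.PosSemidef.of_dotProduct_mulVec_nonneg ?_ fun x => ?_
    · unfold Matrix.IsHermitian
      rw [Matrix.conjTranspose_add, Matrix.conjTranspose_conjTranspose, add_comm]
    · have h1 := hfpos _ (Matrix.posSemidef_vecMulVec_self_star x)
      have h2 : f (Matrix.vecMulVec x (star x)) = star x ⬝ᵥ F *ᵥ x := by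
        rw [hF', Matrix.mul_vecMulVec, Matrix.trace_vecMulVec, dotProduct_comm]
      have h3 : star x ⬝ᵥ Fᴴ *ᵥ x = star (star x ⬝ᵥ F *ᵥ x) := by
        rw [Matrix.star_dotProduct, Matrix.star_mulVec, ← Matrix.dotProduct_mulVec,
          Matrix.conjTranspose_conjTranspose]
      rw [Matrix.add_mulVec, dotProduct_add, h3, ← h2, Complex.star_def, Complex.add_conj,
        Complex.zero_le_real]
      linarith
  have hHre : ∀ W : Op n, W.IsHermitian → ((F + Fᴴ) * W).trace.re = 2 * (f W).re := by
    intro W hW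
    have : (Fᴴ * W).trace = star (F * W).trace := by
      rw [← Matrix.trace_conjTranspose, Matrix.conjTranspose_mul, hW, Matrix.trace_mul_comm]
    rw [Matrix.add_mul, Matrix.trace_add, this, hF', Complex.add_re, Complex.star_def,
      Complex.conj_re]
    ring
  -- Adding `η` makes the weight positive definite, hence of the form `B†B` with `B` invertible; `η`
  -- is sent to `0` in `hlim`.
  have hbound : ∀ η : ℝ, 0 < η →
      2 * u ≤ diamondNorm C * (2 * (f 1).re + η * Fintype.card (Bits n)) := by
    intro η hη
    have hpd : ((F + Fᴴ) + (η : ℂ) • (1 : Op n)).PosDef :=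
      Matrix.PosDef.posSemidef_add hHpos
        (Matrix.PosDef.one.smul (a := (η : ℂ)) (by simpa using hη))
    obtain ⟨B, hB⟩ := exists_conjTranspose_mul_self_eq hpd.posSemidef
    have hdet : IsUnit B.det := by
      have h1 := (Matrix.isUnit_iff_isUnit_det _).1 hpd.isUnit
      rw [hB, Matrix.det_mul] at h1
      exact isUnit_of_mul_isUnit_right h1
    obtain ⟨Z, h1, h2, h3⟩ := exists_posSemidef_add_sub_choi hC B hdet
    have h4 := hf2 _ ⟨Z, h1, h2, rfl⟩
    have hpt := posSemidef_partialTrace (hposZ Z h1 h2)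
    have h5 := hHre _ hpt.1
    rw [← hB, Matrix.add_mul, Matrix.trace_add, Matrix.trace_add, Complex.add_re, Complex.add_re, h5,
      Matrix.smul_mul, Matrix.one_mul, Matrix.trace_smul, Matrix.trace_smul, Matrix.trace_one,
      ← Matrix.mul_one (F + Fᴴ), hHre 1 Matrix.isHermitian_one] at h3
    have h6 : 0 ≤ ((η : ℂ) • (partialTrace Z).trace).re := by
      have := (Complex.le_def.1 hpt.trace_nonneg).1
      simp only [smul_eq_mul, Complex.re_ofReal_mul]
      exact mul_nonneg hη.le this
    have h7 : ((η : ℂ) • (Fintype.card (Bits n) : ℂ)).re = η * Fintype.card (Bits n) := by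
      rw [smul_eq_mul, Complex.re_ofReal_mul, Complex.natCast_re]
    rw [h7] at h3
    have h8 : u ≤ (f (partialTrace Z)).re := h4
    linarith
  -- A multiple of the identity strictly between the radii `‖C‖_⋄` and `ε` lies in the open ball;
  -- against `u ≤ ‖C‖_⋄ Re f(1)` this is absurd.
  have hf1' : ((diamondNorm C + ε) / 2) * (f 1).re < u := by
    have h := hf1 (((((diamondNorm C + ε) / 2 : ℝ)) : ℂ) • 1) (by
      rw [mem_ball_zero_iff, norm_smul, Complex.norm_real, Real.norm_of_nonneg (by linarith)]
      calc _ ≤ (diamondNorm C + ε) / 2 * 1 := by gcongr; exact opNorm_one_le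
        _ < ε := by linarith)
    rw [map_smul] at h
    simpa only [smul_eq_mul, RCLike.re_to_complex, Complex.re_ofReal_mul] using h
  have hlim : 2 * u ≤ diamondNorm C * (2 * (f 1).re) := by
    refine le_of_forall_pos_le_add fun e he => ?_
    have hd : 0 < (Fintype.card (Bits n) : ℝ) := by exact_mod_cast Fintype.card_pos
    have h := hbound (e / ((diamondNorm C + 1) * Fintype.card (Bits n))) (by positivity)
    have h2 : diamondNorm C * (e / ((diamondNorm C + 1) * Fintype.card (Bits n))
        * Fintype.card (Bits n)) ≤ e := by
      rw [show diamondNorm C * (e / ((diamondNorm C + 1) * Fintype.card (Bits n))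
        * Fintype.card (Bits n)) = e * (diamondNorm C / (diamondNorm C + 1)) by field_simp]
      exact mul_le_of_le_one_right he.le (by rw [div_le_one (by positivity)]; linarith)
    rw [mul_add] at h
    linarith
  have h1pos : 0 ≤ (f 1).re := hfpos 1 Matrix.PosSemidef.one
  nlinarith

/-- A Hermitian-preserving superoperator is a signed sum of Kraus terms whose total weight
is controlled by its diamond norm. -/
theorem exists_signed_kraus {C : Superop n} (hC : IsHermitianPreserving C) {ε : ℝ}
    (hε : diamondNorm C < ε) :
    ∃ (K : (Bits n × Bits n) ⊕ (Bits n × Bits n) → Op n)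
      (s : (Bits n × Bits n) ⊕ (Bits n × Bits n) → ℂ), (∀ j, star (s j) * s j = 1) ∧
      (∀ X, C X = ∑ j, s j • (K j * X * (K j)ᴴ)) ∧
      ((ε : ℂ) • (1 : Op n) - ∑ j, (K j)ᴴ * K j).PosSemidef := by
  obtain ⟨Z, h1, h2, h3⟩ := exists_choi_le hC hε
  have hhalf : (0 : ℂ) ≤ ((1 / 2 : ℝ) : ℂ) := by rw [Complex.zero_le_real]; norm_num
  -- The positive matrices `(Z ± choi C) / 2` have difference `choi C`, hence the signs, and sum
  -- `Z`, whose partial trace bounds the total weight.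
  obtain ⟨K, hK, hK'⟩ := exists_kraus (h1.smul hhalf)
  obtain ⟨K', hL, hL'⟩ := exists_kraus (h2.smul hhalf)
  refine ⟨Sum.elim K K', Sum.elim (fun _ => 1) (fun _ => -1), ?_, fun X => ?_, ?_⟩
  · rintro (j | j) <;> simp
  · ext i j
    simp only [Fintype.sum_sum_type, Sum.elim_inl, Sum.elim_inr, one_smul, neg_smul,
      Finset.sum_neg_distrib, Matrix.add_apply, Matrix.neg_apply, hK, hL]
    rw [superop_apply_eq_sum, ← sub_eq_add_neg, ← Finset.sum_sub_distrib]
    refine Finset.sum_congr rfl fun a _ => ?_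
    rw [← Finset.sum_sub_distrib]
    refine Finset.sum_congr rfl fun b _ => ?_
    rw [← choi_apply]
    simp only [Matrix.smul_apply, Matrix.add_apply, Matrix.sub_apply, smul_eq_mul]
    push_cast
    ring
  · simp only [Fintype.sum_sum_type, Sum.elim_inl, Sum.elim_inr, hK', hL']
    have e : ((1 / 2 : ℝ) : ℂ) • (Z + choi C) + ((1 / 2 : ℝ) : ℂ) • (Z - choi C) = Z := by
      rw [← smul_add, add_add_sub_cancel, ← two_smul ℂ Z, smul_smul]
      norm_num
    rw [← Matrix.transpose_add, ← map_add, e]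
    have h4 := h3.transpose
    rwa [Matrix.transpose_sub, Matrix.transpose_smul, Matrix.transpose_one] at h4

end Kraus

end XEB
end

noncomputable section

namespace XEB

/-! ### Reshuffling of superoperators -/

section Reshuffle

set_option linter.unusedSectionVars false

variable {n : ℕ}

/-- The rank-one superoperator `X ↦ tr(b X) a`. -/
def rankOne (a b : Op n) : Superop n where
  toFun X := (b * X).trace • a
  map_add' X Y := by rw [Matrix.mul_add, Matrix.trace_add, add_smul]
  map_smul' c X := by rw [Matrix.mul_smul, Matrix.trace_smul, smul_eq_mul, mul_smul, RingHom.id_apply]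

theorem rankOne_apply (a b X : Op n) : rankOne a b X = (b * X).trace • a := rfl

theorem superop_eq_sum_rankOne (C : Superop n) :
    C = ∑ k, ∑ l, rankOne (C (Matrix.single k l 1)) (Matrix.single l k 1) := by
  ext X i j
  rw [superop_apply_eq_sum]
  simp only [LinearMap.sum_apply, Matrix.sum_apply, rankOne_apply, Matrix.smul_apply, smul_eq_mul,
    Matrix.trace_single_mul, one_mul]

/-- Rank-one maps span all superoperators, so the identities for `reshuffle` and `superTrace` need
only be checked on `X ↦ tr(bX) a`. -/
theorem superop_linearMap_ext {M : Type*} [AddCommMonoid M] [Module ℂ M] {f g : Superop n →ₗ[ℂ] M}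
    (h : ∀ a b, f (rankOne a b) = g (rankOne a b)) : f = g := by
  ext C
  rw [superop_eq_sum_rankOne C]
  simp only [map_sum, h]

/-- The superoperator `X ↦ A X B`. -/
def mulMul (A B : Op n) : Superop n where
  toFun X := A * X * B
  map_add' X Y := by rw [Matrix.mul_add, Matrix.add_mul]
  map_smul' c X := by simp

theorem mulMul_apply (A B X : Op n) : mulMul A B X = A * X * B := rfl

/-- The linear map that sends `X ↦ tr(b X) a` to `X ↦ a X b`. -/
def reshuffle (n : ℕ) : Superop n →ₗ[ℂ] Superop n where
  toFun C := ∑ k, ∑ l, mulMul (C (Matrix.single k l 1)) (Matrix.single l k 1)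
  map_add' C C' := by
    ext X : 1
    simp [mulMul_apply, Matrix.add_mul, Finset.sum_add_distrib]
  map_smul' c C := by
    ext X : 1
    simp [mulMul_apply, Finset.smul_sum]

theorem reshuffle_apply (C : Superop n) (X : Op n) :
    reshuffle n C X = ∑ k, ∑ l, C (Matrix.single k l 1) * X * Matrix.single l k 1 := by
  simp [reshuffle, mulMul_apply]

theorem reshuffle_rankOne (a b : Op n) : reshuffle n (rankOne a b) = mulMul a b := by
  ext X : 1
  rw [reshuffle_apply, mulMul_apply]
  conv_rhs => rw [Matrix.matrix_eq_sum_single b]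
  rw [Finset.sum_comm]
  simp only [Matrix.mul_sum, rankOne_apply, Matrix.trace_mul_single]
  refine Finset.sum_congr rfl fun l _ => Finset.sum_congr rfl fun k _ => ?_
  have : Matrix.single l k (b l k) = b l k • Matrix.single l k (1 : ℂ) := by simp
  rw [this, Matrix.mul_smul, MulOpposite.op_one, one_smul, Matrix.smul_mul, Matrix.smul_mul]

/-- Reshuffling merely permutes the entries of a superoperator; this is what allows a crude
comparison of the two norms. -/
theorem reshuffle_single_apply (C : Superop n) (i j k l : Bits n) :
    reshuffle n C (Matrix.single k l 1) i j = C (Matrix.single j l 1) i k := by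
  have h : Matrix.entryLinearMap ℂ ℂ i j ∘ₗ LinearMap.applyₗ (Matrix.single k l 1) ∘ₗ reshuffle n
      = Matrix.entryLinearMap ℂ ℂ i k ∘ₗ LinearMap.applyₗ (Matrix.single j l 1) :=
    superop_linearMap_ext fun a b => by
      simp [reshuffle_rankOne, mulMul_apply, rankOne_apply, Matrix.trace_mul_single,
        Matrix.mul_apply, Matrix.single_apply, ite_and, mul_comm]
  exact LinearMap.congr_fun h C

/-- The trace of a superoperator as a linear map on operators. -/
def superTrace (n : ℕ) : Superop n →ₗ[ℂ] ℂ :=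
  Matrix.traceLinearMap (Bits n) ℂ ℂ ∘ₗ LinearMap.applyₗ (1 : Op n) ∘ₗ reshuffle n

theorem superTrace_apply (C : Superop n) : superTrace n C = (reshuffle n C 1).trace := rfl

theorem superTrace_rankOne (a b : Op n) : superTrace n (rankOne a b) = (a * b).trace := by
  rw [superTrace_apply, reshuffle_rankOne, mulMul_apply, Matrix.mul_one]

/-- Composition with fixed superoperators on both sides. -/
def sandwich (A B : Superop n) : Superop n →ₗ[ℂ] Superop n where
  toFun C := A ∘ₗ C ∘ₗ B
  map_add' C C' := by rw [LinearMap.add_comp, LinearMap.comp_add]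
  map_smul' c C := by rw [LinearMap.smul_comp, LinearMap.comp_smul, RingHom.id_apply]

theorem sandwich_apply (A B C : Superop n) : sandwich A B C = A ∘ₗ C ∘ₗ B := rfl

theorem conjMap_apply (U X : Op n) : conjMap U X = U * X * Uᴴ := rfl

theorem conjMap_comp_rankOne (U a b : Op n) :
    conjMap U ∘ₗ rankOne a b = rankOne (U * a * Uᴴ) b := by
  ext X : 1
  simp [rankOne_apply, conjMap_apply]

theorem reshuffle_conjMap_comp (U : Op n) (C : Superop n) :
    reshuffle n (conjMap U ∘ₗ C) = mulMul U 1 ∘ₗ reshuffle n C ∘ₗ mulMul Uᴴ 1 := by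
  have h : reshuffle n ∘ₗ sandwich (conjMap U) LinearMap.id
      = sandwich (mulMul U 1) (mulMul Uᴴ 1) ∘ₗ reshuffle n := superop_linearMap_ext fun a b => by
    simp only [LinearMap.comp_apply, sandwich_apply, conjMap_comp_rankOne, LinearMap.comp_id,
      reshuffle_rankOne]
    ext X : 1
    simp [mulMul_apply, Matrix.mul_assoc]
  exact LinearMap.congr_fun h C

theorem diamondNorm_comp_comp_le_of_le_one {A B : Superop n} (hA : diamondNorm A ≤ 1)
    (hB : diamondNorm B ≤ 1) (C : Superop n) : diamondNorm (A ∘ₗ C ∘ₗ B) ≤ diamondNorm C :=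
  (diamondNorm_comp_le _ _).trans <|
    (mul_le_of_le_one_left (diamondNorm_nonneg _) hA).trans <|
      (diamondNorm_comp_le _ _).trans (mul_le_of_le_one_right (diamondNorm_nonneg _) hB)

theorem rankOne_comp_of_kraus {J : Type*} [Fintype J] {C : Superop n} {K : J → Op n} {s : J → ℂ}
    (hC : ∀ X, C X = ∑ j, s j • (K j * X * (K j)ᴴ)) (a b : Op n) :
    rankOne a b ∘ₗ C = rankOne a (∑ j, s j • ((K j)ᴴ * b * K j)) := by
  ext X : 1
  rw [LinearMap.comp_apply, rankOne_apply, rankOne_apply, hC]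
  congr 1
  simp only [Matrix.mul_sum, Matrix.sum_mul, Matrix.trace_sum, Matrix.mul_smul, Matrix.smul_mul,
    Matrix.trace_smul]
  refine Finset.sum_congr rfl fun j _ => ?_
  congr 1
  rw [← Matrix.mul_assoc, Matrix.trace_mul_comm]
  simp only [Matrix.mul_assoc]

/-- On rank-one maps, precomposition with `Ψ` replaces `b` by `∑ s K† b K`; in `a X b` the outer
factors can be read as `X K†` on the input and `K` on the output. -/
theorem reshuffle_comp_of_kraus {J : Type*} [Fintype J] {Ψ : Superop n} {K : J → Op n} {s : J → ℂ}
    (hΨ : ∀ X, Ψ X = ∑ j, s j • (K j * X * (K j)ᴴ)) (C : Superop n) (X : Op n) :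
    reshuffle n (C ∘ₗ Ψ) X = ∑ j, reshuffle n C (X * (K j)ᴴ) * (s j • K j) := by
  have h : LinearMap.applyₗ X ∘ₗ reshuffle n ∘ₗ sandwich LinearMap.id Ψ
      = ∑ j, mulMul 1 (s j • K j) ∘ₗ LinearMap.applyₗ (X * (K j)ᴴ) ∘ₗ reshuffle n :=
    superop_linearMap_ext fun a b => by
      simp only [LinearMap.comp_apply, sandwich_apply, LinearMap.id_comp, rankOne_comp_of_kraus hΨ,
        reshuffle_rankOne, LinearMap.sum_apply, LinearMap.applyₗ_apply_apply, mulMul_apply,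
        Matrix.mul_sum, Matrix.one_mul]
      refine Finset.sum_congr rfl fun j _ => ?_
      simp only [Matrix.mul_smul, Matrix.mul_assoc]
  have h2 := LinearMap.congr_fun h C
  simpa [sandwich_apply, mulMul_apply] using h2

theorem diamondNorm_mulMul_one_le {U : Op n} (hU : Uᴴ * U = 1) : diamondNorm (mulMul U 1) ≤ 1 := by
  have h := diamondNorm_sum_mul_mul_le (J := Unit) (C := mulMul U 1) (A := fun _ => U)
    (B := fun _ => 1) (fun X => by simp [mulMul_apply]) (a := 1) (b := 1)
    (by simp [hU, Matrix.PosSemidef.zero]) (by simp [Matrix.PosSemidef.zero])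
  simpa using h

theorem diamondNorm_conjMap_le {U : Op n} (hU : Uᴴ * U = 1) : diamondNorm (conjMap U) ≤ 1 :=
  diamondNorm_le_one_of_kraus (J := Unit) (K := fun _ => U) (fun X => by simp [conjMap_apply])
    (by simpa using hU)

/-- The signed Kraus operators of `Ψ` serve as row and column in `diamondNorm_sum_apply_mul_mul_le`.
The signs have modulus one, so row and column each contribute `√ε`. -/
theorem diamondNorm_reshuffle_comp_le {Ψ : Superop n} (hΨ : IsHermitianPreserving Ψ)
    (C : Superop n) :
    diamondNorm (reshuffle n (C ∘ₗ Ψ)) ≤ diamondNorm Ψ * diamondNorm (reshuffle n C) := by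
  have hC := diamondNorm_nonneg (reshuffle n C)
  have hΨ0 := diamondNorm_nonneg Ψ
  have key : ∀ ε, diamondNorm Ψ < ε →
      diamondNorm (reshuffle n (C ∘ₗ Ψ)) ≤ ε * diamondNorm (reshuffle n C) := by
    intro ε hε
    obtain ⟨K, s, hs, h1, h2⟩ := exists_signed_kraus hΨ hε
    have hε0 : 0 ≤ ε := hΨ0.trans hε.le
    have h := diamondNorm_sum_apply_mul_mul_le (b := ε) (d := ε)
      (reshuffle_comp_of_kraus h1 C) (by simpa using h2) (by
        have : ∀ j, (s j • K j)ᴴ * (s j • K j) = (K j)ᴴ * K j := fun j => by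
          rw [Matrix.conjTranspose_smul, Matrix.smul_mul, Matrix.mul_smul, smul_smul, hs, one_smul]
        simpa only [this] using h2) hε0
    rw [mul_assoc, Real.mul_self_sqrt hε0, mul_comm] at h
    exact h
  -- The Kraus decomposition exists only for weights strictly above `‖Ψ‖_⋄`, so the bound is passed
  -- to the limit.
  have hlim : Filter.Tendsto (fun ε : ℝ => ε * diamondNorm (reshuffle n C))
      (nhdsWithin (diamondNorm Ψ) (Set.Ioi (diamondNorm Ψ)))
      (nhds (diamondNorm Ψ * diamondNorm (reshuffle n C))) :=
    (Filter.Tendsto.mul_const _ Filter.tendsto_id).mono_left nhdsWithin_le_nhds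
  exact ge_of_tendsto hlim (Filter.eventually_of_mem self_mem_nhdsWithin fun ε hε => key ε hε)

theorem diamondNorm_reshuffle_conjMap_comp_le {U : Op n} (hU : Uᴴ * U = 1) (hU' : U * Uᴴ = 1)
    (C : Superop n) :
    diamondNorm (reshuffle n (conjMap U ∘ₗ C)) ≤ diamondNorm (reshuffle n C) := by
  rw [reshuffle_conjMap_comp]
  exact diamondNorm_comp_comp_le_of_le_one (diamondNorm_mulMul_one_le hU)
    (diamondNorm_mulMul_one_le (by simpa using hU')) _

theorem coe_SU_conjTranspose_mul (g : SU n) : (g : Op n)ᴴ * (g : Op n) = 1 :=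
  Matrix.mem_unitaryGroup_iff'.mp (Matrix.specialUnitaryGroup_le_unitaryGroup g.2)

theorem coe_SU_mul_conjTranspose (g : SU n) : (g : Op n) * (g : Op n)ᴴ = 1 :=
  Matrix.mem_unitaryGroup_iff.mp (Matrix.specialUnitaryGroup_le_unitaryGroup g.2)

theorem coe_SU_inv (g : SU n) : ((g⁻¹ : SU n) : Op n) = (g : Op n)ᴴ := rfl

theorem omega_apply (g : SU n) (X : Op n) : omega g X = (g : Op n) * X * (g : Op n)ᴴ := rfl

theorem diamondNorm_omega_le (g : SU n) : diamondNorm (omega g) ≤ 1 :=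
  diamondNorm_conjMap_le (coe_SU_conjTranspose_mul g)

theorem omega_mul (g h : SU n) : omega (g * h) = omega g ∘ₗ omega h := by
  ext X : 1
  simp [omega_apply, Matrix.mul_assoc]

theorem omega_one : omega (1 : SU n) = LinearMap.id := by
  ext X : 1
  simp [omega_apply]

/-- The conjugation `C ↦ ω(g†) ∘ C ∘ ω(g)`. -/
def conjBy (g : SU n) : Superop n →ₗ[ℂ] Superop n := sandwich (omega g⁻¹) (omega g)

theorem conjBy_apply (g : SU n) (C : Superop n) : conjBy g C = omega g⁻¹ ∘ₗ C ∘ₗ omega g := rfl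

theorem diamondNorm_conjBy_le (g : SU n) (C : Superop n) :
    diamondNorm (conjBy g C) ≤ diamondNorm C :=
  diamondNorm_comp_comp_le_of_le_one (diamondNorm_omega_le g⁻¹) (diamondNorm_omega_le g) C

theorem conjBy_rankOne (g : SU n) (a b : Op n) :
    conjBy g (rankOne a b)
      = rankOne ((g : Op n)ᴴ * a * (g : Op n)) ((g : Op n)ᴴ * b * (g : Op n)) := by
  ext X : 1
  simp only [conjBy_apply, LinearMap.comp_apply, rankOne_apply, omega_apply, coe_SU_inv,
    Matrix.conjTranspose_conjTranspose, Matrix.mul_smul, Matrix.smul_mul]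
  congr 1
  rw [← Matrix.mul_assoc, Matrix.trace_mul_comm]
  simp only [Matrix.mul_assoc]

/-- Conjugation by `g` acts on `a` and `b` in the same way, both in `X ↦ tr(bX) a` and in `X ↦ a X
b`. -/
theorem reshuffle_conjBy (g : SU n) (C : Superop n) :
    reshuffle n (conjBy g C) = conjBy g (reshuffle n C) := by
  have h : reshuffle n ∘ₗ conjBy g = conjBy g ∘ₗ reshuffle n := superop_linearMap_ext fun a b => by
    rw [LinearMap.comp_apply, LinearMap.comp_apply, conjBy_rankOne, reshuffle_rankOne,
      reshuffle_rankOne]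
    ext X : 1
    simp [conjBy_apply, omega_apply, mulMul_apply, coe_SU_inv, Matrix.mul_assoc]
  exact LinearMap.congr_fun h C

theorem superTrace_conjBy (g : SU n) (C : Superop n) : superTrace n (conjBy g C) = superTrace n C := by
  have h : superTrace n ∘ₗ conjBy g = superTrace n := superop_linearMap_ext fun a b => by
    rw [LinearMap.comp_apply, conjBy_rankOne, superTrace_rankOne, superTrace_rankOne]
    have : (g : Op n)ᴴ * a * (g : Op n) * ((g : Op n)ᴴ * b * (g : Op n))
        = (g : Op n)ᴴ * (a * ((g : Op n) * (g : Op n)ᴴ) * b * (g : Op n)) := by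
      simp only [Matrix.mul_assoc]
    rw [this, coe_SU_mul_conjTranspose, Matrix.mul_one, Matrix.trace_mul_comm, Matrix.mul_assoc,
      coe_SU_mul_conjTranspose, Matrix.mul_one]
  exact LinearMap.congr_fun h C

theorem superTrace_id : superTrace n LinearMap.id = (2 ^ n : ℂ) ^ 2 := by
  rw [superTrace_apply, reshuffle_apply]
  have h : ∀ k l : Bits n, ((LinearMap.id : Superop n) (Matrix.single k l 1) * 1
      * Matrix.single l k 1).trace = 1 := fun k l => by
    rw [LinearMap.id_apply, Matrix.mul_one, Matrix.single_mul_single_same,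
      Matrix.trace_single_eq_same, one_mul]
  simp only [Matrix.trace_sum, h]
  simp [sq]

end Reshuffle

end XEB
end

noncomputable section

namespace XEB

/-! ### Integrals of superoperators -/

section Integral

variable {n : ℕ} {α : Type*} [MeasurableSpace α] {μ : Measure α}

/-- The entrywise integral of a family of superoperators. -/
def superIntegral (μ : Measure α) (F : α → Superop n) : Superop n where
  toFun X := Matrix.of fun i j => ∑ k, ∑ l, X k l * ∫ x, F x (Matrix.single k l 1) i j ∂μ
  map_add' X Y := by ext; simp [add_mul, Finset.sum_add_distrib]
  map_smul' c X := by ext; simp [mul_assoc, Finset.mul_sum]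

theorem superIntegral_single (F : α → Superop n) (i j k l : Bits n) :
    superIntegral μ F (Matrix.single k l 1) i j = ∫ x, F x (Matrix.single k l 1) i j ∂μ := by
  simp [superIntegral, Matrix.single_apply, ite_and]

/-- Entrywise integrability of a family of superoperators. -/
def SuperIntegrable (F : α → Superop n) (μ : Measure α) : Prop :=
  ∀ i j k l, Integrable (fun x => F x (Matrix.single k l 1) i j) μ

theorem linearMap_superop_apply (f : Superop n →ₗ[ℂ] ℂ) (C : Superop n) :
    f C = ∑ k, ∑ l, ∑ i, ∑ j, C (Matrix.single k l 1) i j *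
      f (rankOne (Matrix.single i j 1) (Matrix.single l k 1)) := by
  have h1 : ∀ (b a : Op n), rankOne a b = ∑ i, ∑ j, a i j • rankOne (Matrix.single i j 1) b := by
    intro b a
    ext X : 1
    simp only [rankOne_apply, LinearMap.sum_apply, LinearMap.smul_apply]
    conv_lhs => rw [Matrix.matrix_eq_sum_single a, Finset.smul_sum]
    refine Finset.sum_congr rfl fun i _ => ?_
    rw [Finset.smul_sum]
    refine Finset.sum_congr rfl fun j _ => ?_
    simp [Matrix.smul_single, mul_comm]
  conv_lhs => rw [superop_eq_sum_rankOne C]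
  simp only [map_sum]
  refine Finset.sum_congr rfl fun k _ => Finset.sum_congr rfl fun l _ => ?_
  rw [h1]
  simp only [map_sum, map_smul, smul_eq_mul]

theorem SuperIntegrable.linearMap {F : α → Superop n} (hF : SuperIntegrable F μ)
    (f : Superop n →ₗ[ℂ] ℂ) : Integrable (fun x => f (F x)) μ := by
  rw [funext fun x => linearMap_superop_apply f (F x)]
  exact integrable_finsetSum _ fun k _ => integrable_finsetSum _ fun l _ =>
    integrable_finsetSum _ fun i _ => integrable_finsetSum _ fun j _ => (hF i j k l).mul_const _

/-- A linear functional is a finite combination of entries, and the integral is taken entrywise.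
Through functionals `C ↦ tr(Y (id ⊗ C)(X))` this also yields the norm bound on integrals. -/
theorem linearMap_superIntegral {F : α → Superop n} (hF : SuperIntegrable F μ)
    (f : Superop n →ₗ[ℂ] ℂ) : f (superIntegral μ F) = ∫ x, f (F x) ∂μ := by
  rw [linearMap_superop_apply f (superIntegral μ F), funext fun x => linearMap_superop_apply f (F x)]
  simp only [superIntegral_single]
  rw [integral_finsetSum _ fun k _ => integrable_finsetSum _ fun l _ =>
    integrable_finsetSum _ fun i _ => integrable_finsetSum _ fun j _ => (hF i j k l).mul_const _]
  refine Finset.sum_congr rfl fun k _ => ?_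
  rw [integral_finsetSum _ fun l _ =>
    integrable_finsetSum _ fun i _ => integrable_finsetSum _ fun j _ => (hF i j k l).mul_const _]
  refine Finset.sum_congr rfl fun l _ => ?_
  rw [integral_finsetSum _ fun i _ =>
    integrable_finsetSum _ fun j _ => (hF i j k l).mul_const _]
  refine Finset.sum_congr rfl fun i _ => ?_
  rw [integral_finsetSum _ fun j _ => (hF i j k l).mul_const _]
  refine Finset.sum_congr rfl fun j _ => ?_
  rw [integral_mul_const]

/-- The linear functional that reads off an entry of a superoperator. -/
def superEntry (i j k l : Bits n) : Superop n →ₗ[ℂ] ℂ :=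
  Matrix.entryLinearMap ℂ ℂ i j ∘ₗ LinearMap.applyₗ (Matrix.single k l 1)

theorem SuperIntegrable.map {F : α → Superop n} (hF : SuperIntegrable F μ)
    (G : Superop n →ₗ[ℂ] Superop n) : SuperIntegrable (fun x => G (F x)) μ := fun i j k l =>
  hF.linearMap (superEntry i j k l ∘ₗ G)

theorem map_superIntegral {F : α → Superop n} (hF : SuperIntegrable F μ)
    (G : Superop n →ₗ[ℂ] Superop n) :
    G (superIntegral μ F) = superIntegral μ fun x => G (F x) := superop_ext_single fun i j k l => by
  rw [superIntegral_single]
  exact linearMap_superIntegral hF (superEntry i j k l ∘ₗ G)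

theorem superIntegral_sub {F G : α → Superop n} (hF : SuperIntegrable F μ)
    (hG : SuperIntegrable G μ) :
    superIntegral μ F - superIntegral μ G = superIntegral μ fun x => F x - G x :=
  superop_ext_single fun i j k l => by
    rw [superIntegral_single, LinearMap.sub_apply, Matrix.sub_apply, superIntegral_single,
      superIntegral_single, ← integral_sub (hF i j k l) (hG i j k l)]
    rfl

theorem SuperIntegrable.sub {F G : α → Superop n} (hF : SuperIntegrable F μ)
    (hG : SuperIntegrable G μ) : SuperIntegrable (fun x => F x - G x) μ := fun i j k l =>
  (hF i j k l).sub (hG i j k l)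

theorem superIntegral_const [IsProbabilityMeasure μ] (C : Superop n) :
    superIntegral μ (fun _ : α => C) = C := superop_ext_single fun i j k l => by
  rw [superIntegral_single]; simp

theorem diamondNorm_superIntegral_le {F : α → Superop n} (hF : SuperIntegrable F μ) {h : α → ℝ}
    (hh : Integrable h μ) (hle : ∀ x, diamondNorm (F x) ≤ h x) :
    diamondNorm (superIntegral μ F) ≤ ∫ x, h x ∂μ := by
  refine diamondNorm_le (integral_nonneg fun x => (diamondNorm_nonneg _).trans (hle x))
    fun k X Y hY => ?_
  let f : Superop n →ₗ[ℂ] ℂ :=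
    { toFun := fun C => (Y * amp C X).trace
      map_add' := fun C C' => by rw [amp_add_left, Matrix.mul_add, Matrix.trace_add]
      map_smul' := fun c C => by
        rw [amp_smul_left, Matrix.mul_smul, Matrix.trace_smul, RingHom.id_apply] }
  have h1 : (Y * amp (superIntegral μ F) X).trace = ∫ x, f (F x) ∂μ := linearMap_superIntegral hF f
  rw [h1, ← integral_mul_const]
  refine norm_integral_le_of_norm_le (hh.mul_const _) (Filter.Eventually.of_forall fun x => ?_)
  exact (norm_trace_mul_amp_le (F x) X hY).trans
    (mul_le_mul_of_nonneg_right (hle x) (traceNorm_nonneg X))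

theorem superConj_apply (C : Superop n) (X : Op n) : superConj C X = (C Xᴴ)ᴴ := rfl

theorem superConj_single (C : Superop n) (i j k l : Bits n) :
    superConj C (Matrix.single k l 1) i j = star (C (Matrix.single l k 1) j i) := by
  rw [superConj_apply, Matrix.conjTranspose_single, star_one, Matrix.conjTranspose_apply]

theorem superConj_superIntegral (F : α → Superop n) :
    superConj (superIntegral μ F) = superIntegral μ fun x => superConj (F x) :=
  superop_ext_single fun i j k l => by
    simp only [superConj_single, superIntegral_single]
    exact integral_conj.symm

theorem isHermitianPreserving_iff {C : Superop n} :
    IsHermitianPreserving C ↔ superConj C = C := by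
  constructor
  · intro h
    ext X : 1
    rw [superConj_apply, h.map_conjTranspose, Matrix.conjTranspose_conjTranspose]
  · intro h
    refine isHermitianPreserving_of_map_conjTranspose fun X => ?_
    conv_rhs => rw [← h, superConj_apply, Matrix.conjTranspose_conjTranspose]

theorem isHermitianPreserving_superIntegral {F : α → Superop n}
    (hF : ∀ x, IsHermitianPreserving (F x)) : IsHermitianPreserving (superIntegral μ F) := by
  rw [isHermitianPreserving_iff, superConj_superIntegral]
  congr 1
  ext1 x
  exact isHermitianPreserving_iff.1 (hF x)

theorem IsHermitianPreserving.comp {C C' : Superop n} (hC : IsHermitianPreserving C)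
    (hC' : IsHermitianPreserving C') : IsHermitianPreserving (C ∘ₗ C') := fun X hX => hC _ (hC' X hX)

theorem isHermitianPreserving_omega (g : SU n) : IsHermitianPreserving (omega g) := fun X hX => by
  rw [omega_apply]
  exact Matrix.isHermitian_mul_mul_conjTranspose _ hX

theorem superIntegrable_of_measurable_of_le [IsFiniteMeasure μ] {F : α → Superop n}
    (hm : ∀ i j k l, Measurable fun x => F x (Matrix.single k l 1) i j) {c : ℝ}
    (hc : ∀ x, diamondNorm (F x) ≤ c) : SuperIntegrable F μ := fun i j k l =>
  Integrable.of_bound (hm i j k l).aestronglyMeasurable c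
    (Filter.Eventually.of_forall fun x => (norm_superop_single_le (F x) i j k l).trans (hc x))

theorem measurable_diamondNorm {F : α → Superop n}
    (hm : ∀ i j k l, Measurable fun x => F x (Matrix.single k l 1) i j) :
    Measurable fun x => diamondNorm (F x) := by
  let toSuper : (Bits n × Bits n × Bits n × Bits n → ℂ) → Superop n := fun c =>
    { toFun := fun X => Matrix.of fun i j => ∑ k, ∑ l, X k l * c (i, j, k, l)
      map_add' := fun X Y => by ext; simp [add_mul, Finset.sum_add_distrib]
      map_smul' := fun a X => by ext; simp [mul_assoc, Finset.mul_sum] }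
  have hsingle : ∀ c i j k l, toSuper c (Matrix.single k l 1) i j = c (i, j, k, l) := by
    intro c i j k l
    simp [toSuper, Matrix.single_apply, ite_and]
  -- The diamond norm is Lipschitz in the entries, since it is bounded by the sum of their moduli;
  -- measurability of the entries is then enough.
  have hcont : Continuous fun c => diamondNorm (toSuper c) := by
    have hdiff : ∀ c c', |diamondNorm (toSuper c) - diamondNorm (toSuper c')|
        ≤ ∑ i, ∑ j, ∑ k, ∑ l, ‖c (i, j, k, l) - c' (i, j, k, l)‖ := by
      intro c c'
      have h1 : ∀ A B : Superop n, diamondNorm A - diamondNorm B ≤ diamondNorm (A - B) := by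
        intro A B
        have := diamondNorm_add_le (A - B) B
        rw [sub_add_cancel] at this
        linarith
      have h2 : diamondNorm (toSuper c - toSuper c')
          ≤ ∑ i, ∑ j, ∑ k, ∑ l, ‖c (i, j, k, l) - c' (i, j, k, l)‖ := by
        refine (diamondNorm_le_sum _).trans (le_of_eq ?_)
        simp only [LinearMap.sub_apply, Matrix.sub_apply, hsingle]
      rw [abs_le]
      constructor
      · have h3 := h1 (toSuper c') (toSuper c)
        rw [← diamondNorm_neg (toSuper c' - toSuper c), neg_sub] at h3
        linarith
      · exact (h1 _ _).trans h2
    rw [continuous_iff_continuousAt]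
    intro c'
    rw [ContinuousAt, tendsto_iff_dist_tendsto_zero]
    simp only [Real.dist_eq]
    refine squeeze_zero (fun c => abs_nonneg _) (fun c => hdiff c c') ?_
    have : Continuous fun c : Bits n × Bits n × Bits n × Bits n → ℂ =>
        ∑ i, ∑ j, ∑ k, ∑ l, ‖c (i, j, k, l) - c' (i, j, k, l)‖ := by fun_prop
    convert this.tendsto c' using 2
    simp
  have hF : (fun x => diamondNorm (F x))
      = (fun c => diamondNorm (toSuper c)) ∘ fun x p => F x (Matrix.single p.2.2.1 p.2.2.2 1) p.1 p.2.1 := by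
    ext1 x
    rw [Function.comp_apply]
    congr 1
    exact superop_ext_single fun i j k l =>
      (hsingle (fun p => F x (Matrix.single p.2.2.1 p.2.2.2 1) p.1 p.2.1) i j k l).symm
  rw [hF]
  refine hcont.measurable.comp ?_
  exact measurable_pi_lambda _ fun p => hm _ _ _ _

end Integral

/-! ### Twirling -/

section Twirl

variable {n : ℕ} (μ : Measure (SU n)) [IsProbabilityMeasure μ]

theorem superIntegrable_conjBy (C : Superop n) : SuperIntegrable (fun g : SU n => conjBy g C) μ :=
  fun i j k l => integrable_twirl_entry μ C (Matrix.single k l 1) i j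

theorem twirl_eq_superIntegral (C : Superop n) :
    twirl μ C = superIntegral μ fun g : SU n => conjBy g C :=
  superop_ext_single fun i j k l => by
    rw [superIntegral_single]
    rfl

theorem diamondNorm_twirl_le (C : Superop n) : diamondNorm (twirl μ C) ≤ diamondNorm C := by
  rw [twirl_eq_superIntegral]
  refine (diamondNorm_superIntegral_le (superIntegrable_conjBy μ C)
    (integrable_const (diamondNorm C)) fun g => diamondNorm_conjBy_le g C).trans ?_
  simp

theorem linearMap_twirl_of_forall {f : Superop n →ₗ[ℂ] ℂ} (hf : ∀ g C, f (conjBy g C) = f C)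
    (C : Superop n) : f (twirl μ C) = f C := by
  rw [twirl_eq_superIntegral, linearMap_superIntegral (superIntegrable_conjBy μ C)]
  simp [hf]

theorem superTrace_twirl (C : Superop n) : superTrace n (twirl μ C) = superTrace n C :=
  linearMap_twirl_of_forall μ superTrace_conjBy C

theorem reshuffle_twirl (C : Superop n) : reshuffle n (twirl μ C) = twirl μ (reshuffle n C) := by
  rw [twirl_eq_superIntegral, twirl_eq_superIntegral,
    map_superIntegral (superIntegrable_conjBy μ C)]
  simp only [reshuffle_conjBy]

theorem twirl_of_forall {C : Superop n} (hC : ∀ g, conjBy g C = C) : twirl μ C = C := by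
  rw [twirl_eq_superIntegral]
  simp only [hC, superIntegral_const]

theorem superConj_conjBy (g : SU n) (C : Superop n) :
    superConj (conjBy g C) = conjBy g (superConj C) := by
  ext X : 1
  simp [superConj_apply, conjBy_apply, omega_apply, Matrix.mul_assoc]

theorem superConj_twirl (C : Superop n) : superConj (twirl μ C) = twirl μ (superConj C) := by
  rw [twirl_eq_superIntegral, twirl_eq_superIntegral, superConj_superIntegral]
  simp only [superConj_conjBy]

theorem twirl_add (C C' : Superop n) : twirl μ (C + C') = twirl μ C + twirl μ C' := by
  refine superop_ext_single fun i j k l => ?_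
  rw [twirl_eq_superIntegral, superIntegral_single, LinearMap.add_apply, Matrix.add_apply,
    twirl_eq_superIntegral, superIntegral_single, twirl_eq_superIntegral, superIntegral_single,
    ← integral_add (superIntegrable_conjBy μ C i j k l) (superIntegrable_conjBy μ C' i j k l)]
  simp

theorem twirl_smul (c : ℂ) (C : Superop n) : twirl μ (c • C) = c • twirl μ C := by
  refine superop_ext_single fun i j k l => ?_
  rw [twirl_eq_superIntegral, superIntegral_single, LinearMap.smul_apply, Matrix.smul_apply,
    twirl_eq_superIntegral, superIntegral_single, smul_eq_mul, ← integral_const_mul]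
  simp

theorem isHermitianPreserving_conjBy (g : SU n) {C : Superop n} (hC : IsHermitianPreserving C) :
    IsHermitianPreserving (conjBy g C) :=
  (isHermitianPreserving_omega _).comp (hC.comp (isHermitianPreserving_omega g))

theorem isHermitianPreserving_twirl {C : Superop n} (hC : IsHermitianPreserving C) :
    IsHermitianPreserving (twirl μ C) := by
  rw [twirl_eq_superIntegral]
  exact isHermitianPreserving_superIntegral fun g => isHermitianPreserving_conjBy g hC

theorem conjBy_mul (g h : SU n) (C : Superop n) : conjBy (g * h) C = conjBy h (conjBy g C) := by
  simp only [conjBy_apply, mul_inv_rev, omega_mul, LinearMap.comp_assoc]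

/-- Right invariance of the Haar measure: its image under right translation is again a Haar
probability measure, and that measure is unique. -/
theorem conjBy_twirl_haarSU (h : SU n) (C : Superop n) :
    conjBy h (twirl (haarSU n) C) = twirl (haarSU n) C := by
  rw [twirl_eq_superIntegral, map_superIntegral (superIntegrable_conjBy _ C)]
  simp only [← conjBy_mul]
  refine superop_ext_single fun i j k l => ?_
  rw [superIntegral_single, superIntegral_single]
  have : (haarSU n).IsHaarMeasure := by unfold haarSU; infer_instance
  have hprob : IsProbabilityMeasure ((haarSU n).map (· * h)) :=
    Measure.isProbabilityMeasure_map (continuous_mul_const h).aemeasurable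
  have hmap : (haarSU n).map (· * h) = haarSU n :=
    Measure.isHaarMeasure_eq_of_isProbabilityMeasure _ _
  have hright := MeasureTheory.integral_map (μ := haarSU n) (φ := (· * h))
    (continuous_mul_const h).aemeasurable
    (f := fun g => conjBy g C (Matrix.single k l 1) i j)
    (continuous_twirl_entry C (Matrix.single k l 1) i j).aestronglyMeasurable
  rw [hmap] at hright
  exact hright.symm

theorem IsApproxTwirl.diamondNorm_sub_le {μ : Measure (SU n)} [IsProbabilityMeasure μ] {γ : ℝ}
    (h : IsApproxTwirl μ γ) {C : Superop n} (hC : IsHermitianPreserving C) :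
    diamondNorm (twirl μ C - twirl (haarSU n) C) ≤ γ * diamondNorm C := by
  rcases (diamondNorm_nonneg C).eq_or_lt with h0 | h0
  · rw [← h0, eq_zero_of_diamondNorm_eq_zero h0.symm]
    have : ∀ (ν : Measure (SU n)) [IsProbabilityMeasure ν], twirl ν (0 : Superop n) = 0 :=
      fun ν _ => by simpa using twirl_smul ν 0 0
    simp [this]
  · rw [← div_le_iff₀ h0]
    refine le_trans (le_csSup (s := {r : ℝ | ∃ C : Superop n, IsHermitianPreserving C ∧
      r = diamondNorm (twirl μ C - twirl (haarSU n) C) / diamondNorm C}) ?_ ⟨C, hC, rfl⟩) h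
    -- Twirls are contractions, so the ratios are bounded by `2`; without some bound the supremum
    -- would not dominate them.
    refine ⟨2, ?_⟩
    rintro r ⟨C', -, rfl⟩
    refine div_le_of_le_mul₀ (diamondNorm_nonneg _) zero_le_two ?_
    have h1 := diamondNorm_twirl_le μ C'
    have h2 := diamondNorm_twirl_le (haarSU n) C'
    have h3 := XEB.diamondNorm_sub_le (twirl μ C') (twirl (haarSU n) C')
    linarith

theorem IsApproxTwirl.nonneg {μ : Measure (SU n)} [IsProbabilityMeasure μ] {γ : ℝ}
    (h : IsApproxTwirl μ γ) : 0 ≤ γ := by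
  refine le_trans (Real.sSup_nonneg ?_) h
  rintro r ⟨C, -, rfl⟩
  exact div_nonneg (diamondNorm_nonneg _) (diamondNorm_nonneg _)

end Twirl

end XEB
end

noncomputable section

namespace XEB

/-! ### Superoperators that commute with all unitary channels -/

section Commutant

variable {n : ℕ}

/-- Dividing `U` by a root of its determinant puts it in `SU`; the scalar has modulus one and
cancels in the conjugation. -/
theorem exists_SU_conjMap_eq {U : Op n} (hU : U ∈ Matrix.unitaryGroup (Bits n) ℂ) :
    ∃ g : SU n, omega g = conjMap U := by
  have hd : 0 < Fintype.card (Bits n) := Fintype.card_pos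
  obtain ⟨c, hc⟩ := IsAlgClosed.exists_pow_nat_eq U.det hd
  have hdet : ‖U.det‖ = 1 := by
    have := Matrix.det_of_mem_unitary hU
    exact CStarRing.norm_of_mem_unitary this
  have hcn : ‖c‖ = 1 := by
    rw [← hc, norm_pow] at hdet
    exact (pow_eq_one_iff_of_nonneg (norm_nonneg c) hd.ne').1 hdet
  have hc0 : c ≠ 0 := fun h => by simp [h] at hcn
  have hstar : c⁻¹ * star c⁻¹ = 1 := by
    rw [Complex.star_def, Complex.mul_conj, Complex.normSq_eq_norm_sq, norm_inv, hcn]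
    simp
  have hmem : c⁻¹ • U ∈ Matrix.specialUnitaryGroup (Bits n) ℂ := by
    rw [Matrix.mem_specialUnitaryGroup_iff]
    constructor
    · rw [Matrix.mem_unitaryGroup_iff, Matrix.star_eq_conjTranspose, Matrix.conjTranspose_smul,
        Matrix.smul_mul, Matrix.mul_smul, smul_smul, hstar, one_smul]
      exact Matrix.mem_unitaryGroup_iff.1 hU
    · rw [Matrix.det_smul, ← hc, inv_pow, inv_mul_cancel₀ (pow_ne_zero _ hc0)]
  refine ⟨⟨c⁻¹ • U, hmem⟩, ?_⟩
  ext X : 1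
  rw [omega_apply, conjMap_apply]
  simp only [Matrix.conjTranspose_smul, Matrix.smul_mul, Matrix.mul_smul, smul_smul]
  rw [mul_comm, hstar, one_smul]

theorem map_unitary_conj {A : Superop n} (hA : ∀ g, conjBy g A = A) {U : Op n}
    (hU : U ∈ Matrix.unitaryGroup (Bits n) ℂ) (X : Op n) : A (U * X * Uᴴ) = U * A X * Uᴴ := by
  obtain ⟨g, hg⟩ := exists_SU_conjMap_eq hU
  have h := LinearMap.congr_fun (hA g) X
  rw [conjBy_apply, LinearMap.comp_apply, LinearMap.comp_apply] at h
  rw [← conjMap_apply U X, ← conjMap_apply U (A X), ← hg, ← h, ← LinearMap.comp_apply (omega g),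
    ← omega_mul, mul_inv_cancel, omega_one, LinearMap.id_apply]

/-- An algebraic substitute for differentiating the symmetry: `U = 1 + (i - 1)P` is unitary and `U Y
U† - U† Y U = 2i [P, Y]`. -/
theorem map_commutator_projection {A : Superop n} (hA : ∀ g, conjBy g A = A) {P : Op n}
    (hP : P * P = P) (hPH : Pᴴ = P) (X : Op n) : A (P * X - X * P) = P * A X - A X * P := by
  let U : Op n := 1 + (Complex.I - 1) • P
  have hUH : Uᴴ = 1 + (-Complex.I - 1) • P := by
    simp [U, hPH]
  have hUU : U * Uᴴ = 1 := by
    rw [hUH]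
    simp only [U, Matrix.add_mul, Matrix.mul_add, Matrix.one_mul, Matrix.mul_one, Matrix.smul_mul,
      Matrix.mul_smul, hP]
    have h : (Complex.I - 1) + ((-Complex.I - 1) + (-Complex.I - 1) * (Complex.I - 1)) = 0 := by
      linear_combination -Complex.I_mul_I
    trans 1 + ((Complex.I - 1) + ((-Complex.I - 1) + (-Complex.I - 1) * (Complex.I - 1))) • P
    · module
    · rw [h, zero_smul, add_zero]
  have hU : U ∈ Matrix.unitaryGroup (Bits n) ℂ := Matrix.mem_unitaryGroup_iff.2 hUU
  have hU' : Uᴴ ∈ Matrix.unitaryGroup (Bits n) ℂ := by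
    rw [Matrix.mem_unitaryGroup_iff, Matrix.star_eq_conjTranspose,
      Matrix.conjTranspose_conjTranspose, ← Matrix.star_eq_conjTranspose]
    exact Matrix.mem_unitaryGroup_iff'.1 hU
  have hdiff : ∀ Y : Op n, U * Y * Uᴴ - Uᴴ * Y * U = (2 * Complex.I) • (P * Y - Y * P) := by
    intro Y
    rw [hUH]
    simp only [U, Matrix.add_mul, Matrix.mul_add, Matrix.one_mul, Matrix.mul_one, Matrix.smul_mul,
      Matrix.mul_smul]
    module
  have h1 := map_unitary_conj hA hU X
  have h2 := map_unitary_conj hA hU' X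
  rw [Matrix.conjTranspose_conjTranspose] at h2
  have h3 : (2 * Complex.I) • A (P * X - X * P) = (2 * Complex.I) • (P * A X - A X * P) := by
    rw [← map_smul, ← hdiff, ← hdiff, map_sub, h1, h2]
  exact smul_right_injective _ (by simp : (2 * Complex.I) ≠ 0) h3

/-- The elements whose commutators `A` respects are closed under linear combinations and, by the
Jacobi identity, under brackets. They contain `E_kk` and `S = E_kl + E_lk = 2P - E_kk - E_ll` with
`P` a projection, hence also `2 E_kl = S + [E_kk, S]`. -/
theorem map_commutator_single {A : Superop n} (hA : ∀ g, conjBy g A = A) (k l : Bits n) (X : Op n) :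
    A (Matrix.single k l 1 * X - X * Matrix.single k l 1)
      = Matrix.single k l 1 * A X - A X * Matrix.single k l 1 := by
  have hdiag : ∀ (k : Bits n) (X : Op n), A (Matrix.single k k 1 * X - X * Matrix.single k k 1)
      = Matrix.single k k 1 * A X - A X * Matrix.single k k 1 := fun k X =>
    map_commutator_projection hA (by simp) (by simp) X
  by_cases hkl : k = l
  · subst hkl; exact hdiag k X
  have hP : ∀ X, A ((Matrix.single k l 1 + Matrix.single l k 1) * X
      - X * (Matrix.single k l 1 + Matrix.single l k 1))
      = (Matrix.single k l 1 + Matrix.single l k 1) * A X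
        - A X * (Matrix.single k l 1 + Matrix.single l k 1) := by
    intro X
    let P : Op n := (1 / 2 : ℂ) • (Matrix.single k k 1 + Matrix.single l l 1
      + (Matrix.single k l 1 + Matrix.single l k 1))
    have hPP : P * P = P := by
      simp only [P, Matrix.smul_mul, Matrix.mul_smul, Matrix.add_mul, Matrix.mul_add,
        Matrix.single_mul_single_same, Matrix.single_mul_single_of_ne _ _ _ _ hkl,
        Matrix.single_mul_single_of_ne _ _ _ _ (Ne.symm hkl), mul_one]
      module
    have hPH : Pᴴ = P := by
      simp only [P, Matrix.conjTranspose_smul, Matrix.conjTranspose_add,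
        Matrix.conjTranspose_single, star_one]
      rw [add_comm (Matrix.single l k (1 : ℂ))]
      simp
    have h := map_commutator_projection hA hPP hPH X
    have e : Matrix.single k l 1 + Matrix.single l k 1
        = (2 : ℂ) • P - Matrix.single k k 1 - Matrix.single l l 1 := by
      simp only [P, smul_smul]
      module
    have h1 := hdiag k X
    have h2 := hdiag l X
    rw [e]
    simp only [Matrix.sub_mul, Matrix.mul_sub, Matrix.smul_mul, Matrix.mul_smul, map_sub, map_smul]
      at h h1 h2 ⊢
    rw [show (2 : ℂ) • A (P * X) - A (Matrix.single k k 1 * X) - A (Matrix.single l l 1 * X)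
      - ((2 : ℂ) • A (X * P) - A (X * Matrix.single k k 1) - A (X * Matrix.single l l 1))
      = (2 : ℂ) • (A (P * X) - A (X * P))
        - (A (Matrix.single k k 1 * X) - A (X * Matrix.single k k 1))
        - (A (Matrix.single l l 1 * X) - A (X * Matrix.single l l 1)) by module, h, h1, h2]
    module
  have e : (2 : ℂ) • Matrix.single k l (1 : ℂ) = (Matrix.single k l 1 + Matrix.single l k 1)
      + (Matrix.single k k 1 * (Matrix.single k l 1 + Matrix.single l k 1)
        - (Matrix.single k l 1 + Matrix.single l k 1) * Matrix.single k k 1) := by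
    simp only [Matrix.add_mul, Matrix.mul_add, Matrix.single_mul_single_same,
      Matrix.single_mul_single_of_ne _ _ _ _ hkl,
      Matrix.single_mul_single_of_ne _ _ _ _ (Ne.symm hkl), mul_one]
    module
  have hcomm : ∀ (S D X : Op n), (∀ X, A (S * X - X * S) = S * A X - A X * S) →
      (∀ X, A (D * X - X * D) = D * A X - A X * D) →
      A ((D * S - S * D) * X - X * (D * S - S * D))
        = (D * S - S * D) * A X - A X * (D * S - S * D) := by
    intro S D X hS hD
    have e1 : (D * S - S * D) * X - X * (D * S - S * D)
        = (D * (S * X - X * S) - (S * X - X * S) * D)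
          - (S * (D * X - X * D) - (D * X - X * D) * S) := by noncomm_ring
    rw [e1, map_sub, hS, hD, hS, hD]
    noncomm_ring
  have h1 := hcomm _ _ X hP (hdiag k)
  have h2 := hP X
  have h3 : (2 : ℂ) • A (Matrix.single k l 1 * X - X * Matrix.single k l 1)
      = (2 : ℂ) • (Matrix.single k l 1 * A X - A X * Matrix.single k l 1) := by
    rw [← map_smul]
    have e2 : ∀ Y : Op n, (2 : ℂ) • (Matrix.single k l 1 * Y - Y * Matrix.single k l 1)
        = ((2 : ℂ) • Matrix.single k l (1 : ℂ)) * Y - Y * ((2 : ℂ) • Matrix.single k l (1 : ℂ)) := by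
      intro Y
      rw [Matrix.smul_mul, Matrix.mul_smul, smul_sub]
    rw [e2, e2, e]
    set S : Op n := Matrix.single k l 1 + Matrix.single l k 1
    set D : Op n := Matrix.single k k 1 * S - S * Matrix.single k k 1
    have e3 : ∀ Y : Op n, (S + D) * Y - Y * (S + D) = (S * Y - Y * S) + (D * Y - Y * D) := by
      intro Y; noncomm_ring
    rw [e3, e3, map_add, h1, h2]
  exact smul_right_injective _ (two_ne_zero' ℂ) h3

/-- Up to scalars, `E_kl` is the only common eigenvector of `[E_kk, ·]` and `[E_ll, ·]` with
eigenvalues `1` and `-1`. -/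
theorem exists_smul_single {A : Superop n} (hA : ∀ g, conjBy g A = A) {k l : Bits n} (hkl : k ≠ l) :
    ∃ a : ℂ, A (Matrix.single k l 1) = a • Matrix.single k l 1 := by
  have h1 := map_commutator_single hA k k (Matrix.single k l 1)
  have h2 := map_commutator_single hA l l (Matrix.single k l 1)
  simp only [Matrix.single_mul_single_same,
    Matrix.single_mul_single_of_ne _ _ _ _ (Ne.symm hkl), mul_one, sub_zero, zero_sub, map_neg]
    at h1 h2
  set M := A (Matrix.single k l 1)
  refine ⟨M k l, ?_⟩
  ext i j
  have e1 := congrFun (congrFun h1 i) j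
  have e2 := congrFun (congrFun h2 i) j
  simp only [Matrix.sub_apply, Matrix.neg_apply, Matrix.mul_apply, Matrix.single_apply, ite_and,
    ite_mul, mul_ite, one_mul, mul_one, zero_mul, mul_zero, Finset.sum_ite_eq, Finset.mem_univ,
    if_true, Finset.sum_ite_irrel, Finset.sum_const_zero] at e1 e2
  simp only [Matrix.smul_apply, Matrix.single_apply, smul_eq_mul, mul_ite, mul_one, mul_zero]
  by_cases hi : k = i <;> by_cases hj : l = j
  · subst hi hj; simp
  all_goals grind

/-- Schur's lemma for the adjoint representation by hand: off-diagonal matrix units share one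
eigenvalue `a`, and `A - a id` sends every diagonal unit to the same scalar matrix. `n ≠ 0` provides
two distinct basis labels. -/
theorem exists_eq_smul_id_add {A : Superop n} (hn : n ≠ 0) (hA : ∀ g, conjBy g A = A) :
    ∃ a b : ℂ, A = a • LinearMap.id + b • rankOne 1 1 := by
  have : Nontrivial (Bits n) := by
    have : Nonempty (Fin n) := ⟨⟨0, Nat.pos_of_ne_zero hn⟩⟩
    exact Function.nontrivial
  obtain ⟨k₀, l₀, h₀⟩ := exists_pair_ne (Bits n)
  have hex : ∀ k l : Bits n, ∃ a : ℂ, k ≠ l → A (Matrix.single k l 1) = a • Matrix.single k l 1 := by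
    intro k l
    by_cases h : k = l
    · exact ⟨0, fun h' => absurd h h'⟩
    · obtain ⟨a, ha⟩ := exists_smul_single hA h
      exact ⟨a, fun _ => ha⟩
  choose c hc using hex
  -- Both sides compute `A [E_kl, E_lp]`, once through each factor.
  have hchain : ∀ k l p, k ≠ l → l ≠ p → c k l = c l p := by
    intro k l p hkl hlp
    have h1 := map_commutator_single hA k l (Matrix.single l p 1)
    have h2 := map_commutator_single hA l p (Matrix.single k l 1)
    rw [← neg_sub, map_neg, h1, hc _ _ hlp, hc _ _ hkl] at h2
    simp only [Matrix.smul_mul, Matrix.mul_smul, ← smul_sub, Matrix.single_mul_single_same,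
      mul_one] at h2
    have e := congrFun (congrFun h2 k) p
    have hpl : l ≠ p := hlp
    by_cases hkp : p = k
    · subst hkp
      simp [Ne.symm hkl] at e
      exact e.symm
    · rw [Matrix.single_mul_single_of_ne _ _ _ _ hkp] at e
      simp at e
      exact e.symm
  have hconst : ∀ k l, k ≠ l → c k l = c k₀ l₀ := by
    intro k l hkl
    by_cases hk : k = l₀
    · subst hk; exact (hchain k₀ k l h₀ hkl).symm
    · rw [← hchain l₀ k l (Ne.symm hk) hkl, ← hchain k₀ l₀ k h₀ (Ne.symm hk)]
  set a := c k₀ l₀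
  have hoff : ∀ k l, k ≠ l → A (Matrix.single k l 1) = a • Matrix.single k l 1 := fun k l h => by
    rw [hc k l h, hconst k l h]
  have hdiag : ∀ k, ∃ b : ℂ, A (Matrix.single k k 1) - a • Matrix.single k k 1 = b • 1 := by
    intro k
    have hM : A (Matrix.single k k 1) - a • Matrix.single k k 1
        ∈ Set.range (Matrix.scalar (Bits n)) := by
      refine Matrix.mem_range_scalar_of_commute_single fun i j hij => ?_
      have h1 := map_commutator_single hA i j (Matrix.single k k 1)
      have h2 : A (Matrix.single i j 1 * Matrix.single k k 1
          - Matrix.single k k 1 * Matrix.single i j 1)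
          = a • (Matrix.single i j 1 * Matrix.single k k 1
          - Matrix.single k k 1 * Matrix.single i j 1) := by
        by_cases hj : j = k
        · subst hj
          rw [Matrix.single_mul_single_same, Matrix.single_mul_single_of_ne _ _ _ _ (Ne.symm hij),
            sub_zero, mul_one, hoff i j hij]
        · rw [Matrix.single_mul_single_of_ne _ _ _ _ hj]
          by_cases hi : k = i
          · subst hi
            rw [Matrix.single_mul_single_same, zero_sub, mul_one, map_neg, hoff k j hij, smul_neg]
          · rw [Matrix.single_mul_single_of_ne _ _ _ _ hi]; simp
      rw [h2] at h1
      rw [smul_sub] at h1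
      beta_reduce
      rw [commute_iff_eq, mul_sub, sub_mul, mul_smul_comm, smul_mul_assoc,
        sub_eq_sub_iff_sub_eq_sub, ← h1]
    obtain ⟨b, hb⟩ := hM
    refine ⟨b, ?_⟩
    rw [← hb, Matrix.scalar_apply, Matrix.smul_one_eq_diagonal]
  choose b hb using hdiag
  have hbconst : ∀ k, b k = b k₀ := by
    intro k
    by_cases hk : k = k₀
    · rw [hk]
    have h1 := map_commutator_single hA k k₀ (Matrix.single k₀ k 1)
    rw [hoff k₀ k (Ne.symm hk), Matrix.single_mul_single_same, Matrix.single_mul_single_same,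
      Matrix.mul_smul, Matrix.smul_mul, Matrix.single_mul_single_same,
      Matrix.single_mul_single_same, mul_one, map_sub, sub_eq_sub_iff_sub_eq_sub, hb, hb] at h1
    have h2 := congrFun (congrFun h1 k) k
    simpa using h2
  have key : ∀ k l, A (Matrix.single k l 1)
      = (a • LinearMap.id + b k₀ • rankOne 1 1 : Superop n) (Matrix.single k l 1) := by
    intro k l
    rw [LinearMap.add_apply, LinearMap.smul_apply, LinearMap.smul_apply, LinearMap.id_apply,
      rankOne_apply, Matrix.one_mul]
    by_cases hkl : k = l
    · subst hkl
      rw [Matrix.trace_single_eq_same, one_smul, ← hbconst k, ← hb]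
      abel
    · rw [hoff k l hkl, Matrix.trace_single_eq_of_ne _ _ _ hkl, zero_smul, smul_zero, add_zero]
  exact ⟨a, b k₀, superop_ext_single fun i j k l => by rw [key]⟩

/-- The difference of the identity channel and the completely depolarizing channel. -/
def idSubDepol (n : ℕ) : Superop n := LinearMap.id - ((2 : ℂ) ^ n)⁻¹ • rankOne 1 1

theorem superTrace_idSubDepol : superTrace n (idSubDepol n) = (2 ^ n) ^ 2 - 1 := by
  rw [idSubDepol, map_sub, map_smul, superTrace_id, superTrace_rankOne]
  simp

/-- The twirl is `a id + b (X ↦ tr(X) 1)`. Traceless range fixes the ratio of `b` to `a`, and the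
superoperator trace, which twirling preserves, fixes `a`. -/
theorem twirl_haarSU_eq (hn : n ≠ 0) {C : Superop n} (hC : ∀ X, (C X).trace = 0) :
    twirl (haarSU n) C = (superTrace n C / ((2 ^ n) ^ 2 - 1)) • idSubDepol n := by
  obtain ⟨a, b, hab⟩ := exists_eq_smul_id_add hn fun g => conjBy_twirl_haarSU g C
  have hd0 : (2 : ℂ) ^ n ≠ 0 := by positivity
  have htr : (twirl (haarSU n) C 1).trace = 0 := by
    let f : Superop n →ₗ[ℂ] ℂ := Matrix.traceLinearMap (Bits n) ℂ ℂ ∘ₗ LinearMap.applyₗ (1 : Op n)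
    have h : f (twirl (haarSU n) C) = f C := by
      rw [twirl_eq_superIntegral, linearMap_superIntegral (superIntegrable_conjBy _ C)]
      have : ∀ g : SU n, f (conjBy g C) = 0 := by
        intro g
        change (omega g⁻¹ (C (omega g 1))).trace = 0
        rw [omega_apply, Matrix.trace_mul_comm, ← Matrix.mul_assoc, coe_SU_conjTranspose_mul,
          Matrix.one_mul, hC]
      simp only [this, integral_zero]
      exact (hC 1).symm
    exact h.trans (hC 1)
  have hb : b = -(a * ((2 : ℂ) ^ n)⁻¹) := by
    rw [hab] at htr
    simp only [LinearMap.add_apply, LinearMap.smul_apply, LinearMap.id_apply, rankOne_apply,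
      Matrix.one_mul, Matrix.trace_add, Matrix.trace_smul, Matrix.trace_one, smul_eq_mul,
      Fintype.card_fun, Fintype.card_fin, Nat.cast_pow, Nat.cast_ofNat] at htr
    have h2 : (2 : ℂ) ^ n * (a + b * 2 ^ n) = 0 := by linear_combination htr
    have h3 := (mul_eq_zero.1 h2).resolve_left hd0
    field_simp
    linear_combination h3
  have hA : twirl (haarSU n) C = a • idSubDepol n := by
    rw [hab, hb, idSubDepol]
    module
  have hs : superTrace n C = a * ((2 ^ n) ^ 2 - 1) := by
    rw [← superTrace_twirl (haarSU n) C, hA, map_smul, superTrace_idSubDepol, smul_eq_mul]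
  have hne : ((2 : ℂ) ^ n) ^ 2 - 1 ≠ 0 := by
    have h1 : (1 : ℝ) < (2 ^ n) ^ 2 := one_lt_pow₀ (one_lt_pow₀ one_lt_two hn) two_ne_zero
    have h2 : ((((2 : ℝ) ^ n) ^ 2 - 1 : ℝ) : ℂ) ≠ 0 := by
      exact_mod_cast (sub_pos.2 h1).ne'
    simpa using h2
  rw [hA, hs, mul_div_cancel_right₀ _ hne]

end Commutant

end XEB
end

noncomputable section

namespace XEB

/-! ### Perturbation of a projection of rank one -/

section Perturbation

section Resolvent

variable {V : Type*} [NormedAddCommGroup V] [NormedSpace ℝ V] [FiniteDimensional ℝ V]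

theorem isUnit_smul_one_sub {A : V →L[ℝ] V} {p a : ℝ} (hA : ‖A‖ ≤ a) (hp : a < p) :
    IsUnit (p • (1 : V →L[ℝ] V) - A) := by
  have : CompleteSpace V := FiniteDimensional.complete ℝ V
  have hp0 : 0 < p := ((norm_nonneg A).trans hA).trans_lt hp
  have h1 : ‖p⁻¹ • A‖ < 1 := by
    rw [norm_smul, norm_inv, Real.norm_of_nonneg hp0.le, inv_mul_lt_iff₀ hp0, mul_one]
    exact hA.trans_lt hp
  have h2 := (isUnit_one_sub_of_norm_lt_one h1).smul (Units.mk0 p hp0.ne')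
  rwa [Units.smul_def, Units.val_mk0, smul_sub, smul_smul, mul_inv_cancel₀ hp0.ne', one_smul] at h2

/-- The resolvent of an operator at a real number. -/
def resolventAt (A : V →L[ℝ] V) (p : ℝ) : V →L[ℝ] V := Ring.inverse (p • (1 : V →L[ℝ] V) - A)

variable {A : V →L[ℝ] V} {p a : ℝ}

theorem smul_resolventAt (hA : ‖A‖ ≤ a) (hp : a < p) (v : V) :
    p • resolventAt A p v = A (resolventAt A p v) + v := by
  have h := congrArg (fun F : V →L[ℝ] V => F v)
    (Ring.mul_inverse_cancel _ (isUnit_smul_one_sub hA hp))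
  simp only [mul_apply_eq_comp, one_apply_eq_self,
    _root_.sub_apply, _root_.smul_apply] at h
  exact (sub_eq_iff_eq_add'.1 h)

theorem resolventAt_smul_sub (hA : ‖A‖ ≤ a) (hp : a < p) (v : V) :
    resolventAt A p (p • v - A v) = v := by
  have h := congrArg (fun F : V →L[ℝ] V => F v)
    (Ring.inverse_mul_cancel _ (isUnit_smul_one_sub hA hp))
  unfold resolventAt
  simpa only [mul_apply_eq_comp, one_apply_eq_self,
    _root_.sub_apply, _root_.smul_apply] using h

theorem mul_norm_resolventAt_le (hA : ‖A‖ ≤ a) (hp : a < p) (v : V) :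
    (p - a) * ‖resolventAt A p v‖ ≤ ‖v‖ := by
  have hp0 : 0 < p := ((norm_nonneg A).trans hA).trans_lt hp
  have h1 : ‖p • resolventAt A p v‖ ≤ ‖A (resolventAt A p v)‖ + ‖v‖ := by
    rw [smul_resolventAt hA hp]
    exact norm_add_le _ _
  have h2 := A.le_of_opNorm_le hA (resolventAt A p v)
  rw [norm_smul, Real.norm_of_nonneg hp0.le] at h1
  linarith

theorem continuousOn_resolventAt (hA : ‖A‖ ≤ a) (w : V) :
    ContinuousOn (fun p => resolventAt A p w) (Set.Ioi a) := by
  have : CompleteSpace V := FiniteDimensional.complete ℝ V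
  intro p hp
  obtain ⟨u, hu⟩ := isUnit_smul_one_sub hA hp
  have h1 : ContinuousAt (fun p : ℝ => p • (1 : V →L[ℝ] V) - A) p := by fun_prop
  have h2 : ContinuousAt (fun p : ℝ => resolventAt A p) p := by
    refine ContinuousAt.comp (f := fun p : ℝ => p • (1 : V →L[ℝ] V) - A) ?_ h1
    rw [← hu]
    exact NormedRing.inverse_continuousAt u
  exact (h2.clm_apply continuousAt_const).continuousWithinAt

end Resolvent

section Eigenvalue

theorem abs_mul_norm_le {V : Type*} [NormedAddCommGroup V] [NormedSpace ℝ V] {L₀ : V →ₗ[ℝ] ℝ}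
    {E₀ : V} (hP : ∀ v, ‖L₀ v • E₀‖ ≤ ‖v‖) (v : V) : |L₀ v| * ‖E₀‖ ≤ ‖v‖ := by
  simpa only [norm_smul, Real.norm_eq_abs] using hP v

variable {V : Type*} [NormedAddCommGroup V] [NormedSpace ℝ V] [FiniteDimensional ℝ V]

/-- A small perturbation of a rank-one projection plus a strict contraction has an eigenvalue
near `1`. -/
theorem exists_eigenvector_of_perturbation {T Λ : V →ₗ[ℝ] V} {L₀ : V →ₗ[ℝ] ℝ} {E₀ : V} {γ δ : ℝ}
    (hγ : 0 ≤ γ) (hγ1 : γ < 1) (hδ : 0 ≤ δ) (hγδ : 11 * δ ≤ 1 - γ)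
    (hE₀ : L₀ E₀ = 1) (hΛE : Λ E₀ = E₀) (hLΛ : ∀ v, L₀ (Λ v) = L₀ v)
    (hP : ∀ v, ‖L₀ v • E₀‖ ≤ ‖v‖) (hQ : ∀ v, ‖Λ v - L₀ v • E₀‖ ≤ γ * ‖v‖)
    (hT : ∀ v, ‖T v - Λ v‖ ≤ δ * ‖v‖) (hT1 : ∀ v, ‖T v‖ ≤ ‖v‖) :
    ∃ (p : ℝ) (E : V), 1 - 2 * δ ≤ p ∧ p ≤ 1 ∧ 7 * ‖E - E₀‖ ≤ 2 * ‖E₀‖ ∧ L₀ E = 1 ∧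
      T E = p • E := by
  have hE₀pos : 0 < ‖E₀‖ := norm_pos_iff.2 fun h => by simp [h] at hE₀
  have hLE := abs_mul_norm_le hP
  let D : V →ₗ[ℝ] V := T - Λ
  let P : V →ₗ[ℝ] V := L₀.smulRight E₀
  have hDn : ∀ v, ‖D v‖ ≤ δ * ‖v‖ := hT
  have hDP : ∀ v, ‖D v - L₀ (D v) • E₀‖ ≤ 2 * δ * ‖v‖ := fun v => by
    have := norm_sub_le (D v) (L₀ (D v) • E₀)
    have := hP (D v)
    have := hDn v
    linarith
  -- With `P` the projection `v ↦ L₀(v) E₀`, this is `(Λ - P) + (1 - P) D`; on `ker L₀` it is the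
  -- compression of `T`, and its norm is at most `γ + 2δ`.
  let A : V →L[ℝ] V := LinearMap.toContinuousLinearMap ((Λ - P) + (D - P ∘ₗ D))
  have hAv : ∀ v, A v = (Λ v - L₀ v • E₀) + (D v - L₀ (D v) • E₀) := fun v => rfl
  have hA : ‖A‖ ≤ γ + 2 * δ := by
    refine ContinuousLinearMap.opNorm_le_bound _ (by positivity) fun v => ?_
    rw [hAv]
    refine (norm_add_le _ _).trans ?_
    have := hQ v
    have := hDP v
    linarith
  have hLA : ∀ v, L₀ (A v) = 0 := fun v => by
    rw [hAv]
    simp [hLΛ, hE₀]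
  let w : V := D E₀ - L₀ (D E₀) • E₀
  have hLw : L₀ w = 0 := by simp [w, hE₀]
  have hlt : ∀ p, 1 - 2 * δ ≤ p → γ + 2 * δ < p := fun p hp => by linarith
  -- Seek an eigenvector `E₀ + y` with `L₀ y = 0`. The component in `ker L₀` reads `(p - A) y = w`
  -- and is solved by the resolvent; what remains is the scalar equation `p = 1 + L₀(D(E₀ + y))`.
  let y : ℝ → V := fun p => resolventAt A p w
  have hy : ∀ p, 1 - 2 * δ ≤ p → p • y p = A (y p) + w := fun p hp =>
    smul_resolventAt hA (hlt p hp) w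
  have hLy : ∀ p, 1 - 2 * δ ≤ p → L₀ (y p) = 0 := fun p hp => by
    have h := congrArg L₀ (hy p hp)
    rw [map_smul, map_add, hLA, hLw, add_zero, smul_eq_mul] at h
    refine (mul_eq_zero.1 h).resolve_left ?_
    linarith
  have hyn : ∀ p, 1 - 2 * δ ≤ p → 7 * ‖y p‖ ≤ 2 * ‖E₀‖ := fun p hp => by
    have h1 := mul_norm_resolventAt_le hA (hlt p hp) w
    have h2 := hDP E₀
    -- From `11δ ≤ 1 - γ`: the gap `p - (γ + 2δ)` is at least `1 - γ - 4δ ≥ 7(1 - γ)/11`, while `‖w‖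
    -- ≤ 2δ‖E₀‖ ≤ 2(1 - γ)‖E₀‖/11`.
    have hgap : 7 * (1 - γ) ≤ 11 * (p - (γ + 2 * δ)) := by linarith
    have h3 : 7 * (1 - γ) * ‖y p‖ ≤ 11 * (p - (γ + 2 * δ)) * ‖y p‖ :=
      mul_le_mul_of_nonneg_right hgap (norm_nonneg _)
    have h4 : 11 * δ * ‖E₀‖ ≤ (1 - γ) * ‖E₀‖ := mul_le_mul_of_nonneg_right hγδ (norm_nonneg _)
    have h5 : (1 - γ) * (7 * ‖y p‖) ≤ (1 - γ) * (2 * ‖E₀‖) := by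
      change (p - (γ + 2 * δ)) * ‖y p‖ ≤ ‖w‖ at h1
      change ‖w‖ ≤ _ at h2
      nlinarith
    exact le_of_mul_le_mul_left h5 (by linarith)
  have hDE : ∀ p, 1 - 2 * δ ≤ p → |L₀ (D (E₀ + y p))| ≤ 2 * δ := fun p hp => by
    have h1 := hLE (D (E₀ + y p))
    have h2 := hDn (E₀ + y p)
    have h3 := norm_add_le E₀ (y p)
    have h4 := hyn p hp
    have h5 : δ * ‖E₀ + y p‖ ≤ δ * (2 * ‖E₀‖) := mul_le_mul_of_nonneg_left (by linarith) hδ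
    have h6 : |L₀ (D (E₀ + y p))| * ‖E₀‖ ≤ 2 * δ * ‖E₀‖ := by linarith
    exact le_of_mul_le_mul_right h6 hE₀pos
  -- The intermediate value theorem applies because `|L₀(D(E₀ + y p))| ≤ 2δ` makes `f` change sign
  -- on `[1 - 2δ, 1 + 2δ]`.
  let f : ℝ → ℝ := fun p => 1 + L₀ (D (E₀ + y p)) - p
  have hf : ContinuousOn f (Set.Icc (1 - 2 * δ) (1 + 2 * δ)) := by
    have h1 : ContinuousOn y (Set.Icc (1 - 2 * δ) (1 + 2 * δ)) :=
      (continuousOn_resolventAt hA w).mono fun p hp => hlt p hp.1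
    have h2 : Continuous (L₀ ∘ₗ D) := LinearMap.continuous_of_finiteDimensional _
    exact (continuousOn_const.add (h2.comp_continuousOn (continuousOn_const.add h1))).sub
      continuousOn_id
  obtain ⟨p, hpI, hfp⟩ := intermediate_value_Icc' (by linarith) hf
    (show (0 : ℝ) ∈ Set.Icc (f (1 + 2 * δ)) (f (1 - 2 * δ)) by
      have h1 := abs_le.1 (hDE (1 + 2 * δ) (by linarith))
      have h2 := abs_le.1 (hDE (1 - 2 * δ) le_rfl)
      constructor <;> simp only [f] <;> linarith)
  have hp := hpI.1
  have hL1 : L₀ (E₀ + y p) = 1 := by rw [map_add, hE₀, hLy p hp, add_zero]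
  have hTE : T (E₀ + y p) = p • (E₀ + y p) := by
    have h1 : T (E₀ + y p) = Λ (E₀ + y p) + D (E₀ + y p) := by
      simp only [D, LinearMap.sub_apply]; abel
    have h2 : p = 1 + L₀ (D (E₀ + y p)) := (sub_eq_zero.1 hfp).symm
    rw [smul_add, hy p hp, hAv, hLy p hp, h1]
    nth_rewrite 3 [h2]
    simp only [w, map_add, hΛE]
    module
  refine ⟨p, E₀ + y p, hp, ?_, ?_, hL1, hTE⟩
  -- The upper bound `p ≤ 1` uses that `T` is a contraction.
  · have hE : 0 < ‖E₀ + y p‖ := norm_pos_iff.2 fun h => by simp [h] at hL1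
    have h := hT1 (E₀ + y p)
    rw [hTE, norm_smul, Real.norm_of_nonneg (by linarith)] at h
    exact le_of_mul_le_mul_right (by linarith) hE
  · rw [add_sub_cancel_left]
    exact hyn p hp

/-- A perturbation of a rank-one projection plus a strict contraction has an isolated eigenvalue,
and its powers are governed by it. -/
theorem exists_eigenvalue_of_perturbation {T Λ : V →ₗ[ℝ] V} {L₀ : V →ₗ[ℝ] ℝ} {E₀ : V} {γ δ : ℝ}
    (hγ : 0 ≤ γ) (hγ1 : γ < 1) (hδ : 0 ≤ δ) (hγδ : 11 * δ ≤ 1 - γ)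
    (hE₀ : L₀ E₀ = 1) (hΛE : Λ E₀ = E₀) (hLΛ : ∀ v, L₀ (Λ v) = L₀ v)
    (hP : ∀ v, ‖L₀ v • E₀‖ ≤ ‖v‖) (hQ : ∀ v, ‖Λ v - L₀ v • E₀‖ ≤ γ * ‖v‖)
    (hT : ∀ v, ‖T v - Λ v‖ ≤ δ * ‖v‖) (hT1 : ∀ v, ‖T v‖ ≤ ‖v‖) :
    ∃ (p : ℝ) (E : V) (L : V →ₗ[ℝ] ℝ), 1 - 2 * δ ≤ p ∧ p ≤ 1 ∧ ‖E‖ ≤ 2 * ‖E₀‖ ∧ |L E₀| ≤ 2 ∧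
      (∀ v, L (T v) = p * L v) ∧
      ∀ (m : ℕ) (v : V), ‖(T ^ m) v - (p ^ m * L v) • E‖ ≤ 4 * (γ + 3 * δ) ^ m * ‖v‖ := by
  obtain ⟨p, E, hp, hp1, hEE₀, hL₀E, hTE⟩ :=
    exists_eigenvector_of_perturbation hγ hγ1 hδ hγδ hE₀ hΛE hLΛ hP hQ hT hT1
  have hE₀pos : 0 < ‖E₀‖ := norm_pos_iff.2 fun h => by simp [h] at hE₀
  have hLE := abs_mul_norm_le hP
  have hE : 7 * ‖E‖ ≤ 9 * ‖E₀‖ := by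
    have := norm_add_le E₀ (E - E₀)
    rw [add_sub_cancel] at this
    linarith
  have hLEE : ∀ v, 7 * ‖L₀ v • E‖ ≤ 9 * ‖v‖ := fun v => by
    rw [norm_smul, Real.norm_eq_abs]
    have := hLE v
    have := mul_le_mul_of_nonneg_left hE (abs_nonneg (L₀ v))
    linarith
  let D : V →ₗ[ℝ] V := T - Λ
  have hDn : ∀ v, ‖D v‖ ≤ δ * ‖v‖ := hT
  have hTv : ∀ v, T v = Λ v + D v := fun v => by simp only [D, LinearMap.sub_apply]; abel
  -- `S` is the block of `T` on `ker L₀` along the exact eigenvector `E`: for `L₀ z = 0`, `T z = S z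
  -- + L₀(D z) E`, and `S` maps into `ker L₀`.
  let S : V →L[ℝ] V := LinearMap.toContinuousLinearMap
    ((Λ - L₀.smulRight E₀) + (D - (L₀ ∘ₗ D).smulRight E))
  have hSv : ∀ v, S v = (Λ v - L₀ v • E₀) + (D v - L₀ (D v) • E) := fun v => rfl
  have hS : ‖S‖ ≤ γ + 3 * δ := by
    refine ContinuousLinearMap.opNorm_le_bound _ (by positivity) fun v => ?_
    rw [hSv]
    refine (norm_add_le _ _).trans ?_
    have h1 := hQ v
    have h2 := norm_sub_le (D v) (L₀ (D v) • E)
    have h3 := hLEE (D v)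
    have h4 := hDn v
    linarith [norm_nonneg (D v)]
  have hLS : ∀ v, L₀ (S v) = 0 := fun v => by
    rw [hSv]
    simp [hLΛ, hE₀, hL₀E]
  have hlt : γ + 3 * δ < p := by linarith
  -- In the splitting `ker L₀ ⊕ ℝE` the operator `T` is triangular. This `c` solves `p c - c S = L₀
  -- D`, the equation that removes the off-diagonal term and turns `L₀` into the left
  -- eigenfunctional `L`.
  let c : V →ₗ[ℝ] ℝ := L₀ ∘ₗ D ∘ₗ (resolventAt S p : V →ₗ[ℝ] V)
  have hc : ∀ v, p * c v - c (S v) = L₀ (D v) := fun v => by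
    rw [← smul_eq_mul, ← map_smul, ← map_sub]
    change L₀ (D (resolventAt S p (p • v - S v))) = _
    rw [resolventAt_smul_sub hS hlt]
  have hcn : ∀ v, 6 * (|c v| * ‖E₀‖) ≤ ‖v‖ := fun v => by
    have h1 : |c v| * ‖E₀‖ ≤ ‖D (resolventAt S p v)‖ := hLE _
    have h2 := hDn (resolventAt S p v)
    have h3 := mul_norm_resolventAt_le hS hlt v
    -- Since `p ≥ 1 - 2δ` and `11δ ≤ 1 - γ`, the gap `p - (γ + 3δ)` is at least `6δ`.
    have h4 : 6 * δ * ‖resolventAt S p v‖ ≤ (p - (γ + 3 * δ)) * ‖resolventAt S p v‖ :=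
      mul_le_mul_of_nonneg_right (by linarith) (norm_nonneg _)
    linarith
  let L : V →ₗ[ℝ] ℝ := L₀ + c ∘ₗ (LinearMap.id - L₀.smulRight E)
  have hLv : ∀ v, L v = L₀ v + c (v - L₀ v • E) := fun v => rfl
  have hL₀z : ∀ v, L₀ (v - L₀ v • E) = 0 := fun v => by simp [hL₀E]
  have hTz : ∀ z, L₀ z = 0 → T z = S z + L₀ (D z) • E := fun z hz => by
    rw [hTv, hSv, hz]; module
  have hdecomp : ∀ v, T v = S (v - L₀ v • E) + L₀ (D (v - L₀ v • E)) • E + (L₀ v * p) • E := by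
    intro v
    rw [← hTz _ (hL₀z v), map_sub, map_smul, hTE]
    module
  refine ⟨p, E, L, hp, hp1, by linarith, ?_, ?_, ?_⟩
  · have h1 := hcn (E - E₀)
    have h2 : L E₀ = 1 - c (E - E₀) := by
      rw [hLv, hE₀, one_smul, ← neg_sub, map_neg]; ring
    have h3 : |c (E - E₀)| ≤ 1 := by
      refine le_of_mul_le_mul_right ?_ hE₀pos
      linarith [mul_nonneg (abs_nonneg (c (E - E₀))) (norm_nonneg E₀)]
    rw [h2, abs_le]
    have := abs_le.1 h3
    constructor <;> linarith
  · intro v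
    have h1 : L₀ (T v) = L₀ (D (v - L₀ v • E)) + L₀ v * p := by
      rw [hdecomp v]
      simp [hLS, hL₀E]
    have h2 : T v - L₀ (T v) • E = S (v - L₀ v • E) := by
      rw [h1]
      nth_rewrite 1 [hdecomp v]
      module
    rw [hLv, h2, h1, ← hc, hLv]
    ring
  · intro m v
    set z := v - L₀ v • E with hz
    have hSm : ∀ m : ℕ, L₀ ((S ^ m) z) = 0 := by
      intro m
      cases m with
      | zero => exact hL₀z v
      | succ m => rw [pow_succ', mul_apply_eq_comp, hLS]
    -- The vector `z - c(z) E` is the part of `v` on which `L` vanishes, and `T` carries it to `S z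
    -- - c(S z) E`.
    have hpow : ∀ m : ℕ, (T ^ m) v - (p ^ m * L v) • E = (S ^ m) z - c ((S ^ m) z) • E := by
      intro m
      induction m with
      | zero =>
        simp only [pow_zero, Module.End.one_apply, one_apply_eq_self, one_mul, hLv]
        rw [hz]
        module
      | succ m ih =>
        rw [sub_eq_iff_eq_add] at ih
        rw [pow_succ', Module.End.mul_apply, ih, map_add, map_sub, map_smul, map_smul, hTE,
          hTz _ (hSm m), ← hc, pow_succ' S, mul_apply_eq_comp, pow_succ' p]
        module
    rw [hpow]
    have h1 : ‖(S ^ m) z‖ ≤ (γ + 3 * δ) ^ m * ‖z‖ := by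
      refine (S ^ m).le_of_opNorm_le ?_ z
      rcases m.eq_zero_or_pos with rfl | hm
      · rw [pow_zero, pow_zero]
        exact ContinuousLinearMap.norm_id_le
      · exact (norm_pow_le' S hm).trans (pow_le_pow_left₀ (norm_nonneg _) hS m)
    have h2 : 7 * ‖z‖ ≤ 16 * ‖v‖ := by
      have := norm_sub_le v (L₀ v • E)
      have := hLEE v
      linarith
    have h3 : 42 * ‖c ((S ^ m) z) • E‖ ≤ 9 * ‖(S ^ m) z‖ := by
      rw [norm_smul, Real.norm_eq_abs]
      have h5 := hcn ((S ^ m) z)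
      have h6 := mul_le_mul_of_nonneg_left hE (abs_nonneg (c ((S ^ m) z)))
      linarith
    have h4 := norm_sub_le ((S ^ m) z) (c ((S ^ m) z) • E)
    have h7 : (γ + 3 * δ) ^ m * (7 * ‖z‖) ≤ (γ + 3 * δ) ^ m * (16 * ‖v‖) :=
      mul_le_mul_of_nonneg_left h2 (by positivity)
    have h8 : 0 ≤ (γ + 3 * δ) ^ m * ‖v‖ := by positivity
    linarith

end Eigenvalue

/-- A left eigenfunctional of a perturbed projection is controlled, in any norm, by the
unperturbed functional. -/
theorem abs_eigenfunctional_le {V : Type*} [AddCommGroup V] [Module ℝ V]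
    {T Λ : V →ₗ[ℝ] V} {L₀ L : V →ₗ[ℝ] ℝ} {E₀ : V} {γ δ p κ K : ℝ} {N : V → ℝ}
    (hN0 : ∀ v, 0 ≤ N v) (hNsub : ∀ v w, N (v - w) ≤ N v + N w)
    (hγ1 : γ < 1) (hδ : 0 ≤ δ) (hγδ : 11 * δ ≤ 1 - γ)
    (hp : 1 - 2 * δ ≤ p)
    (hE₀ : L₀ E₀ = 1) (hLΛ : ∀ v, L₀ (Λ v) = L₀ v) (hΛE : Λ E₀ = E₀)
    (hP : ∀ v, N (L₀ v • E₀) ≤ N v) (hQ : ∀ v, N (Λ v - L₀ v • E₀) ≤ γ * N v)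
    (hT : ∀ v, N (T v - Λ v) ≤ 2 * δ * N v) (hκ : ∀ v, |L₀ v| ≤ κ * N v)
    (hLT : ∀ v, L (T v) = p * L v) (hK : ∀ v, |L v| ≤ K * N v) (v : V) :
    |L v| ≤ 9 / 5 * |L E₀| * κ * N v := by
  have hNE : 0 < N E₀ := by
    refine (hN0 E₀).lt_of_ne fun h => ?_
    have := hκ E₀
    rw [← h, hE₀] at this
    norm_num at this
  have hκ0 : 0 ≤ κ := by
    have h := (abs_nonneg _).trans (hκ E₀)
    exact nonneg_of_mul_nonneg_left h hNE
  have hK0 : 0 ≤ K := by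
    have h := (abs_nonneg _).trans (hK E₀)
    exact nonneg_of_mul_nonneg_left h hNE
  have hγ : 0 ≤ γ := nonneg_of_mul_nonneg_left ((hN0 _).trans (hQ E₀)) hNE
  have hp0 : 0 < p := by linarith
  let D : V →ₗ[ℝ] V := T - Λ
  have hTv : ∀ v, T v = Λ v + D v := fun v => by simp only [D, LinearMap.sub_apply]; abel
  -- `L₁` vanishes at `E₀`, so `p L₁ = L₁ ∘ T + …` sees only the contracting part `Λ - P`, terms
  -- with `D`, and a source proportional to `L₀`.
  let L₁ : V →ₗ[ℝ] ℝ := L - L E₀ • L₀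
  have hL₁ : ∀ v, L₁ v = L v - L E₀ * L₀ v := fun v => rfl
  have hDN : ∀ v, N (D (v - L₀ v • E₀)) ≤ 4 * δ * N v := fun v => by
    have h1 : N (D (v - L₀ v • E₀)) ≤ 2 * δ * N (v - L₀ v • E₀) := hT _
    have h2 : N (v - L₀ v • E₀) ≤ 2 * N v := by
      linarith [hNsub v (L₀ v • E₀), hP v]
    have := mul_le_mul_of_nonneg_left h2 (by positivity : 0 ≤ 2 * δ)
    linarith
  have hrec : ∀ v, p * L₁ v = L₁ (Λ v - L₀ v • E₀) + L₁ (D (v - L₀ v • E₀))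
      + L E₀ * L₀ (D (v - L₀ v • E₀)) := fun v => by
    have h1 := hLT v
    have h2 := hLT E₀
    rw [hTv, map_add] at h1 h2
    rw [hΛE] at h2
    simp only [hL₁, map_sub, map_smul, smul_eq_mul, hE₀, hLΛ]
    linear_combination L₀ v * h2 - h1
  -- With this `c` the source `4δ |L E₀| κ` equals `5δ c`, so `c` is stable under the recursion as
  -- soon as `γ + 9δ ≤ p`, which is `11δ ≤ 1 - γ`. Adding `|L E₀| κ` gives the constant `9/5`.
  set c := 4 / 5 * |L E₀| * κ with hc
  have hc0 : 0 ≤ c := by positivity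
  let K₁ := K + |L E₀| * κ
  let q := (γ + 4 * δ) / p
  have hK₁ : 0 ≤ K₁ := by positivity
  have hq0 : 0 ≤ q := by positivity
  have hq1 : q < 1 := (div_lt_one hp0).2 (by linarith)
  -- The a priori constant `K`, possibly huge in the dimension, is damped by `q < 1` at every
  -- iteration and disappears in the limit.
  have hbound : ∀ (k : ℕ) (v : V), |L₁ v| ≤ (c + K₁ * q ^ k) * N v := by
    intro k
    induction k with
    | zero =>
      intro v
      have h1 : |L₁ v| ≤ |L v| + |L E₀ * L₀ v| := by rw [hL₁]; exact abs_sub _ _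
      rw [abs_mul] at h1
      have h2 := mul_le_mul_of_nonneg_left (hκ v) (abs_nonneg (L E₀))
      have h3 := hK v
      have h4 := mul_nonneg hc0 (hN0 v)
      simp only [K₁, pow_zero]
      linarith
    | succ k ih =>
      intro v
      have hb : 0 ≤ c + K₁ * q ^ k := by positivity
      have h1 := (ih (Λ v - L₀ v • E₀)).trans (mul_le_mul_of_nonneg_left (hQ v) hb)
      have h2 := (ih (D (v - L₀ v • E₀))).trans (mul_le_mul_of_nonneg_left (hDN v) hb)
      have h3 : |L E₀ * L₀ (D (v - L₀ v • E₀))| ≤ 5 * δ * c * N v := by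
        rw [abs_mul]
        have := (hκ (D (v - L₀ v • E₀))).trans (mul_le_mul_of_nonneg_left (hDN v) hκ0)
        have := mul_le_mul_of_nonneg_left this (abs_nonneg (L E₀))
        rw [hc]
        linarith
      have h4 : p * |L₁ v| ≤ (c + K₁ * q ^ k) * (γ * N v) + (c + K₁ * q ^ k) * (4 * δ * N v)
          + 5 * δ * c * N v := by
        have h5 : p * |L₁ v| = |p * L₁ v| := by rw [abs_mul, abs_of_pos hp0]
        rw [h5, hrec]
        refine (abs_add_le _ _).trans (add_le_add ((abs_add_le _ _).trans (add_le_add h1 h2)) h3)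
      have h5 : p * q = γ + 4 * δ := mul_div_cancel₀ _ hp0.ne'
      have h6 : p * ((c + K₁ * q ^ (k + 1)) * N v)
          = p * (c * N v) + (γ + 4 * δ) * (K₁ * q ^ k * N v) := by
        rw [← h5]; ring
      have h7 : (γ + 9 * δ) * (c * N v) ≤ p * (c * N v) :=
        mul_le_mul_of_nonneg_right (by linarith) (mul_nonneg hc0 (hN0 v))
      refine le_of_mul_le_mul_left ?_ hp0
      rw [h6]
      linarith
  have hlim : Filter.Tendsto (fun k : ℕ => (c + K₁ * q ^ k) * N v) Filter.atTop
      (nhds ((c + K₁ * 0) * N v)) :=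
    (((tendsto_pow_atTop_nhds_zero_of_lt_one hq0 hq1).const_mul K₁).const_add c).mul_const _
  have h1 : |L₁ v| ≤ c * N v := by
    have := ge_of_tendsto' hlim fun k => hbound k v
    simpa using this
  have h2 : |L v| ≤ |L₁ v| + |L E₀ * L₀ v| := by
    have : L v = L₁ v + L E₀ * L₀ v := by rw [hL₁]; ring
    rw [this]; exact abs_add_le _ _
  rw [abs_mul] at h2
  have h3 := mul_le_mul_of_nonneg_left (hκ v) (abs_nonneg (L E₀))
  rw [hc] at h1
  linarith

end Perturbation

end XEB
end

noncomputable section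

namespace XEB

/-! ### The transfer operator of a linear XEB scheme -/

section SuperMeasurable

variable {n : ℕ} {α : Type*} [MeasurableSpace α]

/-- Entrywise measurability of a family of superoperators. -/
def SuperMeasurable (F : α → Superop n) : Prop :=
  ∀ i j k l, Measurable fun x => F x (Matrix.single k l 1) i j

theorem SuperMeasurable.comp {F G : α → Superop n} (hF : SuperMeasurable F)
    (hG : SuperMeasurable G) : SuperMeasurable fun x => F x ∘ₗ G x := fun i j k l => by
  have : (fun x => F x (G x (Matrix.single k l 1)) i j)
      = fun x => ∑ a, ∑ b, G x (Matrix.single k l 1) a b * F x (Matrix.single a b 1) i j :=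
    funext fun x => superop_apply_eq_sum _ _ _ _
  simp only [LinearMap.comp_apply]
  rw [this]
  exact Finset.measurable_sum _ fun a _ => Finset.measurable_sum _ fun b _ =>
    (hG a b k l).mul (hF i j a b)

theorem SuperMeasurable.sub {F G : α → Superop n} (hF : SuperMeasurable F)
    (hG : SuperMeasurable G) : SuperMeasurable fun x => F x - G x := fun i j k l =>
  (hF i j k l).sub (hG i j k l)

theorem superMeasurable_const (C : Superop n) : SuperMeasurable fun _ : α => C := fun _ _ _ _ =>
  measurable_const

theorem superMeasurable_omega : SuperMeasurable fun g : SU n => omega g := fun i j k l => by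
  have hg : Continuous fun g : SU n => (g : Op n) := continuous_subtype_val
  exact (((hg.matrix_mul continuous_const).matrix_mul
    hg.matrix_conjTranspose).matrix_elem i j).measurable

theorem superMeasurable_omega_inv : SuperMeasurable fun g : SU n => omega g⁻¹ := fun i j k l =>
  (superMeasurable_omega i j k l).comp measurable_inv

theorem SuperMeasurable.comp_measurable {β : Type*} [MeasurableSpace β] {F : α → Superop n}
    (hF : SuperMeasurable F) {f : β → α} (hf : Measurable f) : SuperMeasurable fun x => F (f x) :=
  fun i j k l => (hF i j k l).comp hf

end SuperMeasurable

namespace LinearXEB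

variable {n : ℕ} (X : LinearXEB n)

theorem superMeasurable_phi : SuperMeasurable X.φ := fun i j k l =>
  X.measurable_φ (Matrix.single k l 1) i j

theorem superMeasurable_step {α : Type*} [MeasurableSpace α] {g : α → X.S} (hg : Measurable g)
    {F : α → Superop n} (hF : SuperMeasurable F) :
    SuperMeasurable fun x => omega (g x : SU n)⁻¹ ∘ₗ F x ∘ₗ X.φ (g x) :=
  (superMeasurable_omega_inv.comp_measurable (measurable_subtype_coe.comp hg)).comp
    (hF.comp (X.superMeasurable_phi.comp_measurable hg))

theorem diamondNorm_step_le (g : X.S) (C : Superop n) :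
    diamondNorm (omega (g : SU n)⁻¹ ∘ₗ C ∘ₗ X.φ g) ≤ diamondNorm C :=
  diamondNorm_comp_comp_le_of_le_one (diamondNorm_omega_le _) (X.isChannel_φ g).diamondNorm_le_one C

theorem superIntegrable_step (C : Superop n) :
    SuperIntegrable (fun g : X.S => omega (g : SU n)⁻¹ ∘ₗ C ∘ₗ X.φ g) X.μ :=
  superIntegrable_of_measurable_of_le
    (X.superMeasurable_step measurable_id (superMeasurable_const C))
    fun g => X.diamondNorm_step_le g C

/-- The average `C ↦ E[ω(g†) ∘ C ∘ φ(g)]` over the gates. -/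
def transfer : Superop n →ₗ[ℂ] Superop n where
  toFun C := superIntegral X.μ fun g => omega (g : SU n)⁻¹ ∘ₗ C ∘ₗ X.φ g
  map_add' C C' := superop_ext_single fun i j k l => by
    rw [superIntegral_single, LinearMap.add_apply, Matrix.add_apply, superIntegral_single,
      superIntegral_single,
      ← integral_add (X.superIntegrable_step C i j k l) (X.superIntegrable_step C' i j k l)]
    simp
  map_smul' c C := superop_ext_single fun i j k l => by
    rw [superIntegral_single, RingHom.id_apply, LinearMap.smul_apply, Matrix.smul_apply,
      superIntegral_single, smul_eq_mul, ← integral_const_mul]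
    simp

theorem transfer_apply (C : Superop n) :
    X.transfer C = superIntegral X.μ fun g => omega (g : SU n)⁻¹ ∘ₗ C ∘ₗ X.φ g := rfl

theorem twirl_gateLaw (C : Superop n) :
    twirl X.gateLaw C = superIntegral X.μ fun g => conjBy (g : SU n) C := by
  rw [twirl_eq_superIntegral]
  refine superop_ext_single fun i j k l => ?_
  rw [superIntegral_single, superIntegral_single]
  exact integral_map measurable_subtype_coe.aemeasurable
    (continuous_twirl_entry C (Matrix.single k l 1) i j).aestronglyMeasurable

theorem superIntegrable_conjBy_coe (C : Superop n) :
    SuperIntegrable (fun g : X.S => conjBy (g : SU n) C) X.μ :=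
  superIntegrable_of_measurable_of_le
    ((superMeasurable_omega_inv.comp_measurable measurable_subtype_coe).comp
      ((superMeasurable_const C).comp
        (superMeasurable_omega.comp_measurable measurable_subtype_coe)))
    fun g => diamondNorm_conjBy_le (g : SU n) C

theorem diamondNorm_transfer_le (C : Superop n) : diamondNorm (X.transfer C) ≤ diamondNorm C := by
  refine (diamondNorm_superIntegral_le (X.superIntegrable_step C)
    (integrable_const (diamondNorm C)) fun g => X.diamondNorm_step_le g C).trans ?_
  simp

theorem transfer_sub_twirl (C : Superop n) :
    X.transfer C - twirl X.gateLaw C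
      = superIntegral X.μ fun g => omega (g : SU n)⁻¹ ∘ₗ C ∘ₗ (X.φ g - omega (g : SU n)) := by
  rw [twirl_gateLaw, transfer_apply,
    superIntegral_sub (X.superIntegrable_step C) (X.superIntegrable_conjBy_coe C)]
  congr 1
  ext1 g
  rw [conjBy_apply, LinearMap.comp_sub, LinearMap.comp_sub]

theorem superIntegrable_transfer_sub_twirl (C : Superop n) :
    SuperIntegrable
      (fun g : X.S => omega (g : SU n)⁻¹ ∘ₗ C ∘ₗ (X.φ g - omega (g : SU n))) X.μ := by
  have h := (X.superIntegrable_step C).sub (X.superIntegrable_conjBy_coe C)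
  simpa only [conjBy_apply, ← LinearMap.comp_sub] using h

theorem integrable_diamondNorm_sub :
    Integrable (fun g => diamondNorm (X.φ g - omega (g : SU n))) X.μ := by
  refine Integrable.of_bound (C := 2) (measurable_diamondNorm (X.superMeasurable_phi.sub
    (superMeasurable_omega.comp_measurable measurable_subtype_coe))).aestronglyMeasurable
    (Filter.Eventually.of_forall fun g => ?_)
  rw [Real.norm_of_nonneg (diamondNorm_nonneg _)]
  have h1 := diamondNorm_sub_le (X.φ g) (omega (g : SU n))
  have h2 := (X.isChannel_φ g).diamondNorm_le_one
  have h3 := diamondNorm_omega_le (g : SU n)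
  linarith

theorem avgError_nonneg : 0 ≤ X.avgError := integral_nonneg fun _ => diamondNorm_nonneg _

theorem diamondNorm_transfer_sub_twirl_le (C : Superop n) :
    diamondNorm (X.transfer C - twirl X.gateLaw C) ≤ X.avgError * diamondNorm C := by
  rw [transfer_sub_twirl, avgError, ← integral_mul_const]
  refine diamondNorm_superIntegral_le (X.superIntegrable_transfer_sub_twirl C)
    (X.integrable_diamondNorm_sub.mul_const _) fun g => ?_
  have h1 := diamondNorm_comp_le (omega (g : SU n)⁻¹) (C ∘ₗ (X.φ g - omega (g : SU n)))
  have h2 := mul_le_of_le_one_left (diamondNorm_nonneg (C ∘ₗ (X.φ g - omega (g : SU n))))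
    (diamondNorm_omega_le (g : SU n)⁻¹)
  have h3 := diamondNorm_comp_le C (X.φ g - omega (g : SU n))
  rw [mul_comm] at h3
  exact h1.trans (h2.trans h3)

/-- The error channel `φ(g) - ω(g)` is Hermitian-preserving, so each integrand costs `‖φ(g) -
ω(g)‖_⋄`; the unitary on the left becomes a two-sided multiplication by unitaries after reshuffling.
-/
theorem diamondNorm_reshuffle_transfer_sub_twirl_le (C : Superop n) :
    diamondNorm (reshuffle n (X.transfer C - twirl X.gateLaw C))
      ≤ X.avgError * diamondNorm (reshuffle n C) := by
  have hF := X.superIntegrable_transfer_sub_twirl C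
  rw [transfer_sub_twirl, avgError, ← integral_mul_const, map_superIntegral hF]
  refine diamondNorm_superIntegral_le (hF.map _)
    (X.integrable_diamondNorm_sub.mul_const _) fun g => ?_
  have hΨ : IsHermitianPreserving (X.φ g - omega (g : SU n)) := fun Y hY =>
    ((X.isChannel_φ g).isHermitianPreserving Y hY).sub (isHermitianPreserving_omega (g : SU n) Y hY)
  exact (diamondNorm_reshuffle_conjMap_comp_le (coe_SU_conjTranspose_mul (g : SU n)⁻¹)
    (coe_SU_mul_conjTranspose (g : SU n)⁻¹) _).trans (diamondNorm_reshuffle_comp_le hΨ C)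

theorem isHermitianPreserving_transfer {C : Superop n} (hC : IsHermitianPreserving C) :
    IsHermitianPreserving (X.transfer C) :=
  isHermitianPreserving_superIntegral fun g =>
    (isHermitianPreserving_omega _).comp (hC.comp (X.isChannel_φ g).isHermitianPreserving)

theorem trace_transfer_apply {C : Superop n} (hC : ∀ Y, (C Y).trace = 0) (Y : Op n) :
    (X.transfer C Y).trace = 0 := by
  let f : Superop n →ₗ[ℂ] ℂ := Matrix.traceLinearMap (Bits n) ℂ ℂ ∘ₗ LinearMap.applyₗ Y
  change f (X.transfer C) = 0
  rw [transfer_apply, linearMap_superIntegral (X.superIntegrable_step C)]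
  have : ∀ g : X.S, f (omega (g : SU n)⁻¹ ∘ₗ C ∘ₗ X.φ g) = 0 := by
    intro g
    change (omega (g : SU n)⁻¹ (C (X.φ g Y))).trace = 0
    rw [omega_apply, Matrix.trace_mul_comm, ← Matrix.mul_assoc, coe_SU_conjTranspose_mul,
      Matrix.one_mul, hC]
  simp [this]

theorem transfer_rankOne_one : X.transfer (rankOne 1 1) = rankOne 1 1 := by
  have : ∀ g : X.S, omega (g : SU n)⁻¹ ∘ₗ rankOne 1 1 ∘ₗ X.φ g = rankOne 1 1 := by
    intro g
    ext Y : 1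
    simp only [LinearMap.comp_apply, rankOne_apply, Matrix.one_mul, map_smul, omega_apply,
      Matrix.mul_one, (X.isChannel_φ g).tracePreserving, coe_SU_mul_conjTranspose]
  rw [transfer_apply]
  simp only [this, superIntegral_const]

/-! ### The XEB quantity through the transfer operator -/

theorem idealCircuit_succ {m : ℕ} (g : Fin (m + 1) → X.S) :
    X.idealCircuit g = X.idealCircuit (fun i => g i.succ) * (g 0 : SU n) := by
  simp [idealCircuit, List.ofFn_succ]

theorem noisyCircuit_succ {m : ℕ} (g : Fin (m + 1) → X.S) :
    X.noisyCircuit g = X.noisyCircuit (fun i => g i.succ) ∘ₗ X.φ (g 0) := by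
  simp [noisyCircuit, List.ofFn_succ, Module.End.mul_eq_comp]

/-- The superoperator that results from `C` by precomposition with the noisy circuit and
postcomposition with the inverse of the ideal circuit. -/
def echo (C : Superop n) {m : ℕ} (g : Fin m → X.S) : Superop n :=
  omega (X.idealCircuit g)⁻¹ ∘ₗ C ∘ₗ X.noisyCircuit g

theorem echo_zero (C : Superop n) (g : Fin 0 → X.S) : X.echo C g = C := by
  ext Y : 1
  simp [echo, idealCircuit, noisyCircuit, omega_one]

/-- The first gate `g 0` is innermost in both circuits, hence outermost on both sides here; this
gives the recursion for `transfer`. -/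
theorem echo_succ (C : Superop n) {m : ℕ} (g : Fin (m + 1) → X.S) :
    X.echo C g = omega (g 0 : SU n)⁻¹ ∘ₗ X.echo C (fun i => g i.succ) ∘ₗ X.φ (g 0) := by
  rw [echo, echo, idealCircuit_succ, noisyCircuit_succ, mul_inv_rev, omega_mul]
  simp only [LinearMap.comp_assoc]

theorem superMeasurable_echo (C : Superop n) (m : ℕ) :
    SuperMeasurable fun g : Fin m → X.S => X.echo C g := by
  induction m with
  | zero => simpa only [echo_zero] using superMeasurable_const C
  | succ m ih =>
    simp only [echo_succ]
    exact X.superMeasurable_step (measurable_pi_apply 0)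
      (ih.comp_measurable (measurable_pi_lambda _ fun i => measurable_pi_apply i.succ))

theorem diamondNorm_echo_le (C : Superop n) {m : ℕ} (g : Fin m → X.S) :
    diamondNorm (X.echo C g) ≤ diamondNorm C := by
  induction m with
  | zero => rw [echo_zero]
  | succ m ih =>
    rw [echo_succ]
    exact (X.diamondNorm_step_le _ _).trans (ih _)

theorem superIntegrable_echo (C : Superop n) (m : ℕ) :
    SuperIntegrable (fun g : Fin m → X.S => X.echo C g) (Measure.pi fun _ => X.μ) :=
  superIntegrable_of_measurable_of_le (X.superMeasurable_echo C m) fun g =>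
    X.diamondNorm_echo_le C g

/-- Fubini separates the first gate from the independent remaining ones, and composition with its
two channels commutes with the inner integral. -/
theorem superIntegral_echo (C : Superop n) (m : ℕ) :
    superIntegral (Measure.pi fun _ : Fin m => X.μ) (fun g => X.echo C g)
      = (X.transfer ^ m) C := by
  induction m with
  | zero =>
    simp only [echo_zero, superIntegral_const, pow_zero, Module.End.one_apply]
  | succ m ih =>
    rw [pow_succ', Module.End.mul_apply, ← ih]
    refine superop_ext_single fun i j k l => ?_
    rw [superIntegral_single, transfer_apply, superIntegral_single]
    let H : X.S × (Fin m → X.S) → Superop n := fun p =>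
      omega (p.1 : SU n)⁻¹ ∘ₗ X.echo C p.2 ∘ₗ X.φ p.1
    have hH : SuperIntegrable H (X.μ.prod (Measure.pi fun _ : Fin m => X.μ)) :=
      superIntegrable_of_measurable_of_le
        (X.superMeasurable_step measurable_fst
          ((X.superMeasurable_echo C m).comp_measurable measurable_snd))
        fun p => (X.diamondNorm_step_le _ _).trans (X.diamondNorm_echo_le C _)
    have hmp := measurePreserving_piFinSuccAbove (fun _ : Fin (m + 1) => X.μ) 0
    have h1 : ∫ g, X.echo C g (Matrix.single k l 1) i j ∂(Measure.pi fun _ : Fin (m + 1) => X.μ)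
        = ∫ p, H p (Matrix.single k l 1) i j
          ∂(X.μ.prod (Measure.pi fun _ : Fin m => X.μ)) := by
      rw [← hmp.integral_comp']
      refine integral_congr_ae (Filter.Eventually.of_forall fun g => ?_)
      change X.echo C g _ i j = _
      rw [echo_succ]
      rfl
    rw [h1, integral_prod _ (hH i j k l)]
    refine integral_congr_ae (Filter.Eventually.of_forall fun g => ?_)
    exact (linearMap_superIntegral (X.superIntegrable_echo C m)
      (superEntry i j k l ∘ₗ sandwich (omega (g : SU n)⁻¹) (X.φ g))).symm

/-- The superoperator of the noisy measurement. -/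
def measurement : Superop n := ∑ x, rankOne (Matrix.single x x 1) (X.M x)

theorem measurement_apply (Y : Op n) :
    X.measurement Y = ∑ x, (X.M x * Y).trace • Matrix.single x x 1 := by
  simp [measurement, rankOne_apply]

/-- `|⟨x|U|0⟩|² = ⟨0|U†|x⟩⟨x|U|0⟩`, so pulling `|x⟩⟨x|` back through the ideal circuit produces the
ideal probability as an entry. -/
theorem sum_idealProb_mul_noisyProb {m : ℕ} (g : Fin m → X.S) :
    ∑ x, X.idealProb g x * X.noisyProb g x = (X.echo X.measurement g X.ρ₀ 0 0).re := by
  rw [echo, LinearMap.comp_apply, LinearMap.comp_apply, measurement_apply, map_sum,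
    Matrix.sum_apply, Complex.re_sum]
  refine Finset.sum_congr rfl fun x _ => ?_
  have h : omega (X.idealCircuit g)⁻¹ (Matrix.single x x 1) 0 0
      = ((X.idealProb g x : ℝ) : ℂ) := by
    rw [omega_apply, coe_SU_inv, Matrix.conjTranspose_conjTranspose, idealProb,
      ← Complex.normSq_eq_norm_sq, Complex.normSq_eq_conj_mul_self]
    simp [Matrix.mul_apply, Matrix.single_apply, ite_and]
  rw [map_smul, Matrix.smul_apply, h, smul_eq_mul, Complex.re_mul_ofReal, mul_comm]
  rfl

theorem qR_eq (m : ℕ) :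
    X.qR m = -1 + 2 ^ n * ((X.transfer ^ m) X.measurement X.ρ₀ 0 0).re := by
  let f : Superop n →ₗ[ℂ] ℂ := Matrix.entryLinearMap ℂ ℂ 0 0 ∘ₗ LinearMap.applyₗ X.ρ₀
  have h1 : (X.transfer ^ m) X.measurement X.ρ₀ 0 0
      = ∫ g, f (X.echo X.measurement g) ∂(Measure.pi fun _ : Fin m => X.μ) := by
    rw [← linearMap_superIntegral (X.superIntegrable_echo _ m), superIntegral_echo]
    rfl
  have h2 := integral_re ((X.superIntegrable_echo X.measurement m).linearMap f)
  simp only [RCLike.re_to_complex] at h2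
  rw [qR, h1, ← h2]
  simp only [sum_idealProb_mul_noisyProb]
  rfl

/-- The noisy measurement, compared with the uniform distribution. -/
def signal : Superop n := X.measurement - ((2 : ℂ) ^ n)⁻¹ • rankOne 1 1

theorem transfer_pow_rankOne_one (m : ℕ) : (X.transfer ^ m) (rankOne 1 1) = rankOne 1 1 := by
  induction m with
  | zero => rfl
  | succ m ih => rw [pow_succ, Module.End.mul_apply, transfer_rankOne_one, ih]

/-- The depolarizing part is invariant and has entry `2^{-n}` at a state of trace one, so it
contributes exactly the `1` that cancels the `-1`. -/
theorem qR_eq_signal (m : ℕ) :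
    X.qR m = 2 ^ n * ((X.transfer ^ m) X.signal X.ρ₀ 0 0).re := by
  have h : ((X.transfer ^ m) X.measurement X.ρ₀ 0 0).re
      = ((X.transfer ^ m) X.signal X.ρ₀ 0 0).re + (2 ^ n)⁻¹ := by
    have h1 : X.measurement = X.signal + ((2 : ℂ) ^ n)⁻¹ • rankOne 1 1 := by
      rw [signal, sub_add_cancel]
    rw [h1, map_add, map_smul, transfer_pow_rankOne_one, LinearMap.add_apply, Matrix.add_apply,
      LinearMap.smul_apply, Matrix.smul_apply, rankOne_apply, Matrix.one_mul, X.trace_ρ₀, one_smul,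
      Matrix.one_apply_eq, Complex.add_re, smul_eq_mul, mul_one]
    congr 1
    have : ((2 : ℂ) ^ n)⁻¹ = (((2 : ℝ) ^ n)⁻¹ : ℝ) := by push_cast; rfl
    rw [this, Complex.ofReal_re]
  rw [qR_eq, h, mul_add, mul_inv_cancel₀ (by positivity)]
  ring

end LinearXEB

end XEB
end

noncomputable section

namespace XEB

/-! ### Measure-and-prepare channels -/

section MeasurePrepare

variable {n : ℕ}

/-- With `ρ_x = H†H` and `M_x = G†G`, the operators `H† E_jk G` are Kraus operators of the
measure-and-prepare channel, because `∑ E_jk Y E_kj = tr(Y) 1`. -/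
theorem diamondNorm_sum_rankOne_le {J : Type*} [Fintype J] [DecidableEq J] {ρ M : J → Op n}
    (hρ : ∀ x, (ρ x).PosSemidef) (hρ1 : ∀ x, (ρ x).trace = 1) (hM : ∀ x, (M x).PosSemidef)
    (hM1 : ∑ x, M x = 1) : diamondNorm (∑ x, rankOne (ρ x) (M x)) ≤ 1 := by
  choose H hH using fun x => exists_conjTranspose_mul_self_eq (hρ x)
  choose G hG using fun x => exists_conjTranspose_mul_self_eq (hM x)
  have hsum : ∀ Y : Op n, ∑ j, ∑ k, Matrix.single j k 1 * Y * Matrix.single k j (1 : ℂ)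
      = Y.trace • (1 : Op n) := by
    intro Y
    have h1 : ∀ j k, Matrix.single j k 1 * Y * Matrix.single k j (1 : ℂ)
        = Y k k • Matrix.single j j (1 : ℂ) := by
      intro j k
      rw [Matrix.single_mul_mul_single, one_mul, mul_one, Matrix.smul_single, smul_eq_mul, mul_one]
    simp only [h1, ← Finset.sum_smul, ← Finset.smul_sum, Matrix.sum_single_one]
    rfl
  refine diamondNorm_le_one_of_kraus (J := J × Bits n × Bits n)
    (K := fun q => (H q.1)ᴴ * Matrix.single q.2.1 q.2.2 1 * G q.1) (fun Y => ?_) ?_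
  · rw [LinearMap.sum_apply, Fintype.sum_prod_type]
    refine Finset.sum_congr rfl fun x _ => ?_
    have h2 : ∀ j k : Bits n, (H x)ᴴ * Matrix.single j k 1 * G x * Y
        * ((H x)ᴴ * Matrix.single j k 1 * G x)ᴴ
        = (H x)ᴴ * (Matrix.single j k 1 * (G x * Y * (G x)ᴴ) * Matrix.single k j (1 : ℂ)) * H x := by
      intro j k
      simp only [Matrix.conjTranspose_mul, Matrix.conjTranspose_single,
        Matrix.conjTranspose_conjTranspose, star_one, Matrix.mul_assoc]
    rw [Fintype.sum_prod_type]
    simp only [h2, ← Matrix.sum_mul, ← Matrix.mul_sum, hsum]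
    rw [rankOne_apply, hH x, hG x, Matrix.mul_smul, Matrix.smul_mul, Matrix.mul_one,
      Matrix.mul_assoc, Matrix.trace_mul_comm]
  · rw [Fintype.sum_prod_type, ← hM1]
    refine Finset.sum_congr rfl fun x _ => ?_
    have h2 : ∀ j k : Bits n, ((H x)ᴴ * Matrix.single j k 1 * G x)ᴴ
        * ((H x)ᴴ * Matrix.single j k 1 * G x)
        = (G x)ᴴ * (Matrix.single k j 1 * (H x * (H x)ᴴ) * Matrix.single j k (1 : ℂ)) * G x := by
      intro j k
      simp only [Matrix.conjTranspose_mul, Matrix.conjTranspose_single,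
        Matrix.conjTranspose_conjTranspose, star_one, Matrix.mul_assoc]
    rw [Fintype.sum_prod_type, Finset.sum_comm]
    simp only [h2, ← Matrix.sum_mul, ← Matrix.mul_sum, hsum]
    rw [Matrix.trace_mul_comm, ← hH, hρ1, one_smul, Matrix.mul_one, ← hG]

theorem diamondNorm_depolarizing_le :
    diamondNorm (((2 : ℂ) ^ n)⁻¹ • rankOne (1 : Op n) 1) ≤ 1 := by
  have h0 : (0 : ℂ) ≤ ((2 : ℂ) ^ n)⁻¹ := by
    have : ((2 : ℂ) ^ n)⁻¹ = (((2 : ℝ) ^ n)⁻¹ : ℝ) := by push_cast; rfl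
    rw [this]
    exact_mod_cast (by positivity : (0 : ℝ) ≤ (2 ^ n)⁻¹)
  have h := diamondNorm_sum_rankOne_le (J := Unit) (ρ := fun _ => ((2 : ℂ) ^ n)⁻¹ • (1 : Op n))
    (M := fun _ => 1) (fun _ => Matrix.PosSemidef.one.smul h0) (fun _ => by simp)
    (fun _ => Matrix.PosSemidef.one) (by simp)
  have e : rankOne (((2 : ℂ) ^ n)⁻¹ • (1 : Op n)) 1 = ((2 : ℂ) ^ n)⁻¹ • rankOne 1 1 := by
    ext Y : 1
    rw [LinearMap.smul_apply, rankOne_apply, rankOne_apply, smul_comm]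
  simpa [e] using h

theorem diamondNorm_idSubDepol_le : diamondNorm (idSubDepol n) ≤ 2 := by
  have h1 := diamondNorm_sub_le LinearMap.id (((2 : ℂ) ^ n)⁻¹ • rankOne (1 : Op n) 1)
  have h2 := diamondNorm_id_le (n := n)
  have h3 := diamondNorm_depolarizing_le (n := n)
  rw [idSubDepol]
  linarith

theorem isHermitianPreserving_rankOne {a b : Op n} (ha : a.IsHermitian) (hb : b.IsHermitian) :
    IsHermitianPreserving (rankOne a b) := fun Y hY => by
  rw [rankOne_apply, Matrix.IsHermitian, Matrix.conjTranspose_smul, ha.eq,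
    ← Matrix.trace_conjTranspose, Matrix.conjTranspose_mul, hb.eq, hY.eq, Matrix.trace_mul_comm]

theorem posSemidef_sub_mul_self {M : Op n} (hM : M.PosSemidef) (hM1 : (1 - M).PosSemidef) :
    (M - M * M).PosSemidef := by
  have h1 := hM1.conjTranspose_mul_mul_same M
  have h2 := hM.conjTranspose_mul_mul_same (1 - M)
  have e : M - M * M = Mᴴ * (1 - M) * M + (1 - M)ᴴ * M * (1 - M) := by
    rw [hM.1.eq, hM1.1.eq]
    noncomm_ring
  rw [e]
  exact h1.add h2

end MeasurePrepare

/-! ### Hermitian-preserving superoperators with traceless range -/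

section ErrorSpace

/-- The real space of Hermitian-preserving superoperators whose values have trace zero. -/
def errorSpace (n : ℕ) : Submodule ℝ (Superop n) where
  carrier := {C | IsHermitianPreserving C ∧ ∀ Y, (C Y).trace = 0}
  add_mem' := fun {C C'} hC hC' => ⟨fun Y hY => (hC.1 Y hY).add (hC'.1 Y hY), fun Y => by
    rw [LinearMap.add_apply, Matrix.trace_add, hC.2, hC'.2, add_zero]⟩
  zero_mem' := ⟨fun Y _ => Matrix.isHermitian_zero, fun Y => by simp⟩
  smul_mem' := fun r C hC => ⟨fun Y hY => by
      rw [LinearMap.smul_apply, Matrix.IsHermitian, Matrix.conjTranspose_smul, (hC.1 Y hY).eq,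
        star_trivial], fun Y => by
      rw [LinearMap.smul_apply, Matrix.trace_smul, hC.2, smul_zero]⟩

variable {n : ℕ}

theorem real_smul_superop (r : ℝ) (C : Superop n) : r • C = (r : ℂ) • C := by
  ext Y : 1
  rw [LinearMap.smul_apply, LinearMap.smul_apply, Complex.coe_smul]

instance instNormedAddCommGroupErrorSpace : NormedAddCommGroup (errorSpace n) :=
  AddGroupNorm.toNormedAddCommGroup
    { toFun := fun C => diamondNorm (C : Superop n)
      map_zero' := diamondNorm_zero
      add_le' := fun C C' => diamondNorm_add_le (C : Superop n) C'
      neg' := fun C => diamondNorm_neg (C : Superop n)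
      eq_zero_of_map_eq_zero' := fun _ h => Subtype.ext (eq_zero_of_diamondNorm_eq_zero h) }

theorem norm_errorSpace (C : errorSpace n) : ‖C‖ = diamondNorm (C : Superop n) := rfl

instance instNormedSpaceErrorSpace : NormedSpace ℝ (errorSpace n) where
  norm_smul_le r C := by
    rw [norm_errorSpace, norm_errorSpace, Submodule.coe_smul, real_smul_superop, diamondNorm_smul,
      Complex.norm_real]

instance instFiniteDimensionalErrorSpace : FiniteDimensional ℝ (errorSpace n) := by
  have : FiniteDimensional ℝ (Superop n) := Module.Finite.trans ℂ _
  infer_instance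

theorem superTrace_eq_sum (C : Superop n) :
    superTrace n C = ∑ k, ∑ l, C (Matrix.single k l 1) k l := by
  rw [superTrace_apply, reshuffle_apply]
  simp only [Matrix.trace_sum, Matrix.mul_one, Matrix.trace_mul_single]
  simp

theorem star_superTrace {C : Superop n} (hC : IsHermitianPreserving C) :
    star (superTrace n C) = superTrace n C := by
  conv_rhs => rw [← isHermitianPreserving_iff.1 hC]
  rw [superTrace_eq_sum, superTrace_eq_sum, Finset.sum_comm, star_sum]
  refine Finset.sum_congr rfl fun k _ => ?_
  rw [star_sum]
  refine Finset.sum_congr rfl fun l _ => ?_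
  rw [superConj_single]

theorem ofReal_re_superTrace {C : Superop n} (hC : IsHermitianPreserving C) :
    (((superTrace n C).re : ℝ) : ℂ) = superTrace n C :=
  Complex.conj_eq_iff_re.1 (star_superTrace hC)

/-- The coefficient of `idSubDepol` in the Haar twirl. -/
def haarCoeff (n : ℕ) : errorSpace n →ₗ[ℝ] ℝ where
  toFun C := (superTrace n (C : Superop n)).re / ((2 ^ n) ^ 2 - 1)
  map_add' C C' := by rw [Submodule.coe_add, map_add, Complex.add_re, add_div]
  map_smul' r C := by
    rw [Submodule.coe_smul, real_smul_superop, map_smul, smul_eq_mul, Complex.re_ofReal_mul,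
      RingHom.id_apply, smul_eq_mul, mul_div_assoc]

theorem haarCoeff_apply (C : errorSpace n) :
    haarCoeff n C = (superTrace n (C : Superop n)).re / ((2 ^ n) ^ 2 - 1) := rfl

theorem idSubDepol_mem : idSubDepol n ∈ errorSpace n := by
  have e : ((2 : ℂ) ^ n)⁻¹ = (((2 : ℝ) ^ n)⁻¹ : ℝ) := by push_cast; rfl
  refine ⟨fun Y hY => ?_, fun Y => ?_⟩
  · refine hY.sub ?_
    rw [e, ← real_smul_superop, LinearMap.smul_apply, Matrix.IsHermitian,
      Matrix.conjTranspose_smul, star_trivial,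
      (isHermitianPreserving_rankOne Matrix.isHermitian_one Matrix.isHermitian_one Y hY).eq]
  · rw [idSubDepol, LinearMap.sub_apply, LinearMap.smul_apply, rankOne_apply, LinearMap.id_apply,
      Matrix.one_mul, Matrix.trace_sub, Matrix.trace_smul, Matrix.trace_smul, Matrix.trace_one]
    simp only [Fintype.card_fun, Fintype.card_fin, Nat.cast_pow, Nat.cast_ofNat, smul_eq_mul]
    have : (2 : ℂ) ^ n ≠ 0 := by positivity
    field_simp
    ring

theorem one_lt_two_pow_sq (hn : n ≠ 0) : (1 : ℝ) < (2 ^ n) ^ 2 :=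
  one_lt_pow₀ (one_lt_pow₀ one_lt_two hn) two_ne_zero

theorem coe_haarCoeff_smul (hn : n ≠ 0) (C : errorSpace n) :
    haarCoeff n C • idSubDepol n = twirl (haarSU n) (C : Superop n) := by
  rw [twirl_haarSU_eq hn C.2.2, real_smul_superop, haarCoeff_apply]
  congr 1
  push_cast
  rw [ofReal_re_superTrace C.2.1]

theorem haarCoeff_idSubDepol (hn : n ≠ 0) : haarCoeff n ⟨idSubDepol n, idSubDepol_mem⟩ = 1 := by
  rw [haarCoeff_apply]
  have h := superTrace_idSubDepol (n := n)
  have h2 : superTrace n (idSubDepol n) = (((2 ^ n) ^ 2 - 1 : ℝ) : ℂ) := by rw [h]; push_cast; rfl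
  rw [h2, Complex.ofReal_re, div_self (sub_pos.2 (one_lt_two_pow_sq hn)).ne']

theorem conjBy_idSubDepol (g : SU n) : conjBy g (idSubDepol n) = idSubDepol n := by
  rw [idSubDepol, map_sub, map_smul, conjBy_rankOne, Matrix.mul_one, coe_SU_conjTranspose_mul,
    conjBy_apply, LinearMap.id_comp, ← omega_mul, inv_mul_cancel, omega_one]

end ErrorSpace

/-! ### The norm of the reshuffled superoperator -/

section ReshuffleNorm

variable {n : ℕ}

/-- The Hermitian-preserving part of a superoperator. -/
def hermPart (C : Superop n) : Superop n := (1 / 2 : ℂ) • (C + superConj C)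

theorem superConj_add (C C' : Superop n) : superConj (C + C') = superConj C + superConj C' := by
  ext Y : 1
  simp [superConj_apply]

theorem superConj_smul (c : ℂ) (C : Superop n) : superConj (c • C) = star c • superConj C := by
  ext Y : 1
  simp [superConj_apply]

theorem superConj_superConj (C : Superop n) : superConj (superConj C) = C := by
  ext Y : 1
  simp [superConj_apply]

theorem isHermitianPreserving_hermPart (C : Superop n) : IsHermitianPreserving (hermPart C) := by
  rw [isHermitianPreserving_iff, hermPart, superConj_smul, superConj_add, superConj_superConj,
    add_comm]
  simp

theorem hermPart_add (C C' : Superop n) : hermPart (C + C') = hermPart C + hermPart C' := by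
  simp only [hermPart, superConj_add]
  module

theorem hermPart_neg (C : Superop n) : hermPart (-C) = -hermPart C := by
  rw [← neg_one_smul ℂ C, hermPart, hermPart, superConj_smul]
  simp only [star_neg, star_one]
  module

theorem hermPart_sub (C C' : Superop n) : hermPart (C - C') = hermPart C - hermPart C' := by
  rw [sub_eq_add_neg, hermPart_add, hermPart_neg, sub_eq_add_neg]

theorem hermPart_twirl (μ : Measure (SU n)) [IsProbabilityMeasure μ] (C : Superop n) :
    hermPart (twirl μ C) = twirl μ (hermPart C) := by
  rw [hermPart, hermPart, superConj_twirl, ← twirl_add, twirl_smul]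

theorem diamondNorm_hermPart_le (C : Superop n) : diamondNorm (hermPart C) ≤ diamondNorm C := by
  have h1 := diamondNorm_add_le C (superConj C)
  have h2 := diamondNorm_superConj_le C
  rw [hermPart, diamondNorm_smul]
  norm_num
  linarith

theorem eq_hermPart_add (C : Superop n) :
    C = hermPart C + Complex.I • hermPart (-Complex.I • C) := by
  simp only [hermPart, superConj_smul, star_neg, Complex.star_def, Complex.conj_I, neg_neg,
    smul_add, smul_smul]
  have h1 : Complex.I * (1 / 2 * -Complex.I) = 1 / 2 := by linear_combination (-1 / 2) * Complex.I_mul_I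
  have h2 : Complex.I * (1 / 2 * Complex.I) = -(1 / 2) := by linear_combination (1 / 2) * Complex.I_mul_I
  simp only [h1, h2]
  module

/-- The sum of the diamond norms of the two Hermitian-preserving parts of the reshuffled
superoperator. -/
def reshuffleNorm (C : Superop n) : ℝ :=
  diamondNorm (hermPart (reshuffle n C)) + diamondNorm (hermPart (-Complex.I • reshuffle n C))

theorem reshuffleNorm_nonneg (C : Superop n) : 0 ≤ reshuffleNorm C :=
  add_nonneg (diamondNorm_nonneg _) (diamondNorm_nonneg _)

theorem reshuffleNorm_sub_le (C C' : Superop n) :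
    reshuffleNorm (C - C') ≤ reshuffleNorm C + reshuffleNorm C' := by
  simp only [reshuffleNorm, map_sub, smul_sub, hermPart_sub]
  have h1 := diamondNorm_sub_le (hermPart (reshuffle n C)) (hermPart (reshuffle n C'))
  have h2 := diamondNorm_sub_le (hermPart (-Complex.I • reshuffle n C))
    (hermPart (-Complex.I • reshuffle n C'))
  linarith

theorem reshuffleNorm_le (C : Superop n) : reshuffleNorm C ≤ 2 * diamondNorm (reshuffle n C) := by
  have h1 := diamondNorm_hermPart_le (reshuffle n C)
  have h2 := diamondNorm_hermPart_le (-Complex.I • reshuffle n C)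
  rw [diamondNorm_smul] at h2
  simp only [norm_neg, Complex.norm_I, one_mul] at h2
  rw [reshuffleNorm]
  linarith

theorem diamondNorm_reshuffle_le (C : Superop n) :
    diamondNorm (reshuffle n C) ≤ reshuffleNorm C := by
  have h1 := diamondNorm_add_le (hermPart (reshuffle n C))
    (Complex.I • hermPart (-Complex.I • reshuffle n C))
  rw [← eq_hermPart_add, diamondNorm_smul, Complex.norm_I, one_mul] at h1
  exact h1

theorem reshuffleNorm_twirl_le (μ : Measure (SU n)) [IsProbabilityMeasure μ] (C : Superop n) :
    reshuffleNorm (twirl μ C) ≤ reshuffleNorm C := by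
  simp only [reshuffleNorm, reshuffle_twirl, ← twirl_smul, hermPart_twirl]
  exact add_le_add (diamondNorm_twirl_le μ _) (diamondNorm_twirl_le μ _)

/-- The twirl hypothesis concerns Hermitian-preserving maps only, and reshuffling need not preserve
that property. Hence `reshuffleNorm` adds two Hermitian-preserving parts, each of which commutes
with twirling. -/
theorem IsApproxTwirl.reshuffleNorm_sub_le {μ : Measure (SU n)} [IsProbabilityMeasure μ] {γ : ℝ}
    (h : IsApproxTwirl μ γ) (C : Superop n) :
    reshuffleNorm (twirl μ C - twirl (haarSU n) C) ≤ γ * reshuffleNorm C := by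
  simp only [reshuffleNorm, map_sub, smul_sub, reshuffle_twirl, ← twirl_smul, hermPart_sub,
    hermPart_twirl, mul_add]
  exact add_le_add (h.diamondNorm_sub_le (isHermitianPreserving_hermPart _))
    (h.diamondNorm_sub_le (isHermitianPreserving_hermPart _))

/-- The dimension factor is harmless: the estimate only supplies the a priori constant `K` of
`abs_eigenfunctional_le`, absent from its conclusion. -/
theorem diamondNorm_le_reshuffleNorm (C : Superop n) :
    diamondNorm C ≤ ((2 : ℝ) ^ n) ^ 4 * reshuffleNorm C := by
  refine (diamondNorm_le_sum C).trans ?_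
  have h : ∀ i j k l, ‖C (Matrix.single k l 1) i j‖ ≤ reshuffleNorm C := fun i j k l => by
    rw [← reshuffle_single_apply C i k j l]
    exact (norm_superop_single_le _ _ _ _ _).trans (diamondNorm_reshuffle_le C)
  calc ∑ i, ∑ j, ∑ k, ∑ l, ‖C (Matrix.single k l 1) i j‖
      ≤ ∑ _i : Bits n, ∑ _j : Bits n, ∑ _k : Bits n, ∑ _l : Bits n, reshuffleNorm C :=
        Finset.sum_le_sum fun i _ => Finset.sum_le_sum fun j _ => Finset.sum_le_sum fun k _ =>
          Finset.sum_le_sum fun l _ => h i j k l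
    _ = ((2 : ℝ) ^ n) ^ 4 * reshuffleNorm C := by
        simp only [Finset.sum_const, Finset.card_univ, Fintype.card_fun, Fintype.card_fin,
          nsmul_eq_mul, Nat.cast_pow, Nat.cast_ofNat]
        ring

section

open scoped Matrix.Norms.L2Operator

/-- The superoperator trace is `tr(R(1))` for the reshuffled map `R`, and `‖1‖₁ ≤ 2^n`. Divided by
`4^n - 1`, this is the gain of order `2^{-n}` in `haarCoeff`. -/
theorem norm_superTrace_le (C : Superop n) : ‖superTrace n C‖ ≤ 2 ^ n * reshuffleNorm C := by
  have h1 := norm_trace_mul_le_of_le (X := reshuffle n C 1) (Y := (1 : Op n)) opNorm_one_le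
  have h2 := traceNorm_apply_le (reshuffle n C) 1
  have h3 : traceNorm (1 : Op n) ≤ 2 ^ n := by
    simpa using traceNorm_one_le (ι := Bits n)
  have h4 := mul_le_mul (diamondNorm_reshuffle_le C) h3 (traceNorm_nonneg _)
    (reshuffleNorm_nonneg C)
  rw [Matrix.one_mul] at h1
  rw [superTrace_apply]
  linarith

end

end ReshuffleNorm

end XEB
end

noncomputable section

namespace XEB

namespace LinearXEB

variable {n : ℕ} (X : LinearXEB n)

/-! ### The signal of a linear XEB scheme -/

theorem diamondNorm_measurement_le : diamondNorm X.measurement ≤ 1 :=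
  diamondNorm_sum_rankOne_le
    (fun x => by
      rw [← Matrix.diagonal_single]
      exact Matrix.PosSemidef.diagonal (Pi.single_nonneg.2 zero_le_one))
    (fun x => Matrix.trace_single_eq_same x 1) X.posSemidef_M X.sum_M

theorem diamondNorm_signal_le : diamondNorm X.signal ≤ 2 := by
  have h1 := diamondNorm_sub_le X.measurement (((2 : ℂ) ^ n)⁻¹ • rankOne 1 1)
  have h2 := X.diamondNorm_measurement_le
  have h3 := diamondNorm_depolarizing_le (n := n)
  rw [signal]
  linarith

theorem isHermitianPreserving_measurement : IsHermitianPreserving X.measurement := fun Y hY => by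
  rw [measurement, LinearMap.sum_apply, Matrix.IsHermitian, Matrix.conjTranspose_sum]
  refine Finset.sum_congr rfl fun x _ => ?_
  exact isHermitianPreserving_rankOne (by rw [Matrix.IsHermitian, Matrix.conjTranspose_single,
    star_one]) (X.posSemidef_M x).1 Y hY

theorem trace_measurement_apply (Y : Op n) : (X.measurement Y).trace = Y.trace := by
  rw [measurement_apply, Matrix.trace_sum]
  simp only [Matrix.trace_smul, Matrix.trace_single_eq_same, smul_eq_mul, mul_one]
  rw [← Matrix.trace_sum, ← Matrix.sum_mul, X.sum_M, Matrix.one_mul]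

theorem signal_mem : X.signal ∈ errorSpace n := by
  have e : X.signal = (X.measurement - LinearMap.id) + idSubDepol n := by
    rw [signal, idSubDepol]
    abel
  rw [e]
  refine add_mem ⟨fun Y hY => (X.isHermitianPreserving_measurement Y hY).sub hY, fun Y => ?_⟩
    idSubDepol_mem
  rw [LinearMap.sub_apply, Matrix.trace_sub, trace_measurement_apply, LinearMap.id_apply, sub_self]

theorem posSemidef_one_sub_M (x : Bits n) : (1 - X.M x).PosSemidef := by
  rw [← X.sum_M, ← Finset.add_sum_erase _ _ (Finset.mem_univ x), add_sub_cancel_left]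
  exact Matrix.posSemidef_sum _ fun y _ => X.posSemidef_M y

/-- The reshuffled measurement is `Y ↦ ∑ E_xx Y M_x`, with `∑ E_xx = 1` and `∑ M_x² ≤ ∑ M_x = 1`. -/
theorem diamondNorm_reshuffle_measurement_le : diamondNorm (reshuffle n X.measurement) ≤ 1 := by
  have h := diamondNorm_sum_mul_mul_le (C := reshuffle n X.measurement)
    (A := fun x => Matrix.single x x 1) (B := X.M) (a := 1) (b := 1)
    (fun Y => by simp [measurement, reshuffle_rankOne, mulMul_apply])
    (by simp [Matrix.sum_single_one, Matrix.PosSemidef.zero])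
    (by
      rw [Complex.ofReal_one, one_smul]
      nth_rewrite 1 [← X.sum_M]
      rw [← Finset.sum_sub_distrib]
      refine Matrix.posSemidef_sum _ fun x _ => ?_
      rw [(X.posSemidef_M x).1.eq]
      exact posSemidef_sub_mul_self (X.posSemidef_M x) (X.posSemidef_one_sub_M x))
  simpa using h

theorem reshuffleNorm_signal_le : reshuffleNorm X.signal ≤ 2 * (1 + (2 ^ n)⁻¹) := by
  have h1 := diamondNorm_sub_le (reshuffle n X.measurement)
    (((2 : ℂ) ^ n)⁻¹ • reshuffle n (rankOne 1 1))
  have h2 : reshuffle n (rankOne 1 1) = LinearMap.id := by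
    rw [reshuffle_rankOne]
    ext Y : 1
    simp [mulMul_apply]
  have h3 := X.diamondNorm_reshuffle_measurement_le
  have h4 := mul_le_mul_of_nonneg_left (diamondNorm_id_le (n := n))
    (by positivity : (0 : ℝ) ≤ (2 ^ n)⁻¹)
  rw [← map_smul, ← map_sub, map_smul, h2, diamondNorm_smul, norm_inv, norm_pow,
    Complex.norm_ofNat] at h1
  have h5 := reshuffleNorm_le X.signal
  rw [signal] at h5 ⊢
  linarith

/-! ### The transfer operator on the error space -/

/-- The transfer operator as a real-linear map on the error space. -/
def errorTransfer : errorSpace n →ₗ[ℝ] errorSpace n :=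
  (X.transfer.restrictScalars ℝ).restrict fun _ hC =>
    ⟨X.isHermitianPreserving_transfer hC.1, X.trace_transfer_apply hC.2⟩

theorem coe_errorTransfer (C : errorSpace n) :
    (X.errorTransfer C : Superop n) = X.transfer C := rfl

theorem coe_errorTransfer_pow (m : ℕ) (C : errorSpace n) :
    ((X.errorTransfer ^ m) C : Superop n) = (X.transfer ^ m) C := by
  induction m with
  | zero => rfl
  | succ m ih =>
    rw [pow_succ', pow_succ', Module.End.mul_apply, Module.End.mul_apply, coe_errorTransfer, ih]

end LinearXEB

/-- The twirling map as a real-linear map on the error space. -/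
def errorTwirl {n : ℕ} (μ : Measure (SU n)) [IsProbabilityMeasure μ] :
    errorSpace n →ₗ[ℝ] errorSpace n where
  toFun C := ⟨twirl μ C, isHermitianPreserving_twirl μ C.2.1, fun Y => by
    let f : Superop n →ₗ[ℂ] ℂ := Matrix.traceLinearMap (Bits n) ℂ ℂ ∘ₗ LinearMap.applyₗ Y
    change f (twirl μ (C : Superop n)) = 0
    rw [twirl_eq_superIntegral, linearMap_superIntegral (superIntegrable_conjBy μ _)]
    have : ∀ g : SU n, f (conjBy g (C : Superop n)) = 0 := by
      intro g
      change (omega g⁻¹ ((C : Superop n) (omega g Y))).trace = 0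
      rw [omega_apply, Matrix.trace_mul_comm, ← Matrix.mul_assoc, coe_SU_conjTranspose_mul,
        Matrix.one_mul, C.2.2]
    simp [this]⟩
  map_add' C C' := Subtype.ext (twirl_add μ _ _)
  map_smul' r C := Subtype.ext (by
    change twirl μ (r • (C : Superop n)) = r • twirl μ (C : Superop n)
    rw [real_smul_superop, real_smul_superop, twirl_smul])

theorem coe_errorTwirl {n : ℕ} (μ : Measure (SU n)) [IsProbabilityMeasure μ] (C : errorSpace n) :
    (errorTwirl μ C : Superop n) = twirl μ C := rfl

theorem abs_haarCoeff_le {n : ℕ} (hn : n ≠ 0) (C : errorSpace n) :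
    |haarCoeff n C| ≤ 2 ^ n / ((2 ^ n) ^ 2 - 1) * reshuffleNorm (C : Superop n) := by
  have h0 : (0 : ℝ) < (2 ^ n) ^ 2 - 1 := sub_pos.2 (one_lt_two_pow_sq hn)
  rw [haarCoeff_apply, abs_div, abs_of_pos h0, div_mul_eq_mul_div]
  refine div_le_div_of_nonneg_right ?_ h0.le
  exact (Complex.abs_re_le_norm _).trans (norm_superTrace_le _)

theorem exists_abs_le_mul_reshuffleNorm {n : ℕ} (L : errorSpace n →ₗ[ℝ] ℝ) :
    ∃ K : ℝ, ∀ C, |L C| ≤ K * reshuffleNorm (C : Superop n) := by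
  let f := LinearMap.toContinuousLinearMap L
  refine ⟨‖f‖ * (2 ^ n) ^ 4, fun C => ?_⟩
  have h1 : |L C| ≤ ‖f‖ * ‖C‖ := f.le_opNorm C
  have h2 := mul_le_mul_of_nonneg_left (diamondNorm_le_reshuffleNorm (C : Superop n))
    (norm_nonneg f)
  rw [norm_errorSpace] at h1
  rw [mul_assoc]
  exact h1.trans h2

namespace LinearXEB

variable {n : ℕ} (X : LinearXEB n)

theorem exists_qR_decay (hn : n ≠ 0) {γ δ : ℝ} (htwirl : IsApproxTwirl X.gateLaw γ)
    (herror : X.avgError ≤ δ) (hγδ : 11 * δ ≤ 1 - γ) (hγ1 : γ < 1) :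
    ∃ B p : ℝ, 1 - 2 * δ ≤ p ∧ p ≤ 1 ∧ |B| ≤ 128 ∧
      ∀ m : ℕ, |X.qR m - B * p ^ m| ≤ 8 * 2 ^ n * (γ + 3 * δ) ^ m := by
  have hγ := htwirl.nonneg
  have hδ : 0 ≤ δ := X.avgError_nonneg.trans herror
  let E₀ : errorSpace n := ⟨idSubDepol n, idSubDepol_mem⟩
  have hE₀ : haarCoeff n E₀ = 1 := haarCoeff_idSubDepol hn
  have hΛE : errorTwirl X.gateLaw E₀ = E₀ :=
    Subtype.ext (twirl_of_forall _ conjBy_idSubDepol)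
  have hLΛ : ∀ v, haarCoeff n (errorTwirl X.gateLaw v) = haarCoeff n v := fun v => by
    rw [haarCoeff_apply, coe_errorTwirl, superTrace_twirl, haarCoeff_apply]
  have hcoe : ∀ v, ((haarCoeff n v • E₀ : errorSpace n) : Superop n) = twirl (haarSU n) v :=
    fun v => coe_haarCoeff_smul hn v
  obtain ⟨p, E, L, hp, hp1, hE, hLE, hLT, hpow⟩ := exists_eigenvalue_of_perturbation
    (T := X.errorTransfer) (Λ := errorTwirl X.gateLaw) hγ hγ1 hδ hγδ hE₀ hΛE hLΛ
    (fun v => by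
      rw [norm_errorSpace, hcoe]
      exact diamondNorm_twirl_le _ _)
    (fun v => by
      rw [norm_errorSpace, Submodule.coe_sub, hcoe]
      exact htwirl.diamondNorm_sub_le v.2.1)
    (fun v => by
      rw [norm_errorSpace, Submodule.coe_sub]
      exact (X.diamondNorm_transfer_sub_twirl_le _).trans
        (mul_le_mul_of_nonneg_right herror (diamondNorm_nonneg _)))
    (fun v => X.diamondNorm_transfer_le _)
  obtain ⟨K, hK⟩ := exists_abs_le_mul_reshuffleNorm L
  let D : errorSpace n := ⟨X.signal, X.signal_mem⟩
  have hLD := abs_eigenfunctional_le (T := X.errorTransfer) (Λ := errorTwirl X.gateLaw)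
    (N := fun v : errorSpace n => reshuffleNorm (v : Superop n))
    (fun v => reshuffleNorm_nonneg _) (fun v w => reshuffleNorm_sub_le _ _)
    hγ1 hδ hγδ hp hE₀ hLΛ hΛE
    (fun v => by
      rw [hcoe]
      exact reshuffleNorm_twirl_le _ _)
    (fun v => by
      rw [Submodule.coe_sub, hcoe]
      exact htwirl.reshuffleNorm_sub_le _)
    -- The factor `2` comes from replacing `‖R‖_⋄` by the sum over two Hermitian-preserving parts;
    -- `abs_eigenfunctional_le` allows `2δ` for this reason.
    (fun v => by
      rw [Submodule.coe_sub, mul_assoc]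
      refine (reshuffleNorm_le _).trans (mul_le_mul_of_nonneg_left ?_ zero_le_two)
      exact (X.diamondNorm_reshuffle_transfer_sub_twirl_le _).trans
        (mul_le_mul herror (diamondNorm_reshuffle_le _) (diamondNorm_nonneg _) hδ))
    (abs_haarCoeff_le hn) hLT hK D
  have hρ : traceNorm X.ρ₀ ≤ 1 := by
    have := traceNorm_le_trace X.posSemidef_ρ₀
    rwa [X.trace_ρ₀, Complex.one_re] at this
  have hentry : ∀ C : errorSpace n, |((C : Superop n) X.ρ₀ 0 0).re| ≤ ‖C‖ := fun C =>
    (Complex.abs_re_le_norm _).trans ((norm_entry_le_traceNorm _ _ _).trans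
      ((traceNorm_apply_le (C : Superop n) _).trans
        (mul_le_of_le_one_right (diamondNorm_nonneg _) hρ)))
  have hE₀n : ‖E₀‖ ≤ 2 := diamondNorm_idSubDepol_le
  have hDn : ‖D‖ ≤ 2 := X.diamondNorm_signal_le
  -- With `d = 2^n ≥ 2`, the reshuffled norm gives `d |L D| ≤ (36/5) d/(d - 1) ≤ 72/5`, and `‖E‖ ≤
  -- 2‖E₀‖ ≤ 4`; the product is below `128`. The error constant is `8 = 4‖D‖` with `‖D‖ ≤ 2`.
  refine ⟨2 ^ n * (L D * ((E : Superop n) X.ρ₀ 0 0).re), p, hp, hp1, ?_, fun m => ?_⟩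
  · have hd : (2 : ℝ) ≤ 2 ^ n := by
      simpa using pow_le_pow_right₀ (one_le_two (α := ℝ)) (Nat.one_le_iff_ne_zero.2 hn)
    set d : ℝ := 2 ^ n
    have hd0 : 0 < d := by linarith
    have hd1 : 0 < d ^ 2 - 1 := by nlinarith
    have h1 := (hentry E).trans hE
    have h2 : reshuffleNorm (D : Superop n) ≤ 2 * (1 + d⁻¹) := X.reshuffleNorm_signal_le
    have hκ : 0 ≤ d / (d ^ 2 - 1) := by positivity
    have h3 : |L D| ≤ 9 / 5 * 2 * (d / (d ^ 2 - 1)) * (2 * (1 + d⁻¹)) := by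
      refine hLD.trans (mul_le_mul ?_ h2 (reshuffleNorm_nonneg _) (by positivity))
      refine mul_le_mul_of_nonneg_right ?_ hκ
      linarith
    have h4 : 9 / 5 * 2 * (d / (d ^ 2 - 1)) * (2 * (1 + d⁻¹)) = 36 / 5 / (d - 1) := by
      have : d - 1 ≠ 0 := by linarith
      have : d ^ 2 - 1 ≠ 0 := hd1.ne'
      field_simp
      ring
    have h5 : d * (36 / 5 / (d - 1)) ≤ 72 / 5 := by
      rw [← mul_div_assoc, div_le_iff₀ (by linarith)]
      linarith
    rw [h4] at h3
    rw [abs_mul, abs_mul, abs_of_pos hd0, ← mul_assoc]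
    have h6 : d * |L D| ≤ 72 / 5 := (mul_le_mul_of_nonneg_left h3 hd0.le).trans h5
    have h7 := mul_le_mul h6 (h1.trans (by linarith : _ ≤ (4 : ℝ))) (abs_nonneg _) (by norm_num)
    linarith
  · have h1 := hentry ((X.errorTransfer ^ m) D - (p ^ m * L D) • E)
    have h2 := hpow m D
    have h3 : X.qR m - 2 ^ n * (L D * ((E : Superop n) X.ρ₀ 0 0).re) * p ^ m
        = 2 ^ n * ((((X.errorTransfer ^ m) D - (p ^ m * L D) • E : errorSpace n) : Superop n)
          X.ρ₀ 0 0).re := by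
      rw [qR_eq_signal, Submodule.coe_sub, coe_errorTransfer_pow, Submodule.coe_smul,
        real_smul_superop, LinearMap.sub_apply, Matrix.sub_apply, LinearMap.smul_apply,
        Matrix.smul_apply, smul_eq_mul, Complex.sub_re, Complex.re_ofReal_mul]
      ring
    have hpw : 0 ≤ (γ + 3 * δ) ^ m := by positivity
    have h4 := mul_le_mul_of_nonneg_left hDn (by positivity : 0 ≤ 4 * (γ + 3 * δ) ^ m)
    rw [h3, abs_mul, abs_of_pos (by positivity)]
    have h5 := mul_le_mul_of_nonneg_left (h1.trans (h2.trans h4)) (by positivity : (0 : ℝ) ≤ 2 ^ n)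
    linarith

theorem abs_qR_le (m : ℕ) : |X.qR m| ≤ 2 * 2 ^ n := by
  have hpow : diamondNorm ((X.transfer ^ m) X.signal) ≤ 2 := by
    induction m with
    | zero => exact X.diamondNorm_signal_le
    | succ m ih =>
      rw [pow_succ', Module.End.mul_apply]
      exact (X.diamondNorm_transfer_le _).trans ih
  have hρ : traceNorm X.ρ₀ ≤ 1 := by
    have := traceNorm_le_trace X.posSemidef_ρ₀
    rwa [X.trace_ρ₀, Complex.one_re] at this
  have h : |((X.transfer ^ m) X.signal X.ρ₀ 0 0).re| ≤ 2 :=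
    (Complex.abs_re_le_norm _).trans ((norm_entry_le_traceNorm _ _ _).trans
      ((traceNorm_apply_le _ _).trans
        ((mul_le_of_le_one_right (diamondNorm_nonneg _) hρ).trans hpow)))
  rw [qR_eq_signal, abs_mul, abs_of_pos (by positivity)]
  have := mul_le_mul_of_nonneg_left h (by positivity : (0 : ℝ) ≤ 2 ^ n)
  linarith

/-- In dimension one, traceless range means zero, so the signal vanishes. -/
theorem qR_eq_zero (h : n = 0) (m : ℕ) : X.qR m = 0 := by
  subst h
  have h1 : X.signal = 0 := by
    refine superop_ext_single fun i j k l => ?_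
    have h2 := X.signal_mem.2 (Matrix.single k l 1)
    rw [Matrix.trace, Fintype.sum_unique, Matrix.diag_apply] at h2
    rw [Subsingleton.elim i default, Subsingleton.elim j default]
    exact h2
  rw [qR_eq_signal, h1, map_zero]
  simp

end LinearXEB

end XEB
end

/-! ### The main theorem, with the degenerate cases. -/

theorem theorem1 (n : ℕ) (X : XEB.LinearXEB n) (γ δ : ℝ)
    (htwirl : XEB.IsApproxTwirl X.gateLaw γ)
    (herror : X.avgError ≤ δ)
    (hδ : δ ≤ (1 - γ) / 11) :
    ∃ A B p : ℝ, p ∈ Set.Icc (1 - 2 * δ) 1 ∧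
      (∀ m : ℕ, |X.qR m - (A + B * p ^ m)| ≤ 16 * 2 ^ n * (γ + 6 * δ) ^ m) ∧
      (p < 1 → A = 0 ∧ |B| ≤ 128) := by
  have hγ := htwirl.nonneg
  have hδ0 : 0 ≤ δ := X.avgError_nonneg.trans herror
  have hγδ : 11 * δ ≤ 1 - γ := by linarith
  -- For `n = 0` the Haar coefficient would divide by `4^n - 1 = 0`, but `q_R` vanishes. The choice
  -- `p = 1` makes the last clause vacuous.
  rcases eq_or_ne n 0 with hn | hn
  · refine ⟨0, 0, 1, ⟨by linarith, le_rfl⟩, fun m => ?_, fun h => absurd h (lt_irrefl _)⟩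
    rw [X.qR_eq_zero hn]
    simp only [zero_mul, add_zero, sub_zero, abs_zero]
    positivity
  rcases lt_or_ge γ 1 with hγ1 | hγ1
  · obtain ⟨B, p, hp, hp1, hB, hq⟩ := X.exists_qR_decay hn htwirl herror hγδ hγ1
    refine ⟨0, B, p, ⟨hp, hp1⟩, fun m => ?_, fun _ => ⟨rfl, hB⟩⟩
    rw [zero_add]
    refine (hq m).trans ?_
    have h1 : (γ + 3 * δ) ^ m ≤ (γ + 6 * δ) ^ m :=
      pow_le_pow_left₀ (by positivity) (by linarith) m
    have h2 : (0 : ℝ) ≤ (γ + 3 * δ) ^ m := by positivity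
    exact mul_le_mul (by linarith [show (0 : ℝ) ≤ 2 ^ n by positivity]) h1 h2 (by positivity)
  -- Since `δ ≥ 0`, this case forces `γ = 1` and `δ = 0`: there is no decay to prove, and `|q_R| ≤ 2
  -- · 2^n` suffices.
  · refine ⟨0, 0, 1, ⟨by linarith, le_rfl⟩, fun m => ?_, fun h => absurd h (lt_irrefl _)⟩
    simp only [zero_mul, add_zero, sub_zero]
    refine (X.abs_qR_le m).trans ?_
    have h1 : 1 ≤ (γ + 6 * δ) ^ m := one_le_pow₀ (by linarith)
    have h2 : (0 : ℝ) < 2 ^ n := by positivity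
    nlinarith
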